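/- **Theorem 3 (protocol for privacy level 2).** Let $H:\{0,1\}^{\kappa_1}\times\{0,1\}^*\to\{0,1\}^{\kappa_2}$ be a random oracle, where $\kappa_1,\kappa_2$ depend on the security parameter $\kappa$ and $2^{-\kappa_1},2^{-\kappa_2}$ are negligible in $\kappa$. Data owner $P_1$ holds $(x_i,u_i)_{i<n}$ and $P_2$ holds $(y_j,v_j)_{j<m}$, with distinct identifiers $x_i$ (resp. $y_j$) in $\{0,1\}^*$ and attributes $u_i\in\{0,1\}^{l_1}$, $v_j\in\{0,1\}^{l_2}$; $X$ and $Y$ are the sets of identifiers; the server has no input. *Ideal functionality $\mathcal F_{psa}$ (level 2).* The rows $(u_z,v_z)$, $z\in X\cap Y$, in uniformly random order, are split into fresh XOR shares; $P_1$ and $P_2$ each receive one share of every row, and the server receives $(|X\cap Y|,n,m)$. *Protocol.* (1) $P_1,P_2$ agree on a uniform key $r\in\{0,1\}^{\kappa_1}$. (2), (3) Each data owner shuffles its dataset uniformly and sends the vector $\tilde X=(H(r,x_i))_i$, resp. $\tilde Y=(H(r,y_j))_j$, to the server over a secure channel. (4), (5) The server computes $c=|\tilde X\cap\tilde Y|$,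 lists the positions of the common values in random order, and obtains injections $\pi_1:[c]\to[n]$, $\pi_2:[c]\to[m]$ with $\tilde X_{\pi_1(i)}=\tilde Y_{\pi_2(i)}$. (6), (7) The server (as receiver, with input $\pi_1$) and $P_1$ (as sender, with its shuffled vector $U$) run the modified oblivious switching network (OSN); the server sends its output shares to $P_2$. (8) The same is done with $\pi_2$, $P_2$ and $V$, the server sending its shares to $P_1$. In the modified OSN on $N$ wires with target $\pi:[c]\to[N]$, the receiver programmes the generalized Beneš network by the looping algorithm for a uniform bijection $\rho_1$ of $[N]$; the sender puts uniform labels on the wires and sends its input vector masked by the labels of the network's incoming wires. A gate has incoming labels $a_0,a_1$ and outgoing labels $b_0,b_1$, and the receiver obtains by 1-out-of-2 oblivious transfer (OT) $(a_0\oplus b_0\,\|\,a_1\oplus b_1)$ if the gate is straight-through, or $(a_0\oplus b_1\,\|\,a_1\oplus b_0)$ if it is crossed. The receiver evaluates the network, sends $\rho_2=\rho_1^{-1}\circ\pi$ to the sender, and the shares of entry $i$ are the label of the outgoing wire $\rho_2(i)$ of the network (sender) and the masked value evaluated there (receiver). Key agreement and OT are used as ideal functionalities. *Claim.* The protocol realizes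 $\mathcal F_{psa}$ at privacy level 2 against semi-honest, non-colluding parties. That is, there are probabilistic polynomial-time simulators $\mathsf{Sim}_1,\mathsf{Sim}_2,\mathsf{Sim}$ such that, for all datasets of polynomially bounded sizes $n,m$ and every (even computationally unbounded) distinguisher that makes polynomially many queries to $H$, the advantage in telling apart the two sides of each of the following is at most a negligible function of $\kappa$, which depends only on $\kappa_1,\kappa_2$ and the polynomial bounds: 1. for $k=1,2$: the view of $P_k$ together with the outputs of all parties in the protocol, and the output of $\mathsf{Sim}_k$, which is given only the dataset of $P_k$ and its output from $\mathcal F_{psa}$ (and the public parameters $\kappa,\kappa_1,\kappa_2,l_1,l_2$), together with the outputs of $\mathcal F_{psa}$ to all parties. In particular the shares reconstruct the inner join except with negligible probability, and neither data owner learns more about $X\cap Y$ than its cardinality; 2. the view of the server together with its output in the protocol, and the output of $\mathsf{Sim}$, which is given only $(|X\cap Y|,n,m)$ (and the public parameters), together with $(|X\cap Y|,n,m)$. -/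

import Mathlib

open MeasureTheory

namespace PSA

/-! ## Bit strings and the random oracle -/

/-- Bit strings of length `k`. -/
abbrev Str (k : ℕ) : Type := Fin k → Bool

/-- Bitwise exclusive or. -/
def Str.xor {k : ℕ} (a b : Str k) : Str k := fun i => Bool.xor (a i) (b i)

/-- Functions `{0,1}^κ₁ × {0,1}^* → {0,1}^κ₂`. -/
abbrev Oracle (κ₁ κ₂ : ℕ) : Type := Str κ₁ × List Bool → Str κ₂

/-- The random oracle: all values `H (r, x)` are independent and uniform on `{0,1}^κ₂`. -/
noncomputable def randomOracle (κ₁ κ₂ : ℕ) : Measure (Oracle κ₁ κ₂) :=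
  Measure.infinitePi fun _ => (PMF.uniformOfFintype (Str κ₂)).toMeasure

/-! ## The generalized Beneš network

A network on a list of wire tracks is written as the list of its base switch gates, from the input
layer to the output layer. A gate is the pair of tracks it acts on. For `N ≥ 3` tracks there is an
input layer of `⌊N/2⌋` gates, then an upper sub-network on `⌊N/2⌋` tracks (the first track of
every gate), a lower sub-network on `⌈N/2⌉` tracks (the second track of every gate and, for odd
`N`, the last track), and an output layer of `⌊N/2⌋` gates. The hard-coded connections are the
tracks themselves. -/

section Network

variable {α : Type}

/-- One layer of gates: consecutive tracks are paired. -/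
def layer : List α → List (α × α)
  | a :: b :: t => (a, b) :: layer t
  | _ => []

/-- The tracks of the upper sub-network. -/
def upper : List α → List α
  | a :: _ :: t => a :: upper t
  | _ => []

/-- The tracks of the lower sub-network. -/
def lower : List α → List α
  | _ :: b :: t => b :: lower t
  | [a] => [a]
  | [] => []

theorem length_upper : ∀ l : List α, (upper l).length = l.length / 2
  | [] => by simp [upper]
  | [_] => by simp [upper]
  | _ :: _ :: t => by
    have := length_upper t
    simp only [upper, List.length_cons]
    omega

theorem length_lower : ∀ l : List α, (lower l).length = (l.length + 1) / 2
  | [] => by simp [lower]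
  | [_] => by simp [lower]
  | _ :: _ :: t => by
    have := length_lower t
    simp only [lower, List.length_cons]
    omega

/-- The gates of the generalized Beneš network on the given tracks. -/
def benes : List α → List (α × α)
  | [] => []
  | [_] => []
  | [a, b] => [(a, b)]
  | a :: b :: c :: t =>
    layer (a :: b :: c :: t) ++ benes (upper (a :: b :: c :: t)) ++
      benes (lower (a :: b :: c :: t)) ++ layer (a :: b :: c :: t)
termination_by l => l.length
decreasing_by
  · rw [length_upper]; simp only [List.length_cons]; omega
  · rw [length_lower]; simp only [List.length_cons]; omega

end Network

/-- The gates of the network on the tracks `0, …, N-1`. -/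
def gates (N : ℕ) : List (Fin N × Fin N) := benes (List.finRange N)

/-- The number of base switch gates. -/
abbrev numGates (N : ℕ) : ℕ := (gates N).length

/-! ### Programming the network (looping)

A permutation `ρ` of `[N]` asks that output `j` carry input `ρ j`. The vertices `0, …, N-1` (the
inputs) are joined when they are dual (same gate of the input layer) or when they leave through the
same gate of the output layer. -/

/-- The constraint graph of `ρ`. -/
def loopGraph (N : ℕ) (ρ : ℕ → ℕ) : SimpleGraph ℕ :=
  SimpleGraph.fromRel fun i j =>
    (i < N ∧ j < N ∧ i / 2 = j / 2) ∨
      ∃ a b, a < N ∧ b < N ∧ a / 2 = b / 2 ∧ ρ a = i ∧ ρ b = j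

open Classical in
/-- The two-colouring found by graph search. Each connected component is coloured alternately from
a root: for odd `N` the vertex `N-1` is a root of colour `true` (lower sub-network), every other
component has its smallest vertex as a root of colour `false` (upper sub-network). -/
noncomputable def colour (N : ℕ) (ρ : ℕ → ℕ) (i : ℕ) : Bool :=
  if N % 2 = 1 ∧ (loopGraph N ρ).Reachable (N - 1) i then
    decide (Even ((loopGraph N ρ).dist (N - 1) i))
  else
    decide (Odd ((loopGraph N ρ).dist (sInf {v | (loopGraph N ρ).Reachable v i}) i))

/-- The switches (`false` = straight-through, `true` = crossover) that programme the network on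
`N` tracks for `ρ`, in the order of `gates N`. -/
noncomputable def looping (N : ℕ) (ρ : ℕ → ℕ) : List Bool :=
  if N ≤ 1 then []
  else if N = 2 then [decide (ρ 0 ≠ 0)]
  else
    ((List.range (N / 2)).map fun i => colour N ρ (2 * i)) ++
    looping (N / 2) (fun k =>
      if colour N ρ (ρ (2 * k)) = false then ρ (2 * k) / 2 else ρ (2 * k + 1) / 2) ++
    looping ((N + 1) / 2) (fun k =>
      if 2 * k + 1 < N ∧ colour N ρ (ρ (2 * k)) = false then ρ (2 * k + 1) / 2
      else ρ (2 * k) / 2) ++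
    ((List.range (N / 2)).map fun i => colour N ρ (ρ (2 * i)))
termination_by N
decreasing_by
  · omega
  · omega

/-- The switch of gate `k` when the network is programmed for the permutation `ρ`. -/
noncomputable def switch {N : ℕ} (ρ : Equiv.Perm (Fin N)) (k : Fin (numGates N)) : Bool :=
  (looping N fun i => if h : i < N then (ρ ⟨i, h⟩ : ℕ) else i).getD k false

/-! ## The modified oblivious switching network

The sender holds the vector `u`, the receiver a map `π : [c] → [N]`. The 1-out-of-2 oblivious
transfers are ideal: the sender inputs two messages and receives nothing, the receiver inputs a bit
and receives the selected message. -/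

/-- The random wire labels of the sender: labels `A` of the incoming wires of the network and, for
every gate, labels of its two outgoing wires. -/
abbrev Wires (N l : ℕ) : Type := (Fin N → Str l) × (Fin (numGates N) → Str l × Str l)

/-- Passing gate `k` replaces the labels on its two tracks by the labels of its outgoing wires. -/
def relabel {N l : ℕ} (W : Wires N l) (a : Fin N → Str l) (k : Fin (numGates N)) : Fin N → Str l :=
  Function.update (Function.update a ((gates N).get k).1 (W.2 k).1) ((gates N).get k).2 (W.2 k).2

/-- The labels on the tracks just before gate `k`. -/
def labelsBefore {N l : ℕ} (W : Wires N l) (k : Fin (numGates N)) : Fin N → Str l :=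
  ((List.finRange (numGates N)).take k).foldl (relabel W) W.1

/-- The labels `B_R` on the outgoing wires of the network. -/
def outLabels {N l : ℕ} (W : Wires N l) : Fin N → Str l :=
  (List.finRange (numGates N)).foldl (relabel W) W.1

/-- The two messages that the sender inputs to the oblivious transfer of gate `k`. -/
def otMessages {N l : ℕ} (W : Wires N l) (k : Fin (numGates N)) :
    (Str l × Str l) × (Str l × Str l) :=
  let a₀ := labelsBefore W k ((gates N).get k).1
  let a₁ := labelsBefore W k ((gates N).get k).2
  let b₀ := (W.2 k).1
  let b₁ := (W.2 k).2
  ((a₀.xor b₀, a₁.xor b₁), (a₀.xor b₁, a₁.xor b₀))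

/-- The ideal 1-out-of-2 oblivious transfer. -/
def idealOT {α : Type} (msgs : α × α) (s : Bool) : α := if s then msgs.2 else msgs.1

/-- The masked vector that the sender sends to the receiver. -/
def maskedInput {N l : ℕ} (W : Wires N l) (u : Fin N → Str l) : Fin N → Str l :=
  fun j => (u j).xor (W.1 j)

/-- What the receiver, whose network is programmed for `ρ`, obtains from the transfers. -/
noncomputable def otOutputs {N l : ℕ} (W : Wires N l) (ρ : Equiv.Perm (Fin N)) :
    Fin (numGates N) → Str l × Str l :=
  fun k => idealOT (otMessages W k) (switch ρ k)

/-- The receiver passes gate `k` with switch `s k`, having obtained `t k` from its transfer. -/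
def evalGate {N l : ℕ} (s : Fin (numGates N) → Bool) (t : Fin (numGates N) → Str l × Str l)
    (w : Fin N → Str l) (k : Fin (numGates N)) : Fin N → Str l :=
  let i := ((gates N).get k).1
  let j := ((gates N).get k).2
  let x := (w i).xor (t k).1
  let y := (w j).xor (t k).2
  if s k then Function.update (Function.update w i y) j x
  else Function.update (Function.update w i x) j y

/-- The receiver's evaluation of the network on the masked vector. -/
def evaluate {N l : ℕ} (s : Fin (numGates N) → Bool) (t : Fin (numGates N) → Str l × Str l)
    (w : Fin N → Str l) : Fin N → Str l :=
  (List.finRange (numGates N)).foldl (evalGate s t) w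

/-- The map `ρ₂` with `ρ₁ (ρ₂ i) = π i` that the receiver sends to the sender. -/
def rho₂ {N c : ℕ} (ρ₁ : Equiv.Perm (Fin N)) (π : Fin c → Fin N) : Fin c → Fin N :=
  fun i => ρ₁.symm (π i)

/-- The sender's output shares. -/
def senderShares {N l c : ℕ} (W : Wires N l) (r₂ : Fin c → Fin N) : Fin c → Str l :=
  fun i => outLabels W (r₂ i)

/-- The receiver's output shares, computed from the messages it received. -/
noncomputable def receiverShares {N l c : ℕ} (ρ₁ : Equiv.Perm (Fin N)) (masked : Fin N → Str l)
    (t : Fin (numGates N) → Str l × Str l) (r₂ : Fin c → Fin N) : Fin c → Str l :=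
  fun i => evaluate (switch ρ₁) t masked (r₂ i)

/-! ## Datasets and the ideal functionality -/

/-- A dataset: distinct identifiers, each with an attribute of `l` bits. -/
structure Dataset (l : ℕ) where
  size : ℕ
  id : Fin size → List Bool
  id_injective : Function.Injective id
  attr : Fin size → Str l

/-- The identifiers of a dataset. -/
def Dataset.ids {l : ℕ} (D : Dataset l) : Finset (List Bool) := Finset.univ.image D.id

/-- A list of shares of rows `(u, v)`. -/
abbrev Shares (l₁ l₂ : ℕ) : Type := List (Str l₁ × Str l₂)

/-- Outputs: shares of `P₁`, shares of `P₂`, and the triple `(c, n, m)` of the server. -/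
structure Outputs (l₁ l₂ : ℕ) where
  out₁ : Shares l₁ l₂
  out₂ : Shares l₁ l₂
  outS : ℕ × ℕ × ℕ

/-- The rows `(u_z, v_z)`, `z ∈ X ∩ Y`, of the inner join. -/
def joinRows {l₁ l₂ : ℕ} (D₁ : Dataset l₁) (D₂ : Dataset l₂) : List (Str l₁ × Str l₂) :=
  (((List.finRange D₁.size) ×ˢ (List.finRange D₂.size)).filter
    fun p => D₁.id p.1 = D₂.id p.2).map fun p => (D₁.attr p.1, D₂.attr p.2)

/-- The ideal functionality at privacy level 2: the rows of the inner join, in uniformly random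
order, are split into fresh exclusive-or shares for the two data owners, and the server obtains
`(|X ∩ Y|, n, m)`. -/
noncomputable def idealPSA {l₁ l₂ : ℕ} (D₁ : Dataset l₁) (D₂ : Dataset l₂) :
    PMF (Outputs l₁ l₂) := do
  let τ ← PMF.uniformOfFintype (Equiv.Perm (Fin (joinRows D₁ D₂).length))
  let s ← PMF.uniformOfFintype (Fin (joinRows D₁ D₂).length → Str l₁ × Str l₂)
  return {
    out₁ := List.ofFn s
    out₂ := List.ofFn fun i =>
      ((s i).1.xor ((joinRows D₁ D₂).get (τ i)).1, (s i).2.xor ((joinRows D₁ D₂).get (τ i)).2)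
    outS := ((D₁.ids ∩ D₂.ids).card, D₁.size, D₂.size) }

/-! ## The server-aided protocol -/

/-- The pairs `(K, J)` of positions of the common hash values: for each value in both vectors, its
first position in `x` and its first position in `y`. -/
def matchPairs {n m k : ℕ} (x : Fin n → Str k) (y : Fin m → Str k) : List (Fin n × Fin m) :=
  (List.finRange m).filterMap fun j =>
    if ∀ j' < j, y j' ≠ y j then
      ((List.finRange n).find? fun i => decide (x i = y j)).map fun i => (i, j)
    else none

/-- The record of one execution of the protocol. -/
structure Execution (n m κ₁ κ₂ l₁ l₂ : ℕ) where
  /-- the key agreed by the data owners -/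
  key : Str κ₁
  /-- the shuffles applied by the data owners to their datasets -/
  shuffle₁ : Equiv.Perm (Fin n)
  shuffle₂ : Equiv.Perm (Fin m)
  /-- the wire labels chosen by the data owners as senders of the switching networks -/
  wires₁ : Wires n l₁
  wires₂ : Wires m l₂
  /-- the hash vectors sent to the server -/
  hash₁ : Fin n → Str κ₂
  hash₂ : Fin m → Str κ₂
  /-- the shuffle of the common positions, and the bijections, chosen by the server -/
  order : List ℕ
  bij₁ : Equiv.Perm (Fin n)
  bij₂ : Equiv.Perm (Fin m)
  /-- the messages received by the server in the two switching networks -/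
  masked₁ : Fin n → Str l₁
  masked₂ : Fin m → Str l₂
  ot₁ : Fin (numGates n) → Str l₁ × Str l₁
  ot₂ : Fin (numGates m) → Str l₂ × Str l₂
  /-- the injections sent by the server to the data owners in the switching networks -/
  inj₁ : List (Fin n)
  inj₂ : List (Fin m)
  /-- shares kept by the data owners -/
  kept₁ : List (Str l₁)
  kept₂ : List (Str l₂)
  /-- the server's shares of `u` (sent to `P₂`) and of `v` (sent to `P₁`) -/
  sent₁ : List (Str l₁)
  sent₂ : List (Str l₂)

/-- One execution of the protocol with hash function `H`. Key agreement is ideal: both data owners,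
and nobody else, obtain a uniform key. -/
noncomputable def execute {κ₁ κ₂ l₁ l₂ : ℕ} (D₁ : Dataset l₁) (D₂ : Dataset l₂)
    (H : Oracle κ₁ κ₂) : PMF (Execution D₁.size D₂.size κ₁ κ₂ l₁ l₂) := do
  let r ← PMF.uniformOfFintype (Str κ₁)
  let σ₁ ← PMF.uniformOfFintype (Equiv.Perm (Fin D₁.size))
  let σ₂ ← PMF.uniformOfFintype (Equiv.Perm (Fin D₂.size))
  let x : Fin D₁.size → Str κ₂ := fun i => H (r, D₁.id (σ₁ i))
  let y : Fin D₂.size → Str κ₂ := fun j => H (r, D₂.id (σ₂ j))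
  let τ ← PMF.uniformOfFintype (Equiv.Perm (Fin (matchPairs x y).length))
  let π₁ : Fin (matchPairs x y).length → Fin D₁.size := fun i => ((matchPairs x y).get (τ i)).1
  let π₂ : Fin (matchPairs x y).length → Fin D₂.size := fun i => ((matchPairs x y).get (τ i)).2
  let W₁ ← PMF.uniformOfFintype (Wires D₁.size l₁)
  let ρ₁ ← PMF.uniformOfFintype (Equiv.Perm (Fin D₁.size))
  let u : Fin D₁.size → Str l₁ := fun i => D₁.attr (σ₁ i)
  let W₂ ← PMF.uniformOfFintype (Wires D₂.size l₂)
  let ρ₁' ← PMF.uniformOfFintype (Equiv.Perm (Fin D₂.size))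
  let v : Fin D₂.size → Str l₂ := fun j => D₂.attr (σ₂ j)
  return {
    key := r
    shuffle₁ := σ₁
    shuffle₂ := σ₂
    wires₁ := W₁
    wires₂ := W₂
    hash₁ := x
    hash₂ := y
    order := List.ofFn fun i => (τ i : ℕ)
    bij₁ := ρ₁
    bij₂ := ρ₁'
    masked₁ := maskedInput W₁ u
    masked₂ := maskedInput W₂ v
    ot₁ := otOutputs W₁ ρ₁
    ot₂ := otOutputs W₂ ρ₁'
    inj₁ := List.ofFn (rho₂ ρ₁ π₁)
    inj₂ := List.ofFn (rho₂ ρ₁' π₂)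
    kept₁ := List.ofFn (senderShares W₁ (rho₂ ρ₁ π₁))
    kept₂ := List.ofFn (senderShares W₂ (rho₂ ρ₁' π₂))
    sent₁ := List.ofFn
      (receiverShares ρ₁ (maskedInput W₁ u) (otOutputs W₁ ρ₁) (rho₂ ρ₁ π₁))
    sent₂ := List.ofFn
      (receiverShares ρ₁' (maskedInput W₂ v) (otOutputs W₂ ρ₁') (rho₂ ρ₁' π₂)) }

/-- The outputs of the three parties; the server outputs the number of common hash values and the
lengths of the two vectors. -/
def Execution.outputs {n m κ₁ κ₂ l₁ l₂ : ℕ} (e : Execution n m κ₁ κ₂ l₁ l₂) : Outputs l₁ l₂ where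
  out₁ := e.kept₁.zip e.sent₂
  out₂ := e.sent₁.zip e.kept₂
  outS := ((Finset.univ.image e.hash₁ ∩ Finset.univ.image e.hash₂).card, n, m)

/-! ## Encodings and views

The view of a party is its input, its random choices and the messages it received. Hash values that
a data owner computes itself are determined by its view and the oracle. Views are written as lists
of natural numbers. -/

/-- A self-delimiting encoding of lists. -/
def encList {α : Type} (f : α → List ℕ) (l : List α) : List ℕ := l.length :: l.flatMap f

/-- The encoding of finite vectors. -/
def encVec {α : Type} {n : ℕ} (f : α → List ℕ) (g : Fin n → α) : List ℕ := encList f (List.ofFn g)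

/-- The encoding of bit strings of known length. -/
def encStr {k : ℕ} (s : Str k) : List ℕ := List.ofFn fun i => (s i).toNat

/-- The encoding of a pair of bit strings of known length. -/
def encPair {k l : ℕ} (p : Str k × Str l) : List ℕ := encStr p.1 ++ encStr p.2

/-- The encoding of elements of `[n]`. -/
def encFin {n : ℕ} (i : Fin n) : List ℕ := [(i : ℕ)]

/-- The encoding of wire labels. -/
def encWires {N l : ℕ} (W : Wires N l) : List ℕ := encVec encStr W.1 ++ encVec encPair W.2

/-- The encoding of a dataset. -/
def encDataset {l : ℕ} (D : Dataset l) : List ℕ :=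
  encVec (fun i => encList (fun b : Bool => [b.toNat]) (D.id i) ++ encStr (D.attr i)) id

/-- The view of `P₁`. -/
def Execution.view₁ {n m κ₁ κ₂ l₁ l₂ : ℕ} (D₁ : Dataset l₁) (e : Execution n m κ₁ κ₂ l₁ l₂) :
    List ℕ :=
  encDataset D₁ ++ encStr e.key ++ encVec encFin e.shuffle₁ ++ encWires e.wires₁ ++
    encList encFin e.inj₁ ++ encList encStr e.sent₂

/-- The view of `P₂`. -/
def Execution.view₂ {n m κ₁ κ₂ l₁ l₂ : ℕ} (D₂ : Dataset l₂) (e : Execution n m κ₁ κ₂ l₁ l₂) :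
    List ℕ :=
  encDataset D₂ ++ encStr e.key ++ encVec encFin e.shuffle₂ ++ encWires e.wires₂ ++
    encList encFin e.inj₂ ++ encList encStr e.sent₁

/-- The view of the server, which has no input. -/
def Execution.viewS {n m κ₁ κ₂ l₁ l₂ : ℕ} (e : Execution n m κ₁ κ₂ l₁ l₂) : List ℕ :=
  encVec encStr e.hash₁ ++ encVec encStr e.hash₂ ++ encList (fun i => [i]) e.order ++
    encVec encFin e.bij₁ ++ encVec encStr e.masked₁ ++ encVec encPair e.ot₁ ++
    encVec encFin e.bij₂ ++ encVec encStr e.masked₂ ++ encVec encPair e.ot₂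

/-! ## Probabilistic polynomial-time algorithms

A random access machine with registers, arrays, an input (its length in register `0`, its entries in
array `0`) and an output tape. One step adds, subtracts, moves a number, tests a register for zero,
or draws a uniform number below a given bound. -/

/-- Programs of the machine. -/
inductive Prog : Type
  /-- `reg a := v` -/
  | const (a v : ℕ)
  /-- `reg a := reg b + reg c` -/
  | add (a b c : ℕ)
  /-- `reg a := reg b - reg c` (truncated) -/
  | sub (a b c : ℕ)
  /-- `reg a := array t [reg b]` -/
  | load (a t b : ℕ)
  /-- `array t [reg a] := reg b` -/
  | store (t a b : ℕ)
  /-- `reg a` becomes uniform on `{0, …, reg b - 1}` (and `0` if `reg b = 0`) -/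
  | rand (a b : ℕ)
  /-- append `reg a` to the output -/
  | emit (a : ℕ)
  /-- `P` and then `Q` -/
  | seq (P Q : Prog)
  /-- `P` if `reg a ≠ 0`, otherwise `Q` -/
  | ite (a : ℕ) (P Q : Prog)
  /-- `P` as long as `reg a ≠ 0` -/
  | loop (a : ℕ) (P : Prog)

/-- Memory and output tape of the machine. -/
structure Mem where
  reg : ℕ → ℕ
  arr : ℕ → ℕ → ℕ
  out : List ℕ

/-- Assign `v` to register `a`. -/
def Mem.set (M : Mem) (a v : ℕ) : Mem := { M with reg := Function.update M.reg a v }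

/-- Write `v` at index `i` of array `t`. -/
def Mem.put (M : Mem) (t i v : ℕ) : Mem :=
  { M with arr := Function.update M.arr t (Function.update (M.arr t) i v) }

/-- Append `v` to the output. -/
def Mem.emit (M : Mem) (v : ℕ) : Mem := { M with out := M.out ++ [v] }

/-- The memory at the start, on input `w`. -/
def Mem.init (w : List ℕ) : Mem where
  reg := fun a => if a = 0 then w.length else 0
  arr := fun t i => if t = 0 then w.getD i 0 else 0
  out := []

/-- One step of the machine. A configuration is the list of the programs still to be executed,
together with the memory; the machine has halted when that list is empty. -/
noncomputable def step : List Prog × Mem → PMF (List Prog × Mem)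
  | ([], M) => PMF.pure ([], M)
  | (.const a v :: K, M) => PMF.pure (K, M.set a v)
  | (.add a b c :: K, M) => PMF.pure (K, M.set a (M.reg b + M.reg c))
  | (.sub a b c :: K, M) => PMF.pure (K, M.set a (M.reg b - M.reg c))
  | (.load a t b :: K, M) => PMF.pure (K, M.set a (M.arr t (M.reg b)))
  | (.store t a b :: K, M) =>
    PMF.pure (K, M.put t (M.reg a) (M.reg b))
  | (.rand a b :: K, M) =>
    (PMF.uniformOfFintype (Fin (M.reg b - 1 + 1))).map fun v => (K, M.set a v)
  | (.emit a :: K, M) => PMF.pure (K, M.emit (M.reg a))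
  | (.seq P Q :: K, M) => PMF.pure (P :: Q :: K, M)
  | (.ite a P Q :: K, M) => PMF.pure ((if M.reg a = 0 then Q else P) :: K, M)
  | (.loop a P :: K, M) => PMF.pure (if M.reg a = 0 then (K, M) else (P :: .loop a P :: K, M))

/-- The configuration after `T` further steps. -/
noncomputable def run : ℕ → List Prog × Mem → PMF (List Prog × Mem)
  | 0, c => PMF.pure c
  | T + 1, c => (step c).bind (run T)

/-- The size of an input, with numbers counted in unary (entries are bits, indices or lengths). -/
def inputSize (w : List ℕ) : ℕ := w.length + w.sum

/-- `S` halts on input `w` within `T` steps, whatever its random choices. -/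
def HaltsWithin (S : Prog) (w : List ℕ) (T : ℕ) : Prop :=
  ∀ c ∈ (run T ([S], Mem.init w)).support, c.1 = []

/-- A probabilistic polynomial-time algorithm: on every input it halts within a number of steps that
is polynomial in the size of the input. -/
structure PPT where
  prog : Prog
  time : Polynomial ℕ
  halts : ∀ w, HaltsWithin prog w (time.eval (inputSize w))

/-- The output distribution of a probabilistic polynomial-time algorithm on input `w`. -/
noncomputable def PPT.output (S : PPT) (w : List ℕ) : PMF (List ℕ) :=
  (run (S.time.eval (inputSize w)) ([S.prog], Mem.init w)).map fun c => c.2.out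

/-! ## Distinguishers with access to the random oracle -/

/-- An adaptive randomized strategy of a distinguisher: it outputs a bit, tosses a coin, or queries
the oracle. Its computations are not limited. -/
inductive Strategy (κ₁ κ₂ : ℕ) : Type
  | ret (b : Bool)
  | toss (k : Bool → Strategy κ₁ κ₂)
  | ask (q : Str κ₁ × List Bool) (k : Str κ₂ → Strategy κ₁ κ₂)

/-- The strategy makes at most the given number of oracle queries. -/
def Strategy.QueriesAtMost {κ₁ κ₂ : ℕ} : Strategy κ₁ κ₂ → ℕ → Prop
  | .ret _, _ => True
  | .toss k, q => ∀ b, (k b).QueriesAtMost q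
  | .ask _ _, 0 => False
  | .ask _ k, q + 1 => ∀ a, (k a).QueriesAtMost q

/-- The bit that the strategy outputs when the oracle is `H`. -/
noncomputable def Strategy.run {κ₁ κ₂ : ℕ} (H : Oracle κ₁ κ₂) : Strategy κ₁ κ₂ → PMF Bool
  | .ret b => PMF.pure b
  | .toss k => (PMF.uniformOfFintype Bool).bind fun b => (k b).run H
  | .ask q k => (k (H q)).run H

/-- The probability that the distinguisher `D` outputs `true` on a sample of the experiment `E`; the
same random oracle is used by `E` and by `D`. -/
noncomputable def acceptProb {κ₁ κ₂ : ℕ} {α : Type} (E : Oracle κ₁ κ₂ → PMF α)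
    (D : α → Strategy κ₁ κ₂) : ℝ :=
  (∫⁻ H, ((E H).bind fun a => (D a).run H) true ∂(randomOracle κ₁ κ₂)).toReal

/-- Every distinguisher with at most `q` oracle queries has advantage at most `ε` in telling the two
experiments apart. -/
def Indist {κ₁ κ₂ : ℕ} {α : Type} (q : ℕ) (ε : ℝ) (E E' : Oracle κ₁ κ₂ → PMF α) : Prop :=
  ∀ D : α → Strategy κ₁ κ₂, (∀ a, (D a).QueriesAtMost q) →
    |acceptProb E D - acceptProb E' D| ≤ ε

/-- A negligible function. -/
def Negligible (ε : ℕ → ℝ) : Prop :=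
  Asymptotics.SuperpolynomialDecay Filter.atTop (fun k : ℕ => (k : ℝ)) ε

/-! ## Real and ideal experiments -/

section Experiments

variable {l₁ l₂ : ℕ} (κ κ₁ κ₂ : ℕ) (D₁ : Dataset l₁) (D₂ : Dataset l₂)

/-- The public parameters, given to the simulators. -/
def params (l₁ l₂ : ℕ) : List ℕ := [κ, κ₁, κ₂, l₁, l₂]

/-- The view of `P₁` with the outputs of all parties, in the protocol. -/
noncomputable def real₁ (H : Oracle κ₁ κ₂) : PMF (List ℕ × Outputs l₁ l₂) :=
  (execute D₁ D₂ H).map fun e => (e.view₁ D₁, e.outputs)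

/-- The view of `P₂` with the outputs of all parties, in the protocol. -/
noncomputable def real₂ (H : Oracle κ₁ κ₂) : PMF (List ℕ × Outputs l₁ l₂) :=
  (execute D₁ D₂ H).map fun e => (e.view₂ D₂, e.outputs)

/-- The view of the server with its output, in the protocol. -/
noncomputable def realS (H : Oracle κ₁ κ₂) : PMF (List ℕ × (ℕ × ℕ × ℕ)) :=
  (execute D₁ D₂ H).map fun e => (e.viewS, e.outputs.outS)

/-- The simulator for `P₁` sees the dataset and the output of `P₁`. -/
noncomputable def ideal₁ (S : PPT) (_ : Oracle κ₁ κ₂) : PMF (List ℕ × Outputs l₁ l₂) :=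
  (idealPSA D₁ D₂).bind fun o =>
    (S.output (params κ κ₁ κ₂ l₁ l₂ ++ encDataset D₁ ++ encList encPair o.out₁)).map (·, o)

/-- The simulator for `P₂` sees the dataset and the output of `P₂`. -/
noncomputable def ideal₂ (S : PPT) (_ : Oracle κ₁ κ₂) : PMF (List ℕ × Outputs l₁ l₂) :=
  (idealPSA D₁ D₂).bind fun o =>
    (S.output (params κ κ₁ κ₂ l₁ l₂ ++ encDataset D₂ ++ encList encPair o.out₂)).map (·, o)

/-- The simulator for the server sees only `(|X ∩ Y|, n, m)`. -/
noncomputable def idealS (S : PPT) (_ : Oracle κ₁ κ₂) : PMF (List ℕ × (ℕ × ℕ × ℕ)) :=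
  (idealPSA D₁ D₂).bind fun o =>
    (S.output (params κ κ₁ κ₂ l₁ l₂ ++ [o.outS.1, o.outS.2.1, o.outS.2.2])).map (·, o.outS)

end Experiments

end PSA

/-! Fix the oracle and the key `r`. If `H (r, ·)` is injective on the identifiers, the matched
positions are exactly those of the inner join, and the remaining statements about a data owner are
exact identities between distributions; the only loss is the collision probability, at most `N ^ 2 /
2 ^ κ₂`.

In a switching network every track carries the routed value masked by the label of its current wire
(`foldl_evalGate`), and a network programmed by looping delivers input `ρ j` at output `j`
(`route_net`). So the two shares of a row are a label and the value masked by that label. The sender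
learns `ρ₁⁻¹ ∘ π`, which is a uniform injection whatever `π` is (`unif_perm_symm_bind`); the shares
it gets from the other network are masked by labels of distinct outgoing wires, hence uniform
(`unif_outLabels_bind`). The view of a data owner can therefore be sampled backwards from its
output: a random injection, its own shares planted as labels on the corresponding outgoing wires,
and uniform strings elsewhere (`prescribed_wires_bind`).

The messages that the server receives as receiver are in bijection with the wire labels
(`messages_bijective`), hence uniform and independent of the data. What remains are the hash
vectors. The server does not see the key, and a distinguisher with `q` queries hits it with
probability at most `q / 2 ^ κ₁`; apart from that event the values for the key can be replaced by
fresh ones (`fresh_key_le`). After the shuffles, fresh values form a uniform vector and a second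
vector with copies of random entries of the first one at random places (`shuffled_values_bind`),
which needs only the cardinalities.

Looping works because its constraint graph is the union of two matchings, hence bipartite; for odd
`N` a parity count puts the unpaired input and the unpaired output in the same component
(`reachable_last`).

The simulators have to be programs of the machine. They are written in a small language whose loops
are truncated at the square of the input size, so that running times are polynomial by construction,
and a calculus of specifications (`Spec`) computes their exact output laws. -/

namespace PSA

/-! ### Polynomial time: compiling a language with truncated loops into machine code. -/

/-! ## Running times and outputs of the machine -/

/-- From configuration `c` every run halts within `B` steps, with output distribution `ν`. -/
def Halts (c : List Prog × Mem) (B : ℕ) (ν : PMF (List ℕ)) : Prop :=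
  ∀ T ≥ B, (run T c).map (fun c => c.2.out) = ν ∧ ∀ c' ∈ (run T c).support, c'.1 = []

theorem run_nil (T : ℕ) (M : Mem) : run T ([], M) = PMF.pure ([], M) := by
  induction T with
  | zero => rfl
  | succ T ih => rw [run, step, PMF.pure_bind, ih]

/-- A halted configuration is a fixed point of `step`, so surplus steps are harmless. This is what
makes `Halts` monotone in the bound, and bounds can be rounded up freely. -/
theorem halts_nil (M : Mem) (B : ℕ) : Halts ([], M) B (PMF.pure M.out) := by
  intro T _
  rw [run_nil]
  refine ⟨PMF.pure_map _ _, fun c' hc => ?_⟩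
  rw [PMF.mem_support_pure_iff] at hc
  rw [hc]

theorem Halts.mono {c B B' ν} (h : Halts c B ν) (hB : B ≤ B') : Halts c B' ν :=
  fun T hT => h T (hB.trans hT)

theorem halts_bind {α : Type} {c B} {p : PMF α} {f : α → List Prog × Mem} {ν : α → PMF (List ℕ)}
    (hs : step c = p.map f) (h : ∀ a ∈ p.support, Halts (f a) B (ν a)) :
    Halts c (B + 1) (p.bind ν) := by
  intro T hT
  obtain ⟨T, rfl⟩ : ∃ T', T = T' + 1 := ⟨T - 1, by omega⟩
  rw [run, hs, PMF.bind_map]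
  constructor
  · rw [PMF.map_bind]
    ext x
    rw [PMF.bind_apply, PMF.bind_apply]
    refine tsum_congr fun a => ?_
    by_cases ha : a ∈ p.support
    · rw [← (h a ha T (by omega)).1]; rfl
    · rw [PMF.mem_support_iff, not_not] at ha
      simp [ha]
  · intro c' hc'
    obtain ⟨a, ha, hc'⟩ := (PMF.mem_support_bind_iff _ _ _).1 hc'
    exact (h a ha T (by omega)).2 c' hc'

theorem halts_step {c c' B ν} (hs : step c = PMF.pure c') (h : Halts c' B ν) :
    Halts c (B + 1) ν := by
  have := halts_bind (p := PMF.pure ()) (f := fun _ => c') (ν := fun _ => ν)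
    (by rw [hs, PMF.pure_map]) (fun _ _ => h)
  rwa [PMF.bind_const] at this

/-! ## A structured language with bounded loops -/

/-- Expressions. -/
inductive Ex : Type
  | lit (v : ℕ)
  | reg (a : ℕ)
  | add (e f : Ex)
  | sub (e f : Ex)
  | get (t : ℕ) (e : Ex)

/-- The value of an expression. -/
def Ex.eval (s : Mem) : Ex → ℕ
  | .lit v => v
  | .reg a => s.reg a
  | .add e f => e.eval s + f.eval s
  | .sub e f => e.eval s - f.eval s
  | .get t e => s.arr t (e.eval s)

/-- Commands. -/
inductive Cmd : Type
  | set (a : ℕ) (e : Ex)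
  | put (t : ℕ) (i e : Ex)
  | rand (a : ℕ) (e : Ex)
  | emit (e : Ex)
  | seq (P Q : Cmd)
  | ite (e : Ex) (P Q : Cmd)
  | rep (a : ℕ) (e : Ex) (P : Cmd)

/-- A uniform number below `n`, and `0` if `n = 0`. -/
noncomputable def randBelow (n : ℕ) : PMF ℕ :=
  (PMF.uniformOfFintype (Fin (n - 1 + 1))).map fun v : Fin _ => (v : ℕ)

theorem monad_map {α β : Type} (p : PMF α) (f : α → β) :
    (do let a ← p; pure (f a) : PMF β) = p.map f := rfl

/-- Run `body` with register `a` equal to `i`, …, `i + n - 1`. -/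
noncomputable def iter (a : ℕ) (body : Mem → PMF Mem) : ℕ → ℕ → Mem → PMF Mem
  | 0, _, s => PMF.pure s
  | n + 1, i, s => (body (s.set a i)).bind (iter a body n (i + 1))

/-- The distribution of the memory after a command, when loops run at most `B` times. -/
noncomputable def Cmd.den (B : ℕ) : Cmd → Mem → PMF Mem
  | .set a e, s => PMF.pure (s.set a (e.eval s))
  | .put t i e, s => PMF.pure (s.put t (i.eval s) (e.eval s))
  | .rand a e, s => (randBelow (e.eval s)).map (s.set a)
  | .emit e, s => PMF.pure (s.emit (e.eval s))
  | .seq P Q, s => (P.den B s).bind (Q.den B)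
  | .ite e P Q, s => if e.eval s = 0 then Q.den B s else P.den B s
  | .rep a e P, s => iter a (P.den B) (min (e.eval s) B) 0 s

/-- Machine code that writes the value of an expression to register `2 * d + 1`. -/
def Ex.code : Ex → ℕ → Prog
  | .lit v, d => .const (2 * d + 1) v
  | .reg a, d => .seq (.const (2 * d + 1) 0) (.add (2 * d + 1) (2 * d + 1) (2 * a))
  | .add e f, d => .seq (e.code d) (.seq (f.code (d + 1))
      (.add (2 * d + 1) (2 * d + 1) (2 * (d + 1) + 1)))
  | .sub e f, d => .seq (e.code d) (.seq (f.code (d + 1))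
      (.sub (2 * d + 1) (2 * d + 1) (2 * (d + 1) + 1)))
  | .get t e, d => .seq (e.code d) (.load (2 * d + 1) t (2 * d + 1))

/-- The number of steps of `Ex.code`. -/
def Ex.cost : Ex → ℕ
  | .lit _ => 1
  | .reg _ => 3
  | .add e f => e.cost + f.cost + 3
  | .sub e f => e.cost + f.cost + 3
  | .get _ e => e.cost + 2

/-- Machine code of a command; registers of the command become even registers, the loops keep their
counters in odd registers from `2 * d + 1` on, and register `1` holds the bound for loops. -/
def Cmd.code : Cmd → ℕ → Prog
  | .set a e, d => .seq (e.code d) (.seq (.const (2 * a) 0) (.add (2 * a) (2 * a) (2 * d + 1)))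
  | .put t i e, d => .seq (i.code d) (.seq (e.code (d + 1))
      (.store t (2 * d + 1) (2 * (d + 1) + 1)))
  | .rand a e, d => .seq (e.code d) (.rand (2 * a) (2 * d + 1))
  | .emit e, d => .seq (e.code d) (.emit (2 * d + 1))
  | .seq P Q, d => .seq (P.code d) (Q.code d)
  | .ite e P Q, d => .seq (e.code d) (.ite (2 * d + 1) (P.code d) (Q.code d))
  | .rep a e P, d => .seq (e.code d) (.seq (.sub (2 * (d + 1) + 1) (2 * d + 1) 1)
      (.seq (.sub (2 * d + 1) (2 * d + 1) (2 * (d + 1) + 1))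
        (.seq (.const (2 * (d + 1) + 1) 0)
          (.loop (2 * d + 1)
            (.seq (.const (2 * a) 0) (.seq (.add (2 * a) (2 * a) (2 * (d + 1) + 1))
              (.seq (P.code (d + 3)) (.seq (.const (2 * (d + 2) + 1) 1)
                (.seq (.add (2 * (d + 1) + 1) (2 * (d + 1) + 1) (2 * (d + 2) + 1))
                  (.sub (2 * d + 1) (2 * d + 1) (2 * (d + 2) + 1)))))))))))

/-- A bound for the number of steps of `Cmd.code`, as a polynomial in the bound for loops. -/
noncomputable def Cmd.cost : Cmd → Polynomial ℕ
  | .set _ e => Polynomial.C (e.cost + 4)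
  | .put _ i e => Polynomial.C (i.cost + e.cost + 3)
  | .rand _ e => Polynomial.C (e.cost + 2)
  | .emit e => Polynomial.C (e.cost + 2)
  | .seq P Q => P.cost + Q.cost + 1
  | .ite e P Q => P.cost + Q.cost + Polynomial.C (e.cost + 2)
  | .rep _ e P => Polynomial.X * (P.cost + 11) + Polynomial.C (e.cost + 8)

/-- `M'` differs from `M` only in temporary registers of depth at least `d`. -/
def SameBelow (d : ℕ) (M M' : Mem) : Prop :=
  M'.arr = M.arr ∧ M'.out = M.out ∧ ∀ r, r < 2 * d + 1 ∨ r % 2 = 0 → M'.reg r = M.reg r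

/-- The machine memory `M` represents the memory `s` of a command. -/
def Represents (s M : Mem) : Prop :=
  M.arr = s.arr ∧ M.out = s.out ∧ ∀ r, M.reg (2 * r) = s.reg r

theorem SameBelow.trans {d M M' M''} (h : SameBelow d M M') (h' : SameBelow d M' M'') :
    SameBelow d M M'' :=
  ⟨h'.1.trans h.1, h'.2.1.trans h.2.1, fun r hr => (h'.2.2 r hr).trans (h.2.2 r hr)⟩

theorem SameBelow.mono {d d' M M'} (h : SameBelow d' M M') (hd : d ≤ d') : SameBelow d M M' :=
  ⟨h.1, h.2.1, fun r hr => h.2.2 r (by omega)⟩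

theorem sameBelow_set {d M a v} (ha : 2 * d + 1 ≤ a) (ha' : a % 2 = 1) :
    SameBelow d M (M.set a v) := by
  refine ⟨rfl, rfl, fun r hr => ?_⟩
  simp only [Mem.set]
  rw [Function.update_of_ne (by omega)]

theorem SameBelow.set {d M M' a v} (h : SameBelow d M M') (ha : 2 * d + 1 ≤ a) (ha' : a % 2 = 1) :
    SameBelow d M (M'.set a v) :=
  h.trans (sameBelow_set ha ha')

theorem Represents.of_sameBelow {s M M' d} (h : Represents s M) (h' : SameBelow d M M') :
    Represents s M' :=
  ⟨h'.1.trans h.1, h'.2.1.trans h.2.1, fun r => (h'.2.2 _ (by omega)).trans (h.2.2 r)⟩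

@[simp] theorem Mem.set_reg_self (M : Mem) (a v : ℕ) : (M.set a v).reg a = v := by
  simp [Mem.set]

theorem Mem.set_reg_ne (M : Mem) {a r : ℕ} (v : ℕ) (h : r ≠ a) : (M.set a v).reg r = M.reg r := by
  simp [Mem.set, h]

@[simp] theorem Mem.set_arr (M : Mem) (a v : ℕ) : (M.set a v).arr = M.arr := rfl
@[simp] theorem Mem.set_out (M : Mem) (a v : ℕ) : (M.set a v).out = M.out := rfl
@[simp] theorem Mem.put_reg (M : Mem) (t i v : ℕ) : (M.put t i v).reg = M.reg := rfl
@[simp] theorem Mem.put_out (M : Mem) (t i v : ℕ) : (M.put t i v).out = M.out := rfl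
@[simp] theorem Mem.emit_reg (M : Mem) (v : ℕ) : (M.emit v).reg = M.reg := rfl
@[simp] theorem Mem.emit_arr (M : Mem) (v : ℕ) : (M.emit v).arr = M.arr := rfl
@[simp] theorem Mem.emit_out (M : Mem) (v : ℕ) : (M.emit v).out = M.out ++ [v] := rfl

/-- The continuation `K` spares a description of intermediate memories, and the bounds of
consecutive pieces of code simply add up. A right operand is evaluated one temporary register
deeper, so the value of the left one survives. -/
theorem Ex.code_halts (e : Ex) : ∀ (s M : Mem) (d B : ℕ) (K : List Prog) (ν : PMF (List ℕ)),
    Represents s M →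
    (∀ M', SameBelow d M M' → M'.reg (2 * d + 1) = e.eval s → Halts (K, M') B ν) →
    Halts (e.code d :: K, M) (e.cost + B) ν := by
  induction e with
  | lit v =>
    intro s M d B K ν hM h
    refine (halts_step rfl (h _ (sameBelow_set le_rfl (by omega)) ?_)).mono
      (by simp only [cost]; omega)
    simp [eval]
  | reg a =>
    intro s M d B K ν hM h
    refine (halts_step rfl (halts_step rfl (halts_step rfl
      (h _ ((sameBelow_set le_rfl (by omega)).set le_rfl (by omega)) ?_)))).mono
      (by simp only [cost]; omega)
    rw [Mem.set_reg_self, Mem.set_reg_self, Mem.set_reg_ne _ _ (by omega), hM.2.2, zero_add]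
    rfl
  | add e f he hf =>
    intro s M d B K ν hM h
    refine (halts_step rfl (he s M d _ _ ν hM fun M₁ h₁ r₁ => halts_step rfl
      (hf s M₁ (d + 1) _ _ ν (hM.of_sameBelow h₁) fun M₂ h₂ r₂ => halts_step rfl
        (h _ ((h₁.trans (h₂.mono (by omega))).set le_rfl (by omega)) ?_)))).mono
      (by simp only [cost]; omega)
    rw [Mem.set_reg_self, h₂.2.2 (2 * d + 1) (by omega), r₁, r₂]
    rfl
  | sub e f he hf =>
    intro s M d B K ν hM h
    refine (halts_step rfl (he s M d _ _ ν hM fun M₁ h₁ r₁ => halts_step rfl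
      (hf s M₁ (d + 1) _ _ ν (hM.of_sameBelow h₁) fun M₂ h₂ r₂ => halts_step rfl
        (h _ ((h₁.trans (h₂.mono (by omega))).set le_rfl (by omega)) ?_)))).mono
      (by simp only [cost]; omega)
    rw [Mem.set_reg_self, h₂.2.2 (2 * d + 1) (by omega), r₁, r₂]
    rfl
  | get t e he =>
    intro s M d B K ν hM h
    refine (halts_step rfl (he s M d _ _ ν hM fun M₁ h₁ r₁ => halts_step rfl
        (h _ (h₁.set le_rfl (by omega)) ?_))).mono
      (by simp only [cost]; omega)
    rw [Mem.set_reg_self, r₁, h₁.1, hM.1]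
    rfl

/-- `M'` agrees with `M` on temporary registers of depth below `d`. -/
def SameTemps (d : ℕ) (M M' : Mem) : Prop :=
  ∀ r, r % 2 = 1 → r < 2 * d + 1 → M'.reg r = M.reg r

theorem SameTemps.trans {d M M' M''} (h : SameTemps d M M') (h' : SameTemps d M' M'') :
    SameTemps d M M'' := fun r hr hd => (h' r hr hd).trans (h r hr hd)

theorem SameBelow.sameTemps {d M M'} (h : SameBelow d M M') : SameTemps d M M' :=
  fun r _ hd => h.2.2 r (Or.inl hd)

theorem SameTemps.mono {d d' M M'} (h : SameTemps d' M M') (hd : d ≤ d') : SameTemps d M M' :=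
  fun r h₁ h₂ => h r h₁ (by omega)

theorem Represents.set {s M} (h : Represents s M) (a v : ℕ) :
    Represents (s.set a v) (M.set (2 * a) v) := by
  refine ⟨h.1, h.2.1, fun r => ?_⟩
  by_cases hr : r = a
  · subst hr; simp
  · rw [Mem.set_reg_ne _ _ hr, Mem.set_reg_ne _ _ (by omega), h.2.2]

theorem sameTemps_set_even (d : ℕ) (M : Mem) (a v : ℕ) : SameTemps d M (M.set (2 * a) v) :=
  fun r hr _ => Mem.set_reg_ne _ _ (by omega)

/-- The registers `2 * d + 1`, `2 * (d + 1) + 1` and `2 * (d + 2) + 1` hold the number of remaining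
rounds, the loop index and the constant 1; the body works from depth `d + 3` on. A round costs `C`
steps for the body, 6 before it and 5 after it. The condition `1 ≤ d` protects register 1, which
holds the bound for loops. -/
theorem halts_loop {B C d a : ℕ} {K : List Prog} {body : Mem → PMF Mem} {code : Prog}
    {ν : Mem → PMF (List ℕ)} {T : ℕ}
    (hbody : ∀ (s M : Mem) (B' : ℕ) (K : List Prog) (ν : Mem → PMF (List ℕ)),
      Represents s M → M.reg 1 = B →
      (∀ s' M', Represents s' M' → SameTemps (d + 3) M M' → Halts (K, M') B' (ν s')) →
      Halts (code :: K, M) (C + B') ((body s).bind ν)) (hd : 1 ≤ d) (n : ℕ) :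
    ∀ (i : ℕ) (s M M₀ : Mem), Represents s M → M.reg 1 = B → M.reg (2 * d + 1) = n →
      M.reg (2 * (d + 1) + 1) = i → SameTemps d M₀ M →
      (∀ s' M', Represents s' M' → SameTemps d M₀ M' → Halts (K, M') T (ν s')) →
      Halts (.loop (2 * d + 1)
            (.seq (.const (2 * a) 0) (.seq (.add (2 * a) (2 * a) (2 * (d + 1) + 1))
              (.seq code (.seq (.const (2 * (d + 2) + 1) 1)
                (.seq (.add (2 * (d + 1) + 1) (2 * (d + 1) + 1) (2 * (d + 2) + 1))
                  (.sub (2 * d + 1) (2 * d + 1) (2 * (d + 2) + 1))))))) :: K, M)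
        (n * (C + 11) + (T + 1)) ((iter a body n i s).bind ν) := by
  induction n with
  | zero =>
    intro i s M M₀ hs hB hn hi hM h
    rw [iter, PMF.pure_bind, zero_mul, zero_add]
    refine halts_step (c' := (K, M)) ?_ (h s M hs hM)
    rw [step, if_pos hn]
  | succ n ih =>
    intro i s M M₀ hs hB hn hi hM h
    rw [iter, PMF.bind_bind]
    refine (halts_step (by rw [step, if_neg (by omega)]) (halts_step rfl (halts_step rfl
      (halts_step rfl (halts_step rfl (halts_step rfl
      (hbody (s.set a i) _ (n * (C + 11) + (T + 1) + 5) _ _ ?_ ?_ ?_))))))).mono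
      (by ring_nf; omega)
    · have := (hs.set a 0).set a i
      have e : ((s.set a 0).set a i) = s.set a i := by simp [Mem.set]
      rw [e] at this
      convert this using 2
      rw [Mem.set_reg_self, Mem.set_reg_ne _ _ (by omega), hi, zero_add]
    · rw [Mem.set_reg_ne _ _ (by omega), Mem.set_reg_ne _ _ (by omega), hB]
    · intro s' M' hs' hM'
      have hM'' : SameTemps (d + 3) M M' :=
        ((sameTemps_set_even _ _ _ _).trans (sameTemps_set_even _ _ _ _)).trans hM'
      refine halts_step rfl (halts_step rfl (halts_step rfl (halts_step rfl (halts_step rfl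
        (ih (i + 1) s' _ M₀ ?_ ?_ ?_ ?_ ?_ h)))))
      · exact hs'.of_sameBelow (d := d)
          (((sameBelow_set (by omega) (by omega)).set (by omega) (by omega)).set
            (by omega) (by omega))
      · rw [Mem.set_reg_ne _ _ (by omega), Mem.set_reg_ne _ _ (by omega),
          Mem.set_reg_ne _ _ (by omega), hM'' 1 (by omega) (by omega), hB]
      · rw [Mem.set_reg_self, Mem.set_reg_ne _ _ (by omega), Mem.set_reg_ne _ _ (by omega),
          Mem.set_reg_ne _ _ (by omega), Mem.set_reg_self, hM'' _ (by omega) (by omega), hn]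
        rfl
      · rw [Mem.set_reg_ne _ _ (by omega), Mem.set_reg_self, Mem.set_reg_ne _ _ (by omega),
          Mem.set_reg_self, hM'' _ (by omega) (by omega), hi]
      · exact (hM.trans (hM''.mono (by omega))).trans
          (((sameBelow_set (by omega) (by omega)).set (by omega) (by omega)).set
            (by omega) (by omega)).sameTemps

/-- Commands change even registers, so only temporaries below depth `d` are promised to survive; by
`1 ≤ d` the loop bound in register 1 is among them. -/
theorem Cmd.code_halts (B : ℕ) (P : Cmd) :
    ∀ (s M : Mem) (d B' : ℕ) (K : List Prog) (ν : Mem → PMF (List ℕ)),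
    1 ≤ d → Represents s M → M.reg 1 = B →
    (∀ s' M', Represents s' M' → SameTemps d M M' → Halts (K, M') B' (ν s')) →
    Halts (P.code d :: K, M) (P.cost.eval B + B') ((P.den B s).bind ν) := by
  induction P with
  | set a e =>
    intro s M d B' K ν hd hM hB h
    rw [den, PMF.pure_bind]
    refine (halts_step rfl (e.code_halts s M d _ _ _ hM fun M₁ h₁ r₁ => halts_step rfl
      (halts_step rfl (halts_step rfl (h _ _ ?_ ?_))))).mono
        (by simp only [cost, Polynomial.eval_C]; omega)
    · have := ((hM.of_sameBelow h₁).set a 0).set a (e.eval s)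
      have e' : ((s.set a 0).set a (e.eval s)) = s.set a (e.eval s) := by simp [Mem.set]
      rw [e'] at this
      convert this using 2
      rw [Mem.set_reg_self, Mem.set_reg_ne _ _ (by omega), r₁, zero_add]
    · exact h₁.sameTemps.trans ((sameTemps_set_even _ _ _ _).trans (sameTemps_set_even _ _ _ _))
  | put t i e =>
    intro s M d B' K ν hd hM hB h
    rw [den, PMF.pure_bind]
    refine (halts_step rfl (i.code_halts s M d _ _ _ hM fun M₁ h₁ r₁ => halts_step rfl
      (e.code_halts s M₁ (d + 1) _ _ _ (hM.of_sameBelow h₁) fun M₂ h₂ r₂ =>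
      (halts_step rfl (h _ _ ?_ ?_))))).mono
        (by simp only [cost, Polynomial.eval_C]; omega)
    · have := (hM.of_sameBelow h₁).of_sameBelow h₂
      refine ⟨?_, this.2.1, this.2.2⟩
      simp only [Mem.put]
      rw [this.1, h₂.2.2 (2 * d + 1) (by omega), r₁, r₂]
    · exact h₁.sameTemps.trans (h₂.mono (by omega)).sameTemps
  | rand a e =>
    intro s M d B' K ν hd hM hB h
    rw [den, PMF.bind_map]
    refine (halts_step rfl (e.code_halts s M d _ _ _ hM fun M₁ h₁ r₁ =>
      halts_bind (f := fun v => (K, M₁.set (2 * a) v)) ?_ fun v _ => h _ _ ?_ ?_)).mono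
        (B := e.cost + (B' + 1) + 1) (by simp only [cost, Polynomial.eval_C]; omega)
    · rw [step, ← r₁]; exact congrArg _ (monad_map _ _)
    · exact (hM.of_sameBelow h₁).set a v
    · exact h₁.sameTemps.trans (sameTemps_set_even _ _ _ _)
  | emit e =>
    intro s M d B' K ν hd hM hB h
    rw [den, PMF.pure_bind]
    refine (halts_step rfl (e.code_halts s M d _ _ _ hM fun M₁ h₁ r₁ => halts_step rfl
      (h _ _ ?_ ?_))).mono (by simp only [cost, Polynomial.eval_C]; omega)
    · have := hM.of_sameBelow h₁
      refine ⟨this.1, ?_, this.2.2⟩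
      simp only [Mem.emit]
      rw [this.2.1, r₁]
    · exact h₁.sameTemps
  | seq P Q hP hQ =>
    intro s M d B' K ν hd hM hB h
    rw [den, PMF.bind_bind]
    refine (halts_step rfl (hP s M d (Q.cost.eval B + B') _ _ hd hM hB fun s₁ M₁ h₁ r₁ =>
      hQ s₁ M₁ d B' _ _ hd h₁ ?_ fun s₂ M₂ h₂ r₂ => h _ _ h₂ (r₁.trans r₂))).mono ?_
    · rw [r₁ 1 (by omega) (by omega), hB]
    · simp only [cost, Polynomial.eval_add, Polynomial.eval_one]; omega
  | ite e P Q hP hQ =>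
    intro s M d B' K ν hd hM hB h
    refine (halts_step rfl (e.code_halts s M d (max (P.cost.eval B) (Q.cost.eval B) + B' + 1)
      _ _ hM fun M₁ h₁ r₁ => halts_step rfl ?_)).mono
        (B := e.cost + (max (P.cost.eval B) (Q.cost.eval B) + B' + 1) + 1) ?_
    · have hB₁ : M₁.reg 1 = B := by rw [h₁.sameTemps 1 (by omega) (by omega), hB]
      by_cases h0 : e.eval s = 0
      · rw [den, if_pos h0, if_pos (by rw [r₁, h0])]
        exact (hQ s M₁ d B' _ _ hd (hM.of_sameBelow h₁) hB₁ fun s₂ M₂ h₂ r₂ =>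
          h _ _ h₂ (h₁.sameTemps.trans r₂)).mono (by omega)
      · rw [den, if_neg h0, if_neg (by rw [r₁]; exact h0)]
        exact (hP s M₁ d B' _ _ hd (hM.of_sameBelow h₁) hB₁ fun s₂ M₂ h₂ r₂ =>
          h _ _ h₂ (h₁.sameTemps.trans r₂)).mono (by omega)
    · simp only [cost, Polynomial.eval_add, Polynomial.eval_C]; omega
  | rep a e P hP =>
    intro s M d B' K ν hd hM hB h
    have hmul : min (e.eval s) B * (P.cost.eval B + 11) ≤ B * (P.cost.eval B + 11) :=
      Nat.mul_le_mul_right _ (min_le_right _ _)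
    refine (halts_step rfl (e.code_halts s M d
      (min (e.eval s) B * (P.cost.eval B + 11) + (B' + 1) + 6) _ _ hM fun M₁ h₁ r₁ =>
      halts_step rfl (halts_step rfl (halts_step rfl (halts_step rfl (halts_step rfl
        (halts_step rfl (halts_loop (T := B') (B := B) (C := P.cost.eval B)
        (hbody := fun s M B' K ν hs hB h => hP s M (d + 3) B' K ν (by omega) hs hB h)
        hd (min (e.eval s) B) 0 s _ M ?_ ?_ ?_ ?_ ?_ h)))))))).mono
        (B := e.cost + (min (e.eval s) B * (P.cost.eval B + 11) + (B' + 1) + 6) + 1) ?_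
    · exact (hM.of_sameBelow h₁).of_sameBelow (d := d)
          (((sameBelow_set (by omega) (by omega)).set (by omega) (by omega)).set
            (by omega) (by omega))
    · rw [Mem.set_reg_ne _ _ (by omega), Mem.set_reg_ne _ _ (by omega),
          Mem.set_reg_ne _ _ (by omega), h₁.sameTemps 1 (by omega) (by omega), hB]
    -- Two truncated subtractions compute a minimum: `v - (v - B) = min v B`.
    · rw [Mem.set_reg_ne _ _ (by omega), Mem.set_reg_self, Mem.set_reg_ne _ _ (by omega),
        Mem.set_reg_self, r₁, h₁.sameTemps 1 (by omega) (by omega), hB]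
      omega
    · rw [Mem.set_reg_self]
    · exact h₁.sameTemps.trans (((sameBelow_set (by omega) (by omega)).set (by omega)
        (by omega)).set (by omega) (by omega)).sameTemps
    · simp only [cost, Polynomial.eval_add, Polynomial.eval_C, Polynomial.eval_mul,
        Polynomial.eval_X, Polynomial.eval_ofNat]
      omega

/-! ## Initialization -/

/-- Write the square of the size of the input to register `1`. -/
def initCode : Prog :=
  .seq (.const 3 1) (.seq (.const 5 0) (.seq (.add 5 5 0) (.seq (.const 7 0) (.seq (.add 7 7 0)
    (.seq (.loop 5 (.seq (.sub 5 5 3) (.seq (.load 9 0 5) (.add 7 7 9))))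
    (.seq (.const 9 0) (.seq (.add 9 9 7)
      (.seq (.const 1 0) (.loop 9 (.seq (.add 1 1 7) (.sub 9 9 3)))))))))))

/-- The input is summed from its last entry backwards, so that register 5 is both the loop counter
and the index; register 7 starts at the length and collects the entries already visited. -/
theorem init_halts_sum (w : List ℕ) (K : List Prog) (ν) (B n : ℕ) :
    ∀ M : Mem, n ≤ w.length → Represents (Mem.init w) M → M.reg 3 = 1 → M.reg 5 = n →
      M.reg 7 = w.length + (w.drop n).sum →
      (∀ M', Represents (Mem.init w) M' → M'.reg 3 = 1 → M'.reg 7 = inputSize w →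
        Halts (K, M') B ν) →
      Halts (.loop 5 (.seq (.sub 5 5 3) (.seq (.load 9 0 5) (.add 7 7 9))) :: K, M)
        (n * 6 + (B + 1)) ν := by
  induction n with
  | zero =>
    intro M hn hM h3 h5 h7 h
    refine (halts_step (c' := (K, M)) (by rw [step, if_pos h5]) (h M hM h3 ?_)).mono (by omega)
    rw [h7, List.drop_zero]; rfl
  | succ n ih =>
    intro M hn hM h3 h5 h7 h
    refine (halts_step (by rw [step, if_neg (by omega)]) (halts_step rfl (halts_step rfl
      (halts_step rfl (halts_step rfl (halts_step rfl (ih _ (by omega)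
        (hM.of_sameBelow (d := 0) (((sameBelow_set (by omega) (by omega)).set (by omega)
          (by omega)).set (by omega) (by omega))) ?_ ?_ ?_ h))))))).mono (by omega)
    · rw [Mem.set_reg_ne _ _ (by omega), Mem.set_reg_ne _ _ (by omega),
        Mem.set_reg_ne _ _ (by omega), h3]
    · rw [Mem.set_reg_ne _ _ (by omega), Mem.set_reg_ne _ _ (by omega), Mem.set_reg_self, h5, h3]
      rfl
    · rw [Mem.set_reg_self, Mem.set_reg_ne _ _ (by omega), Mem.set_reg_ne _ _ (by omega),
        Mem.set_reg_self, Mem.set_reg_self, Mem.set_arr, hM.1, h7, h5, h3,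
        List.drop_eq_getElem_cons (show n < w.length by omega), List.sum_cons]
      simp only [Mem.init, if_true, Nat.add_sub_cancel]
      rw [List.getD_eq_getElem _ _ (by omega)]
      omega

/-- The machine has no multiplication: `S` is added `S` times, and `S - n` additions are done when
`n` remain. -/
theorem init_halts_square (s₀ : Mem) (K : List Prog) (ν) (B S n : ℕ) :
    ∀ M : Mem, n ≤ S → Represents s₀ M → M.reg 3 = 1 → M.reg 9 = n → M.reg 7 = S →
      M.reg 1 = S * (S - n) →
      (∀ M', Represents s₀ M' → M'.reg 1 = S ^ 2 → Halts (K, M') B ν) →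
      Halts (.loop 9 (.seq (.add 1 1 7) (.sub 9 9 3)) :: K, M) (n * 4 + (B + 1)) ν := by
  induction n with
  | zero =>
    intro M hn hM h3 h9 h7 h1 h
    refine (halts_step (c' := (K, M)) (by rw [step, if_pos h9]) (h M hM ?_)).mono (by omega)
    rw [h1, Nat.sub_zero, sq]
  | succ n ih =>
    intro M hn hM h3 h9 h7 h1 h
    refine (halts_step (by rw [step, if_neg (by omega)]) (halts_step rfl (halts_step rfl
      (halts_step rfl (ih _ (by omega)
        (hM.of_sameBelow (d := 0) ((sameBelow_set (by omega) (by omega)).set (by omega)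
          (by omega))) ?_ ?_ ?_ ?_ h))))).mono (by omega)
    · rw [Mem.set_reg_ne _ _ (by omega), Mem.set_reg_ne _ _ (by omega), h3]
    · rw [Mem.set_reg_self, Mem.set_reg_ne _ _ (by omega), Mem.set_reg_ne _ _ (by omega), h9, h3]
      rfl
    · rw [Mem.set_reg_ne _ _ (by omega), Mem.set_reg_ne _ _ (by omega), h7]
    · rw [Mem.set_reg_ne _ _ (by omega), Mem.set_reg_self, h1, h7,
        show S - n = S - (n + 1) + 1 by omega]
      ring

theorem initCode_halts (w : List ℕ) (K : List Prog) (ν) (B : ℕ)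
    (h : ∀ M, Represents (Mem.init w) M → M.reg 1 = inputSize w ^ 2 → Halts (K, M) B ν) :
    Halts (initCode :: K, Mem.init w) (inputSize w * 10 + B + 50) ν := by
  have hw : w.length ≤ inputSize w := Nat.le_add_right _ _
  have h0 : Represents (Mem.init w) (Mem.init w) := by
    refine ⟨rfl, rfl, fun r => ?_⟩
    simp only [Mem.init]
    by_cases hr : r = 0 <;> simp [hr]
  refine (halts_step rfl (halts_step rfl (halts_step rfl (halts_step rfl (halts_step rfl
    (halts_step rfl (halts_step rfl (halts_step rfl (halts_step rfl (halts_step rfl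
    (halts_step rfl (init_halts_sum w _ _ _ w.length _ le_rfl (h0.of_sameBelow (d := 0)
      (((((sameBelow_set (by omega) (by omega)).set (by omega) (by omega)).set (by omega)
      (by omega)).set (by omega) (by omega)).set (by omega) (by omega))) ?_ ?_ ?_ fun M hM h3 h7 =>
    halts_step rfl (halts_step rfl (halts_step rfl (halts_step rfl (halts_step rfl
    (halts_step rfl
      (init_halts_square (Mem.init w) _ _ _ (inputSize w) (inputSize w) _ le_rfl
      ?_ ?_ ?_ ?_ ?_ h)))))))))))))))))).mono (by omega)
  · simp [Mem.set]
  · simp [Mem.set, Mem.init]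
  · simp [Mem.set, Mem.init]
  · exact hM.of_sameBelow (d := 0)
        (((sameBelow_set (by omega) (by omega)).set (by omega) (by omega)).set (by omega)
          (by omega))
  · simp [Mem.set, h3]
  · simp [Mem.set, h7]
  · simp [Mem.set, h7]
  · simp [Mem.set]

/-- The loop bound is `inputSize w ^ 2`, whence the composition of the cost with `X ^ 2`; the linear
term pays for computing this bound. Truncation makes every command polynomial-time. That no
simulator is in fact truncated is a separate matter, settled by the hypotheses on `B` in the
specifications. -/
theorem Cmd.halts_program (P : Cmd) (w : List ℕ) :
    Halts ([.seq initCode (P.code 1)], Mem.init w)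
      ((10 * Polynomial.X + P.cost.comp (Polynomial.X ^ 2) + 60 : Polynomial ℕ).eval (inputSize w))
      ((P.den (inputSize w ^ 2) (Mem.init w)).map Mem.out) := by
  refine (halts_step rfl (initCode_halts w _ _ _ fun M hM h1 =>
    P.code_halts _ (Mem.init w) M 1 0 [] (fun s => PMF.pure s.out) le_rfl hM h1
      fun s' M' h' _ => ?_)).mono ?_
  · rw [← h'.2.1]
    exact halts_nil _ _
  · simp only [Polynomial.eval_add, Polynomial.eval_mul, Polynomial.eval_comp, Polynomial.eval_pow,
      Polynomial.eval_X, Polynomial.eval_ofNat]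
    omega

/-- The probabilistic polynomial-time algorithm given by a command. -/
noncomputable def Cmd.toPPT (P : Cmd) : PPT where
  prog := .seq initCode (P.code 1)
  time := 10 * Polynomial.X + P.cost.comp (Polynomial.X ^ 2) + 60
  halts w c hc := (P.halts_program w _ le_rfl).2 c hc

theorem Cmd.toPPT_output (P : Cmd) (w : List ℕ) :
    P.toPPT.output w = (P.den (inputSize w ^ 2) (Mem.init w)).map Mem.out :=
  (P.halts_program w _ le_rfl).1

/-! ### The laws that the simulators sample: uniform strings, vectors and permutations. -/

/-! ## Probability mass functions -/

section Uniform

variable {α β γ : Type}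

/-- The uniform distribution. -/
noncomputable abbrev unif (α : Type) [Fintype α] [Nonempty α] : PMF α := PMF.uniformOfFintype α

theorem bind_congr_support {p : PMF α} {f g : α → PMF β} (h : ∀ a ∈ p.support, f a = g a) :
    p.bind f = p.bind g := by
  ext x
  rw [PMF.bind_apply, PMF.bind_apply]
  refine tsum_congr fun a => ?_
  by_cases ha : a ∈ p.support
  · rw [h a ha]
  · rw [PMF.mem_support_iff, not_not] at ha
    simp [ha]

theorem map_eq_bind (p : PMF α) (f : α → β) : p.map f = p.bind fun a => PMF.pure (f a) := rfl

theorem unif_map_of_bijective [Fintype α] [Nonempty α] [Fintype β] [Nonempty β] {f : α → β}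
    (hf : Function.Bijective f) : (unif α).map f = unif β := by
  classical
  ext b
  obtain ⟨a, rfl⟩ := hf.2 b
  rw [PMF.map_apply, PMF.uniformOfFintype_apply, tsum_eq_single a]
  · rw [if_pos rfl, PMF.uniformOfFintype_apply, Fintype.card_of_bijective hf]
  · intro a' ha'
    rw [if_neg fun h => ha' (hf.1 h).symm]

theorem unif_map_equiv [Fintype α] [Nonempty α] [Fintype β] [Nonempty β] (e : α ≃ β) :
    (unif α).map e = unif β := unif_map_of_bijective e.bijective

theorem unif_bind_equiv [Fintype α] [Nonempty α] [Fintype β] [Nonempty β] (e : α ≃ β)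
    (f : β → PMF γ) : (unif β).bind f = (unif α).bind fun a => f (e a) := by
  rw [← unif_map_equiv e, PMF.bind_map]; rfl

theorem unif_prod [Fintype α] [Nonempty α] [Fintype β] [Nonempty β] :
    unif (α × β) = (unif α).bind fun a => (unif β).map fun b => (a, b) := by
  classical
  ext ⟨a, b⟩
  rw [PMF.uniformOfFintype_apply, PMF.bind_apply, tsum_eq_single a]
  · rw [PMF.map_apply, tsum_eq_single b]
    · rw [if_pos rfl, PMF.uniformOfFintype_apply, PMF.uniformOfFintype_apply, Fintype.card_prod,
        Nat.cast_mul, ENNReal.mul_inv (by simp) (by simp)]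
    · intro b' hb'
      rw [if_neg fun h => hb' (Prod.ext_iff.1 h).2.symm]
  · intro a' ha'
    rw [PMF.map_apply]
    convert mul_zero _
    refine ENNReal.tsum_eq_zero.2 fun b' => ?_
    rw [if_neg fun h => ha' (Prod.ext_iff.1 h).1.symm]

theorem unif_prod_bind [Fintype α] [Nonempty α] [Fintype β] [Nonempty β] (f : α × β → PMF γ) :
    (unif (α × β)).bind f = (unif α).bind fun a => (unif β).bind fun b => f (a, b) := by
  rw [unif_prod, PMF.bind_bind]
  refine congrArg _ (funext fun a => ?_)
  rw [PMF.bind_map]; rfl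

theorem unif_pi_succ_bind {A : Type} [Fintype A] [Nonempty A] (n : ℕ)
    (f : (Fin (n + 1) → A) → PMF γ) :
    (unif (Fin (n + 1) → A)).bind f =
      (unif (Fin n → A)).bind fun g => (unif A).bind fun a => f (Fin.snoc g a) := by
  rw [unif_bind_equiv ((Equiv.prodComm _ _).trans (Fin.snocEquiv fun _ : Fin (n + 1) => A)),
    unif_prod_bind]
  rfl

end Uniform

/-! ## Concatenations of independent lists -/

/-- The concatenation of independent lists with laws `μ 0`, …, `μ (n - 1)`. -/
noncomputable def seqLaw : ℕ → (ℕ → PMF (List ℕ)) → PMF (List ℕ)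
  | 0, _ => PMF.pure []
  | n + 1, μ => (seqLaw n μ).bind fun a => (μ n).map (a ++ ·)

theorem seqLaw_congr {n : ℕ} {μ μ' : ℕ → PMF (List ℕ)} (h : ∀ i < n, μ i = μ' i) :
    seqLaw n μ = seqLaw n μ' := by
  induction n with
  | zero => rfl
  | succ n ih => rw [seqLaw, seqLaw, ih fun i hi => h i (by omega), h n (by omega)]

theorem seqLaw_pure (n : ℕ) (f : ℕ → List ℕ) :
    seqLaw n (fun i => PMF.pure (f i)) = PMF.pure ((List.range n).flatMap f) := by
  induction n with
  | zero => rfl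
  | succ n ih =>
    rw [seqLaw, ih, PMF.pure_bind, PMF.pure_map, List.range_succ, List.flatMap_append]
    simp

/-- The coordinates of a uniform vector are independent and uniform; the induction splits off the
last one. This links uniform vectors in the protocol to the outputs of loops in the simulators. -/
theorem unif_pi_flatten {A : Type} [Fintype A] [Nonempty A] (n : ℕ) (F : ℕ → A → List ℕ) :
    (unif (Fin n → A)).map (fun g => (List.ofFn fun i : Fin n => F i (g i)).flatten) =
      seqLaw n fun i => (unif A).map (F i) := by
  induction n with
  | zero =>
    simp only [List.ofFn_zero, List.flatten_nil, seqLaw]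
    exact PMF.map_const _ _
  | succ n ih =>
    rw [map_eq_bind, unif_pi_succ_bind, seqLaw, ← ih, PMF.bind_map]
    refine congrArg _ (funext fun g => ?_)
    simp only [Function.comp]
    rw [PMF.map_comp, map_eq_bind]
    refine congrArg _ (funext fun a => ?_)
    rw [List.ofFn_succ_last]
    simp

/-- `k` independent uniform bits. -/
noncomputable def bitsLaw (k : ℕ) : PMF (List ℕ) := seqLaw k fun _ => (randBelow 2).map fun v => [v]

theorem randBelow_two : randBelow 2 = (unif Bool).map Bool.toNat := by
  unfold randBelow
  have : PMF.uniformOfFintype (Fin (2 - 1 + 1)) = (unif Bool).map finTwoEquiv.symm :=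
    (unif_map_equiv finTwoEquiv.symm).symm
  rw [this, PMF.map_comp]
  congr 1
  funext b
  cases b <;> rfl

theorem unif_str_map (k : ℕ) : (unif (Str k)).map encStr = bitsLaw k := by
  have := unif_pi_flatten (A := Bool) k fun _ b => [b.toNat]
  rw [bitsLaw, randBelow_two, PMF.map_comp]
  rw [show (fun v => [v]) ∘ Bool.toNat = fun b : Bool => [b.toNat] from rfl, ← this]
  congr 1
  funext g
  rw [encStr, List.flatten_eq_flatMap, List.ofFn_eq_map, List.ofFn_eq_map, List.flatMap_map]
  simp [← List.map_eq_flatMap]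

/-! ## Uniformly random permutations -/

/-- The values of a permutation. -/
def permList {n : ℕ} (σ : Equiv.Perm (Fin n)) : List ℕ := List.ofFn fun i => (σ i : ℕ)

/-- The values of a uniformly random permutation of `[n]`. -/
noncomputable def permLaw (n : ℕ) : PMF (List ℕ) := (unif (Equiv.Perm (Fin n))).map permList

/-- Append `n` to the list `a` of length `n`, and exchange it with entry `j`. -/
def insertSwap (n : ℕ) (a : List ℕ) (j : ℕ) : List ℕ :=
  (List.range (n + 1)).map fun i => if i = j then n else if i = n then a.getD j 0 else a.getD i 0

/-- The permutation of `[n + 1]` that extends a permutation of `[n]`, after exchanging `j` and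
the last element. -/
def extendSwap (n : ℕ) (p : Equiv.Perm (Fin n) × Fin (n + 1)) : Equiv.Perm (Fin (n + 1)) :=
  (Equiv.swap p.2 (Fin.last n)).trans
    ((finSuccEquivLast.trans p.1.optionCongr).trans finSuccEquivLast.symm)

theorem extendSwap_apply (n : ℕ) (p : Equiv.Perm (Fin n) × Fin (n + 1)) (i : Fin (n + 1)) :
    ((extendSwap n p i : Fin (n + 1)) : ℕ) =
      if (i : ℕ) = p.2 then n else if (i : ℕ) = n then (permList p.1).getD p.2 0
        else (permList p.1).getD i 0 := by
  obtain ⟨e, j⟩ := p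
  have key : ∀ k : Fin (n + 1), k ≠ Fin.last n →
      ((((finSuccEquivLast.trans e.optionCongr).trans finSuccEquivLast.symm) k : Fin (n + 1)) : ℕ)
        = (permList e).getD k 0 := by
    intro k hk
    obtain ⟨k, rfl⟩ := Fin.exists_castSucc_eq.2 hk
    simp [permList]
  simp only [extendSwap, Equiv.trans_apply (Equiv.swap _ _)]
  by_cases h : i = j
  · subst h
    rw [Equiv.swap_apply_left, if_pos rfl]
    simp
  · rw [if_neg fun h' => h (Fin.ext h')]
    by_cases h2 : i = Fin.last n
    · subst h2
      rw [Equiv.swap_apply_right, key _ fun h' => h h'.symm, Fin.val_last, if_pos rfl]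
    · rw [Equiv.swap_apply_of_ne_of_ne h h2, key _ h2, if_neg]
      exact fun h' => h2 (Fin.ext h')

/-- The index `j` is recovered as the preimage of the last element, and the smaller permutation by
cancelling the swap. Surjectivity is the count `(n + 1)! = n! * (n + 1)`. -/
theorem extendSwap_bijective (n : ℕ) : Function.Bijective (extendSwap n) := by
  rw [Fintype.bijective_iff_injective_and_card]
  refine ⟨fun p q h => ?_, ?_⟩
  · have h2 : p.2 = q.2 := by
      have hp : extendSwap n p p.2 = Fin.last n := Fin.ext (by simp [extendSwap_apply])
      have hq : extendSwap n q q.2 = Fin.last n := Fin.ext (by simp [extendSwap_apply])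
      rw [h, ← hq] at hp
      exact (extendSwap n q).injective hp
    refine Prod.ext ?_ h2
    unfold extendSwap at h
    rw [h2] at h
    have h3 := congrArg (fun e => (Equiv.swap q.2 (Fin.last n)).symm.trans e) h
    simp only [← Equiv.trans_assoc, Equiv.symm_trans_self, Equiv.refl_trans] at h3
    have h4 : p.1.optionCongr = q.1.optionCongr := by
      ext1 x
      have := DFunLike.congr_fun h3 (finSuccEquivLast.symm x)
      simpa using this
    exact Equiv.optionCongr_injective h4
  · simp [Fintype.card_perm, Nat.factorial_succ, mul_comm]

theorem permLaw_zero : permLaw 0 = PMF.pure [] := by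
  unfold permLaw
  have : (permList : Equiv.Perm (Fin 0) → List ℕ) = Function.const _ [] := by
    funext σ; simp [permList]
  rw [this, PMF.map_const]

/-- One round of the inside-out Fisher–Yates shuffle; it is exactly uniform because `extendSwap` is
a bijection. -/
theorem permLaw_succ (n : ℕ) :
    permLaw (n + 1) = (permLaw n).bind fun a => (randBelow (n + 1)).map (insertSwap n a) := by
  unfold permLaw randBelow
  rw [← unif_map_of_bijective (extendSwap_bijective n), PMF.map_comp, map_eq_bind, unif_prod_bind,
    PMF.bind_map]
  refine congrArg _ (funext fun e => ?_)
  simp only [Function.comp]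
  rw [PMF.map_comp, map_eq_bind]
  refine congrArg _ (funext fun j => ?_)
  congr 1
  refine List.ext_getElem (by simp [permList, insertSwap]) fun i h₁ h₂ => ?_
  have hi : i < n + 1 := by simpa [permList] using h₁
  have := extendSwap_apply n (e, j) ⟨i, hi⟩
  simp only [permList, insertSwap, List.getElem_ofFn, List.getElem_map, List.getElem_range,
    Function.comp] at this ⊢
  exact this

/-! ### A program logic for output laws, and the program fragments verified with it. -/

/-! ## Specifications of commands -/

section Specifications

variable {α β : Type}

/-- The memory after the command `P` from memory `s` can be labelled by a random variable of law `d`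
such that label and memory satisfy `Q`, as far as output distributions are concerned. -/
def Spec (B : ℕ) (P : Cmd) (s : Mem) (d : PMF α) (Q : α → Mem → Prop) : Prop :=
  ∀ (k : Mem → PMF (List ℕ)) (ν : α → PMF (List ℕ)),
    (∀ a ∈ d.support, ∀ s' ∈ (P.den B s).support, Q a s' → k s' = ν a) →
      (P.den B s).bind k = d.bind ν

/-- The registers that a command may write. -/
def Cmd.regs : Cmd → List ℕ
  | .set a _ => [a]
  | .put _ _ _ => []
  | .rand a _ => [a]
  | .emit _ => []
  | .seq P Q => P.regs ++ Q.regs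
  | .ite _ P Q => P.regs ++ Q.regs
  | .rep a _ P => a :: P.regs

/-- The arrays that a command may write. -/
def Cmd.arrs : Cmd → List ℕ
  | .set _ _ => []
  | .put t _ _ => [t]
  | .rand _ _ => []
  | .emit _ => []
  | .seq P Q => P.arrs ++ Q.arrs
  | .ite _ P Q => P.arrs ++ Q.arrs
  | .rep _ _ P => P.arrs

/-- The command has no output. -/
def Cmd.silent : Cmd → Bool
  | .set _ _ => true
  | .put _ _ _ => true
  | .rand _ _ => true
  | .emit _ => false
  | .seq P Q => P.silent && Q.silent
  | .ite _ P Q => P.silent && Q.silent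
  | .rep _ _ P => P.silent

/-- `s'` differs from `s` only where `P` may write. -/
structure Frame (P : Cmd) (s s' : Mem) : Prop where
  reg : ∀ r, r ∉ P.regs → s'.reg r = s.reg r
  arr : ∀ t, t ∉ P.arrs → s'.arr t = s.arr t
  out : P.silent = true → s'.out = s.out

theorem Frame.refl (P : Cmd) (s : Mem) : Frame P s s := ⟨fun _ _ => rfl, fun _ _ => rfl, fun _ => rfl⟩

theorem Frame.trans {P s s' s''} (h : Frame P s s') (h' : Frame P s' s'') : Frame P s s'' :=
  ⟨fun r hr => (h'.reg r hr).trans (h.reg r hr), fun r hr => (h'.arr r hr).trans (h.arr r hr),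
    fun h₀ => (h'.out h₀).trans (h.out h₀)⟩

theorem Frame.weaken {P Q s s'} (h : Frame P s s') (h₁ : ∀ r, r ∉ Q.regs → r ∉ P.regs)
    (h₂ : ∀ r, r ∉ Q.arrs → r ∉ P.arrs) (h₃ : Q.silent = true → P.silent = true) : Frame Q s s' :=
  ⟨fun r hr => h.reg r (h₁ r hr), fun r hr => h.arr r (h₂ r hr), fun h₀ => h.out (h₃ h₀)⟩

theorem frame_set {P : Cmd} {a : ℕ} (ha : a ∈ P.regs) (s : Mem) (v : ℕ) : Frame P s (s.set a v) :=
  ⟨fun _ hr => Mem.set_reg_ne _ _ fun h => hr (by rwa [h]), fun _ _ => rfl, fun _ => rfl⟩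

theorem frame_iter {P : Cmd} {a : ℕ} {e : Ex} {B : ℕ}
    (hP : ∀ s, ∀ s' ∈ (P.den B s).support, Frame P s s') (n : ℕ) :
    ∀ i s, ∀ s' ∈ (iter a (P.den B) n i s).support, Frame (.rep a e P) s s' := by
  induction n with
  | zero =>
    intro i s s' hs'
    rw [iter, PMF.mem_support_pure_iff] at hs'
    rw [hs']; exact Frame.refl _ _
  | succ n ih =>
    intro i s s' hs'
    rw [iter, PMF.mem_support_bind_iff] at hs'
    obtain ⟨s₁, h₁, h₂⟩ := hs'
    refine Frame.trans ?_ (ih _ _ _ h₂)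
    have := (hP _ _ h₁).weaken (Q := .rep a e P) (fun r hr h' => hr (List.mem_cons_of_mem _ h'))
      (fun r hr => hr) (fun h => h)
    exact (frame_set List.mem_cons_self s i).trans this

/-- What a command may write is read off its syntax. In the verification of the simulators,
preservation of a register or array thus becomes a decidable check on `regs` and `arrs`. -/
theorem Cmd.frame (B : ℕ) (P : Cmd) : ∀ s, ∀ s' ∈ (P.den B s).support, Frame P s s' := by
  induction P with
  | set a e =>
    intro s s' hs'
    rw [den, PMF.mem_support_pure_iff] at hs'
    subst hs'
    exact ⟨fun r hr => Mem.set_reg_ne _ _ fun h => hr (by rw [h]; exact List.mem_singleton_self _),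
      fun _ _ => rfl, fun _ => rfl⟩
  | put t i e =>
    intro s s' hs'
    rw [den, PMF.mem_support_pure_iff] at hs'
    subst hs'
    refine ⟨fun _ _ => rfl, fun r hr => ?_, fun _ => rfl⟩
    simp only [Mem.put]
    rw [Function.update_of_ne fun h => hr (by rw [h]; exact List.mem_singleton_self _)]
  | rand a e =>
    intro s s' hs'
    rw [den, PMF.mem_support_map_iff] at hs'
    obtain ⟨v, _, rfl⟩ := hs'
    exact ⟨fun r hr => Mem.set_reg_ne _ _ fun h => hr (by rw [h]; exact List.mem_singleton_self _),
      fun _ _ => rfl, fun _ => rfl⟩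
  | emit e =>
    intro s s' hs'
    rw [den, PMF.mem_support_pure_iff] at hs'
    subst hs'
    exact ⟨fun _ _ => rfl, fun _ _ => rfl, fun h => by simp [silent] at h⟩
  | seq P Q hP hQ =>
    intro s s' hs'
    rw [den, PMF.mem_support_bind_iff] at hs'
    obtain ⟨s₁, h₁, h₂⟩ := hs'
    refine ((hP _ _ h₁).weaken ?_ ?_ ?_).trans ((hQ _ _ h₂).weaken ?_ ?_ ?_) <;>
      simp +contextual [regs, arrs, silent]
  | ite e P Q hP hQ =>
    intro s s' hs'
    rw [den] at hs'
    split_ifs at hs'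
    · refine (hQ _ _ hs').weaken ?_ ?_ ?_ <;> simp +contextual [regs, arrs, silent]
    · refine (hP _ _ hs').weaken ?_ ?_ ?_ <;> simp +contextual [regs, arrs, silent]
  | rep a e P hP =>
    intro s s' hs'
    rw [den] at hs'
    exact frame_iter hP _ _ _ _ hs'

theorem Spec.weaken {B P s} {d : PMF α} {Q Q' : α → Mem → Prop} (h : Spec B P s d Q)
    (hQ : ∀ a ∈ d.support, ∀ s', Frame P s s' → Q a s' → Q' a s') : Spec B P s d Q' :=
  fun k ν hk => h k ν fun a ha s' hs' hQ' => hk a ha s' hs' (hQ a ha s' (P.frame B s s' hs') hQ')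

/-- Since `Spec` quantifies over all continuations of the output law, composition consists of two
applications of the hypotheses; the frame condition for the first command comes for free. -/
theorem Spec.seq {B P R s} {d : PMF α} {Q : α → Mem → Prop} {d' : α → PMF β} {Q' : β → Mem → Prop}
    (h : Spec B P s d Q)
    (hR : ∀ a ∈ d.support, ∀ s', Frame P s s' → Q a s' → Spec B R s' (d' a) Q') :
    Spec B (.seq P R) s (d.bind d') Q' := by
  intro k ν hk
  rw [Cmd.den, PMF.bind_bind, PMF.bind_bind]
  refine h _ _ fun a ha s' hs' hQ => hR a ha s' (P.frame B s s' hs') hQ k ν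
    fun b hb s'' hs'' hQ' => hk b ?_ s'' ?_ hQ'
  · exact (PMF.mem_support_bind_iff _ _ _).2 ⟨a, ha, hb⟩
  · exact (PMF.mem_support_bind_iff _ _ _).2 ⟨s', hs', hs''⟩

theorem Spec.map {B P s} {d : PMF α} {Q : β → Mem → Prop} {f : α → β}
    (h : Spec B P s d fun a => Q (f a)) : Spec B P s (d.map f) Q := by
  intro k ν hk
  rw [PMF.bind_map]
  exact h _ _ fun a ha s' hs' hQ =>
    hk _ ((PMF.mem_support_map_iff _ _ _).2 ⟨a, ha, rfl⟩) s' hs' hQ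

theorem Spec.of_pure {B P s s'} {a : α} {Q : α → Mem → Prop} (h : P.den B s = PMF.pure s')
    (hQ : Q a s') : Spec B P s (PMF.pure a) Q := by
  intro k ν hk
  rw [h, PMF.pure_bind, PMF.pure_bind]
  exact hk a (by simp) s' (by rw [h]; simp) hQ

theorem Spec.rand (B a e s) :
    Spec B (.rand a e) s (randBelow (e.eval s)) fun v s' => s' = s.set a v := by
  intro k ν hk
  rw [Cmd.den, PMF.bind_map]
  exact bind_congr_support fun v hv =>
    hk v hv _ ((PMF.mem_support_map_iff _ _ _).2 ⟨v, hv, rfl⟩) rfl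

theorem spec_iter {B a : ℕ} {P : Cmd} (δ : ℕ → α → PMF α)
    {I : ℕ → α → Mem → Prop} (n : ℕ) :
    ∀ (m : ℕ), (∀ i, m ≤ i → i < m + n → ∀ x s', I i x s' →
        Spec B P (s'.set a i) (δ i x) (I (i + 1))) →
      ∀ (x : α) (s : Mem), I m x s → ∀ (k : Mem → PMF (List ℕ)) (ν : α → PMF (List ℕ)),
      (∀ y, ∀ s' ∈ (iter a (P.den B) n m s).support, I (m + n) y s' → k s' = ν y) →
      (iter a (P.den B) n m s).bind k =
        (Nat.rec (motive := fun _ => PMF α) (PMF.pure x) (fun i p => p.bind (δ (m + i))) n).bind ν := by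
  induction n with
  | zero =>
    intro m hstep x s hI k ν hk
    simp only [iter, PMF.pure_bind] at hk ⊢
    rw [hk x s (by simp) hI]
    exact (PMF.pure_bind _ _).symm
  | succ n ih =>
    intro m hstep x s hI k ν hk
    -- `iter` peels off the first round, whereas the recursor appends the last one; `shift`
    -- reassociates the binds.
    have shift : ∀ j, (Nat.rec (motive := fun _ => PMF α) (PMF.pure x)
        (fun i p => p.bind (δ (m + i))) (j + 1) : PMF α) = (δ m x).bind fun y =>
          Nat.rec (motive := fun _ => PMF α) (PMF.pure y) (fun i p => p.bind (δ (m + 1 + i))) j := by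
      intro j
      induction j with
      | zero => simp
      | succ j ihj =>
        rw [show (Nat.rec (motive := fun _ => PMF α) (PMF.pure x)
          (fun i p => p.bind (δ (m + i))) (j + 1 + 1) : PMF α) = (Nat.rec (motive := fun _ => PMF α)
            (PMF.pure x) (fun i p => p.bind (δ (m + i))) (j + 1) : PMF α).bind (δ (m + (j + 1)))
          from rfl, ihj, PMF.bind_bind]
        rw [show m + (j + 1) = m + 1 + j by ring]
    rw [shift, PMF.bind_bind, iter, PMF.bind_bind]
    refine hstep m le_rfl (by omega) x s hI _ _ fun y _ s₁ hs₁ hy => ?_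
    refine ih (m + 1) (fun i h₁ h₂ => hstep i (by omega) (by omega)) y s₁ hy k ν
      fun z s' hs' hz => hk z s' ?_ ?_
    · rw [iter, PMF.mem_support_bind_iff]; exact ⟨s₁, hs₁, hs'⟩
    · rwa [show m + (n + 1) = m + 1 + n by ring]

/-- The rule for loops. -/
theorem Spec.rep {B a e P s} {n : ℕ} {D : ℕ → PMF α} {x₀ : α} (δ : ℕ → α → PMF α)
    {I : ℕ → α → Mem → Prop} (hn : e.eval s = n) (hB : n ≤ B) (h₀ : D 0 = PMF.pure x₀)
    (hD : ∀ i < n, D (i + 1) = (D i).bind (δ i)) (hI : I 0 x₀ s)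
    (hstep : ∀ i < n, ∀ x s', Frame (.rep a e P) s s' → I i x s' →
      Spec B P (s'.set a i) (δ i x) (I (i + 1))) :
    Spec B (.rep a e P) s (D n) (I n) := by
  intro k ν hk
  have hmin : min (e.eval s) B = n := by omega
  have hden : (Cmd.rep a e P).den B s = iter a (P.den B) n 0 s := by rw [Cmd.den, hmin]
  rw [hden] at hk ⊢
  have hDn : ∀ j ≤ n, (Nat.rec (motive := fun _ => PMF α) (PMF.pure x₀)
      (fun i p => p.bind (δ (0 + i))) j : PMF α) = D j := by
    intro j hj
    induction j with
    | zero => exact h₀.symm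
    | succ j ih => rw [hD j (by omega), ← ih (by omega)]; simp
  -- The invariant is strengthened by the frame condition and by membership of the label in the
  -- support of its law, which the final continuation requires.
  have := spec_iter (B := B) (a := a) (P := P) δ
    (I := fun i x s' => Frame (.rep a e P) s s' ∧ I i x s' ∧ (x ∈ (D i).support)) n 0
    (fun i _ hi x s' h => ?_) x₀ s ⟨Frame.refl _ _, hI, by rw [h₀]; simp⟩ k ν
    (fun y s' hs' h => hk y (by simpa using h.2.2) s' hs' (by simpa using h.2.1))
  · rw [this, hDn n le_rfl]
  · refine (hstep i (by omega) x s' h.1 h.2.1).weaken fun y hy s'' hf hQ => ⟨?_, hQ, ?_⟩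
    · exact h.1.trans ((frame_set List.mem_cons_self s' i).trans
        (hf.weaken (Q := .rep a e P) (fun r hr h' => hr (List.mem_cons_of_mem _ h'))
          (fun r hr => hr) (fun h => h)))
    · rw [hD i (by omega)]
      exact (PMF.mem_support_bind_iff _ _ _).2 ⟨x, h.2.2, hy⟩

/-- The rule for loops that only append to the output. -/
theorem Spec.rep_emit {B a e P s} {n : ℕ} {μ : ℕ → PMF (List ℕ)} (hn : e.eval s = n) (hB : n ≤ B)
    (hstep : ∀ i < n, ∀ s', Frame (.rep a e P) s s' →
      Spec B P (s'.set a i) (μ i) fun l s'' => s''.out = s'.out ++ l) :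
    Spec B (.rep a e P) s (seqLaw n μ) fun l s' => s'.out = s.out ++ l := by
  refine Spec.rep (D := fun i => seqLaw i μ) (x₀ := []) (fun i l => (μ i).map (l ++ ·)) hn hB rfl
    (fun _ _ => rfl) (I := fun _ l s' => s'.out = s.out ++ l) (by simp) fun i hi l s' hf hl => ?_
  refine Spec.map ((hstep i hi s' hf).weaken fun l' _ s'' _ h => ?_)
  rw [h, hl, List.append_assoc]

theorem Spec.output {B P s} {d : PMF α} {Q : α → Mem → Prop} {f : α → List ℕ}
    (h : Spec B P s d Q) (hQ : ∀ a ∈ d.support, ∀ s', Frame P s s' → Q a s' → s'.out = f a) :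
    (P.den B s).map Mem.out = d.map f :=
  h _ _ fun a ha s' hs' hQ' => by
    simp [hQ a ha s' (P.frame B s s' hs') hQ']

end Specifications

/-! ## Rules for single commands -/

section Rules

variable {α : Type} {B : ℕ} {s : Mem} {d : PMF α} {Q : α → Mem → Prop}

theorem Spec.of_den {P P' : Cmd} {s' : Mem}
    (h : P.den B s = (P' : Cmd).den B s') (hs : Spec B P' s' d Q) : Spec B P s d Q := by
  intro k ν hk
  rw [h] at hk ⊢
  exact hs k ν hk

theorem Spec.set_seq {a e R} (h : Spec B R (s.set a (e.eval s)) d Q) :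
    Spec B (.seq (.set a e) R) s d Q :=
  Spec.of_den (by rw [Cmd.den, Cmd.den, PMF.pure_bind]) h

theorem Spec.put_seq {t i e R} (h : Spec B R (s.put t (i.eval s) (e.eval s)) d Q) :
    Spec B (.seq (.put t i e) R) s d Q :=
  Spec.of_den (by rw [Cmd.den, Cmd.den, PMF.pure_bind]) h

theorem Spec.emit_seq {e R} (h : Spec B R (s.emit (e.eval s)) d Q) :
    Spec B (.seq (.emit e) R) s d Q :=
  Spec.of_den (by rw [Cmd.den, Cmd.den, PMF.pure_bind]) h

theorem Spec.set {a e} {x : α} (h : Q x (s.set a (e.eval s))) :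
    Spec B (.set a e) s (PMF.pure x) Q := Spec.of_pure rfl h

theorem Spec.put {t i e} {x : α} (h : Q x (s.put t (i.eval s) (e.eval s))) :
    Spec B (.put t i e) s (PMF.pure x) Q := Spec.of_pure rfl h

theorem Spec.emit {e} {x : α} (h : Q x (s.emit (e.eval s))) :
    Spec B (.emit e) s (PMF.pure x) Q := Spec.of_pure rfl h

theorem Spec.ite {e P R} (h₀ : e.eval s = 0 → Spec B R s d Q) (h₁ : e.eval s ≠ 0 → Spec B P s d Q) :
    Spec B (.ite e P R) s d Q := by
  by_cases h : e.eval s = 0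
  · exact Spec.of_den (by rw [Cmd.den, if_pos h]) (h₀ h)
  · exact Spec.of_den (by rw [Cmd.den, if_neg h]) (h₁ h)

/-- Sequencing after a command without randomness. -/
theorem Spec.seq_unit {P R} {Q' : Unit → Mem → Prop} (h : Spec B P s (PMF.pure ()) Q')
    (hR : ∀ s', Frame P s s' → Q' () s' → Spec B R s' d Q) : Spec B (.seq P R) s d Q := by
  have := h.seq (R := R) (d' := fun _ => d) fun _ _ s' hf hQ => hR s' hf hQ
  rwa [PMF.bind_const] at this

theorem Mem.put_arr (M : Mem) (t i v t' : ℕ) :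
    (M.put t i v).arr t' = if t' = t then Function.update (M.arr t) i v else M.arr t' := by
  simp only [Mem.put, Function.update_apply]

end Rules

/-! ## Program fragments -/

/-- Emit uniform bits. -/
def emitBits (i j : ℕ) (e : Ex) : Cmd := .rep i e (.seq (.rand j (.lit 2)) (.emit (.reg j)))

theorem emitBits_spec {B i j n : ℕ} {e : Ex} {s : Mem} (hn : e.eval s = n) (hB : n ≤ B) :
    Spec B (emitBits i j e) s (bitsLaw n) fun l s' => s'.out = s.out ++ l := by
  refine Spec.rep_emit hn hB fun k _ s' _ => ?_
  rw [map_eq_bind]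
  refine (Spec.rand B j (.lit 2) _).seq fun v _ s₁ _ h₁ => Spec.of_pure rfl ?_
  subst h₁
  simp [Ex.eval]

/-- Write a uniformly random permutation to array `t`. -/
def shuffle (t i j : ℕ) (e : Ex) : Cmd :=
  .rep i e (.seq (.rand j (.add (.reg i) (.lit 1)))
    (.seq (.put t (.reg i) (.get t (.reg j))) (.put t (.reg j) (.reg i))))

theorem getD_insertSwap {n : ℕ} (a : List ℕ) (j i : ℕ) (hi : i < n + 1) :
    (insertSwap n a j).getD i 0 =
      if i = j then n else if i = n then a.getD j 0 else a.getD i 0 := by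
  rw [insertSwap, List.getD_eq_getElem _ _ (by simpa using hi)]
  simp

theorem mem_support_randBelow {n v : ℕ} (h : v ∈ (randBelow (n + 1)).support) : v < n + 1 := by
  unfold randBelow at h
  obtain ⟨w, _, rfl⟩ := (PMF.mem_support_map_iff _ _ _).1 h
  exact w.2

/-- The two writes carry out `insertSwap` in place. If the drawn index is the current one, the first
write copies the entry onto itself and the second one overwrites it. Only entries already written
are ever used, so the array may hold anything at the start and can be reused. -/
theorem shuffle_spec {B t i j n : ℕ} {e : Ex} {s : Mem} (hij : i ≠ j) (hn : e.eval s = n)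
    (hB : n ≤ B) :
    Spec B (shuffle t i j e) s (permLaw n) fun a s' => ∀ k < n, s'.arr t k = a.getD k 0 := by
  refine Spec.rep (D := permLaw) (x₀ := [])
    (fun k a => (randBelow (k + 1)).map (insertSwap k a)) hn hB permLaw_zero
    (fun k _ => permLaw_succ k) (I := fun n a s' => ∀ k < n, s'.arr t k = a.getD k 0)
    (by simp) fun k hk a s' _ ha => ?_
  refine Spec.map ?_
  have h := Spec.rand B j (.add (.reg i) (.lit 1)) (s'.set i k)
  simp only [Ex.eval, Mem.set_reg_self] at h
  have h2 := h.seq (R := .seq (.put t (.reg i) (.get t (.reg j))) (.put t (.reg j) (.reg i)))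
    (d' := PMF.pure) (Q' := fun v s'' => ∀ l < k + 1, s''.arr t l = (insertSwap k a v).getD l 0)
    fun v hv s₁ _ h₁ => ?_
  · rwa [PMF.bind_pure] at h2
  · have hv' := mem_support_randBelow hv
    refine Spec.put_seq (Spec.put fun l hl => ?_)
    subst h₁
    rw [getD_insertSwap _ _ _ hl]
    have e1 : ((s'.set i k).set j v).reg i = k := by rw [Mem.set_reg_ne _ _ hij, Mem.set_reg_self]
    simp only [Ex.eval, Mem.put_reg, Mem.set_reg_self, e1]
    simp only [Mem.put, Mem.set_arr, Function.update_self, Function.update_apply]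
    by_cases h3 : l = v
    · simp [h3]
    · rw [if_neg h3, if_neg h3]
      by_cases h4 : l = k
      · rw [if_pos h4, if_pos h4, ha v (by omega)]
      · rw [if_neg h4, if_neg h4, ha l (by omega)]

/-- Emit the entries of an array. -/
def emitArr (t i : ℕ) (e : Ex) : Cmd := .rep i e (.emit (.get t (.reg i)))

theorem emitArr_spec {B t i n : ℕ} {e : Ex} {s : Mem} (hn : e.eval s = n) (hB : n ≤ B) :
    Spec B (emitArr t i e) s (PMF.pure ((List.range n).map (s.arr t)))
      fun l s' => s'.out = s.out ++ l := by
  have := Spec.rep_emit (B := B) (a := i) (e := e) (P := .emit (.get t (.reg i))) (s := s)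
    (μ := fun k => PMF.pure [s.arr t k]) hn hB fun k hk s' hf => Spec.of_pure rfl ?_
  · rwa [seqLaw_pure, ← List.map_eq_flatMap] at this
  · simp [Ex.eval, hf.arr t (by simp [Cmd.arrs])]

/-! ## Tables for the network -/

/-- The number of gates of the network on `N` tracks. -/
def gateCount (N : ℕ) : ℕ :=
  if N ≤ 2 then N - 1 else N / 2 + N / 2 + gateCount (N / 2) + gateCount (N - N / 2)
termination_by N
decreasing_by all_goals omega

/-- The distance from the end of the list of all labels to the label of the last outgoing wire. -/
def lastOffset (N : ℕ) : ℕ :=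
  if N % 2 = 0 ∨ N ≤ 1 then 1 else N / 2 + N / 2 + lastOffset (N - N / 2)
termination_by N
decreasing_by omega

/-- One step of `tables`. -/
def tablesStep (t i h p : ℕ) : Cmd :=
  .seq (.put t (.reg i) (.reg h))
    (.seq (.ite (.sub (.reg i) (.lit 2))
      (.put (t + 1) (.reg i) (.add (.add (.add (.reg h) (.reg h)) (.get (t + 1) (.reg h)))
        (.get (t + 1) (.sub (.reg i) (.reg h)))))
      (.put (t + 1) (.reg i) (.sub (.reg i) (.lit 1))))
    (.seq (.ite (.reg p) (.ite (.sub (.reg i) (.lit 1))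
      (.put (t + 2) (.reg i) (.add (.add (.reg h) (.reg h))
        (.get (t + 2) (.sub (.reg i) (.reg h)))))
      (.put (t + 2) (.reg i) (.lit 1))) (.put (t + 2) (.reg i) (.lit 1)))
    (.ite (.reg p) (.seq (.set h (.add (.reg h) (.lit 1))) (.set p (.lit 0)))
      (.set p (.lit 1)))))

/-- Write `k / 2`, `gateCount k` and `lastOffset k` to entry `k` of arrays `t`, `t + 1`
and `t + 2`. -/
def tables (t i h p : ℕ) (e : Ex) : Cmd :=
  .seq (.set h (.lit 0)) (.seq (.set p (.lit 0)) (.rep i (.add e (.lit 1)) (tablesStep t i h p)))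

/-- The machine cannot halve, so registers `h` and `p` follow half and parity of the loop index. The
recursions for `gateCount` and `lastOffset` read only smaller entries of the tables. The condition
`hn` says that `e` does not depend on the two auxiliary registers. -/
theorem tables_spec {B t i h p n : ℕ} {e : Ex} {s : Mem} (hih : i ≠ h) (hip : i ≠ p) (hhp : h ≠ p)
    (hn : ∀ u v, e.eval ((s.set h u).set p v) = n) (hB : n + 1 ≤ B) :
    Spec B (tables t i h p e) s (PMF.pure ()) fun _ s' => ∀ k ≤ n,
      s'.arr t k = k / 2 ∧ s'.arr (t + 1) k = gateCount k ∧ s'.arr (t + 2) k = lastOffset k := by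
  refine Spec.set_seq (Spec.set_seq ?_)
  simp only [Ex.eval]
  refine (Spec.rep (D := fun _ => PMF.pure ()) (n := n + 1) (x₀ := ()) (fun _ _ => PMF.pure ())
      (I := fun n _ s' => s'.reg h = n / 2 ∧ s'.reg p = n % 2 ∧ ∀ k < n,
      s'.arr t k = k / 2 ∧ s'.arr (t + 1) k = gateCount k ∧ s'.arr (t + 2) k = lastOffset k)
      (by simp [Ex.eval, hn]) (by omega) rfl (fun _ _ => (PMF.pure_bind _ _).symm)
      ⟨by rw [Mem.set_reg_ne _ _ hhp, Mem.set_reg_self], by rw [Mem.set_reg_self], by simp⟩ ?_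
      ).weaken fun _ _ s' _ hs' k hk => hs'.2.2 k (by omega)
  intro m hm _ s' _ ⟨hh, hp, ht⟩
  have r1 : (s'.set i m).reg h = m / 2 := by rw [Mem.set_reg_ne _ _ hih.symm, hh]
  have r2 : (s'.set i m).reg p = m % 2 := by rw [Mem.set_reg_ne _ _ hip.symm, hp]
  have r3 : (s'.set i m).reg i = m := Mem.set_reg_self _ _ _
  rw [← Mem.set_arr s' i m] at ht
  generalize s'.set i m = s₁ at *
  refine Spec.put_seq (Spec.seq_unit (Q' := fun _ s₂ => s₂ =
    ((s₁.put t m (m / 2)).put (t + 1) m (gateCount m))) (Spec.ite ?_ ?_) fun s₂ _ h₂ => ?_)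
  · intro h0
    simp only [Ex.eval, Mem.put_reg, r1, r3] at h0 ⊢
    refine Spec.put ?_
    simp only [Ex.eval, Mem.put_reg, r3]
    rw [gateCount, if_pos (by omega)]
  · intro h0
    simp only [Ex.eval, Mem.put_reg, r1, r3] at h0 ⊢
    refine Spec.put ?_
    simp only [Ex.eval, Mem.put_reg, r1, r3]
    rw [gateCount, if_neg (by omega), Mem.put_arr, if_neg (by omega), (ht _ (by omega)).2.1,
      (ht _ (by omega)).2.1]
  refine Spec.seq_unit (Q' := fun _ s₃ => s₃ = s₂.put (t + 2) m (lastOffset m)) (Spec.ite ?_ ?_)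
    fun s₃ _ h₃ => ?_
  · intro h0
    subst h₂
    simp only [Ex.eval, Mem.put_reg, r2] at h0
    refine Spec.put ?_
    simp only [Ex.eval, Mem.put_reg, r3]
    rw [lastOffset, if_pos (by omega)]
  · intro h0
    subst h₂
    simp only [Ex.eval, Mem.put_reg, r2] at h0
    refine Spec.ite (fun h1 => Spec.put ?_) (fun h1 => Spec.put ?_)
    · simp only [Ex.eval, Mem.put_reg, r3] at h1 ⊢
      rw [lastOffset, if_pos (by omega)]
    · simp only [Ex.eval, Mem.put_reg, r1, r3] at h1 ⊢
      rw [lastOffset.eq_def m, if_neg (by omega), Mem.put_arr, if_neg (by omega), Mem.put_arr,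
        if_neg (by omega), (ht _ (by omega)).2.2]
  have harr : ∀ k < m + 1, s₃.arr t k = k / 2 ∧ s₃.arr (t + 1) k = gateCount k ∧
      s₃.arr (t + 2) k = lastOffset k := by
    intro k hk
    subst h₃ h₂
    simp only [Mem.put_arr]
    by_cases hkm : k = m
    · simp [hkm]
    · have := ht k (by omega)
      simp [hkm, this]
  have e1 : s₃.reg h = m / 2 := by subst h₃ h₂; exact r1
  have e2 : s₃.reg p = m % 2 := by subst h₃ h₂; exact r2
  refine Spec.ite (fun h0 => ?_) (fun h0 => ?_) <;> simp only [Ex.eval, e2] at h0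
  · refine Spec.set ⟨?_, ?_, harr⟩
    · rw [Mem.set_reg_ne _ _ hhp, e1]; omega
    · rw [Mem.set_reg_self]; simp only [Ex.eval]; omega
  · refine Spec.set_seq (Spec.set ⟨?_, ?_, harr⟩)
    · rw [Mem.set_reg_ne _ _ hhp, Mem.set_reg_self]; simp only [Ex.eval, e1]; omega
    · rw [Mem.set_reg_self]; simp only [Ex.eval]; omega

/-! ### Combinatorics of the Beneš network: routing by two-colouring. -/

/-! ## Lists of tracks -/

section Tracks

variable {α : Type}

theorem map_range_add_two (f : ℕ → α) (n : ℕ) :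
    (List.range (n + 2)).map f = f 0 :: f 1 :: (List.range n).map (fun i => f (i + 2)) := by
  rw [List.range_succ_eq_map, List.range_succ_eq_map]
  simp [Function.comp_def]

theorem layer_map_range : ∀ (n : ℕ) (f : ℕ → α),
    layer ((List.range n).map f) = (List.range (n / 2)).map fun i => (f (2 * i), f (2 * i + 1))
  | 0, _ => rfl
  | 1, _ => rfl
  | n + 2, f => by
    rw [map_range_add_two, layer, layer_map_range n,
      show (n + 2) / 2 = n / 2 + 1 by omega, List.range_succ_eq_map]
    simp [Function.comp_def, mul_add]

theorem upper_map_range : ∀ (n : ℕ) (f : ℕ → α),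
    upper ((List.range n).map f) = (List.range (n / 2)).map fun i => f (2 * i)
  | 0, _ => rfl
  | 1, _ => rfl
  | n + 2, f => by
    rw [map_range_add_two, upper, upper_map_range n,
      show (n + 2) / 2 = n / 2 + 1 by omega, List.range_succ_eq_map]
    simp [Function.comp_def, mul_add]

/-- The minimum acts only for odd `n` and `i = n / 2`, where `2 * i + 1 = n` is clipped to the last,
unpaired track. -/
theorem lower_map_range : ∀ (n : ℕ) (f : ℕ → α),
    lower ((List.range n).map f) =
      (List.range ((n + 1) / 2)).map fun i => f (min (2 * i + 1) (n - 1))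
  | 0, _ => rfl
  | 1, _ => rfl
  | n + 2, f => by
    rw [map_range_add_two, lower, lower_map_range n,
      show (n + 2 + 1) / 2 = (n + 1) / 2 + 1 by omega, List.range_succ_eq_map]
    simp only [List.map_cons, List.map_map, Function.comp_def, List.cons.injEq]
    refine ⟨congrArg f (by omega), List.map_congr_left fun i hi => congrArg f ?_⟩
    have := List.mem_range.1 hi
    omega

theorem benes_of_three_le (l : List α) (h : 3 ≤ l.length) :
    benes l = layer l ++ benes (upper l) ++ benes (lower l) ++ layer l := by
  match l, h with
  | a :: b :: c :: t, _ => rw [benes]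

/-- The gates of the network on the tracks `f 0`, …, `f (n - 1)`. -/
def net (n : ℕ) (f : ℕ → α) : List (α × α) := benes ((List.range n).map f)

/-- A layer of gates on the tracks `f 0`, …, `f (n - 1)`. -/
def netLayer (n : ℕ) (f : ℕ → α) : List (α × α) :=
  (List.range (n / 2)).map fun i => (f (2 * i), f (2 * i + 1))

theorem net_zero (f : ℕ → α) : net 0 f = [] := by simp [net, benes]
theorem net_one (f : ℕ → α) : net 1 f = [] := by simp [net, benes]
theorem net_two (f : ℕ → α) : net 2 f = [(f 0, f 1)] := by
  simp [net, benes, List.range_succ]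

theorem net_of_three_le (n : ℕ) (f : ℕ → α) (h : 3 ≤ n) :
    net n f = netLayer n f ++ net (n / 2) (fun i => f (2 * i)) ++
      net ((n + 1) / 2) (fun i => f (min (2 * i + 1) (n - 1))) ++ netLayer n f := by
  rw [net, benes_of_three_le _ (by simpa), layer_map_range, upper_map_range, lower_map_range]
  rfl

theorem length_netLayer (n : ℕ) (f : ℕ → α) : (netLayer n f).length = n / 2 := by simp [netLayer]

theorem length_net (n : ℕ) : ∀ f : ℕ → α, (net n f).length = gateCount n := by
  induction n using Nat.strong_induction_on with
  | _ n ih =>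
    intro f
    by_cases h : 3 ≤ n
    · rw [net_of_three_le n f h, gateCount, if_neg (by omega)]
      simp only [List.length_append, length_netLayer]
      rw [ih _ (by omega), ih _ (by omega), show (n + 1) / 2 = n - n / 2 by omega]
      omega
    · rw [gateCount, if_pos (by omega)]
      obtain rfl | rfl | rfl : n = 0 ∨ n = 1 ∨ n = 2 := by omega
      · rw [net_zero]; rfl
      · rw [net_one]; rfl
      · rw [net_two]; rfl

/-- Tracks of a network pass through its gates only. -/
theorem mem_net (n : ℕ) : ∀ f : ℕ → α, ∀ p ∈ net n f,
    ∃ i j, i < n ∧ j < n ∧ i ≠ j ∧ p = (f i, f j) := by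
  induction n using Nat.strong_induction_on with
  | _ n ih =>
    intro f p hp
    have hl : ∀ p ∈ netLayer n f, ∃ i j, i < n ∧ j < n ∧ i ≠ j ∧ p = (f i, f j) := by
      intro p hp
      simp only [netLayer, List.mem_map, List.mem_range] at hp
      obtain ⟨i, hi, rfl⟩ := hp
      exact ⟨_, _, by omega, by omega, by omega, rfl⟩
    by_cases h : 3 ≤ n
    · rw [net_of_three_le n f h] at hp
      simp only [List.mem_append] at hp
      rcases hp with ((hp | hp) | hp) | hp
      · exact hl p hp
      · obtain ⟨i, j, hi, hj, hij, rfl⟩ := ih _ (by omega) _ p hp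
        exact ⟨_, _, by omega, by omega, by omega, rfl⟩
      · obtain ⟨i, j, hi, hj, hij, rfl⟩ := ih _ (by omega) _ p hp
        exact ⟨_, _, by omega, by omega, by omega, rfl⟩
      · exact hl p hp
    · obtain rfl | rfl | rfl : n = 0 ∨ n = 1 ∨ n = 2 := by omega
      · simp [net_zero] at hp
      · simp [net_one] at hp
      · rw [net_two, List.mem_singleton] at hp
        exact ⟨0, 1, by omega, by omega, by omega, hp⟩

end Tracks

/-! ## Two-colourings -/

/-- Two fixed-point-free involutions are the two classes of edges of a bipartite graph. -/
theorem exists_colouring_of_involutions {V : Type} (a b : Equiv.Perm V) (ha : ∀ v, a (a v) = v)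
    (hb : ∀ v, b (b v) = v) (ha' : ∀ v, a v ≠ v) (hb' : ∀ v, b v ≠ v) :
    ∃ χ : V → Bool, ∀ v, χ (a v) ≠ χ v ∧ χ (b v) ≠ χ v := by
  classical
  let c : Equiv.Perm V := b * a
  have ea : a⁻¹ = a := Equiv.ext fun v => by rw [Equiv.Perm.inv_eq_iff_eq, ha]
  have eb : b⁻¹ = b := Equiv.ext fun v => by rw [Equiv.Perm.inv_eq_iff_eq, hb]
  -- The involutions generate a dihedral group: conjugation by `a` inverts `c = b * a`.
  have conj : ∀ k : ℤ, a * c ^ k = c ^ (-k) * a := by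
    have h1 : a * c * a⁻¹ = c⁻¹ := by
      simp only [c, mul_inv_rev, ea, eb]; simp [mul_assoc]
      exact Equiv.ext ha
    intro k
    have := conj_zpow (i := k) (a := a) (b := c)
    rw [h1] at this
    rw [zpow_neg, ← inv_zpow, this]
    group
  -- If `a v = c ^ (2 * j) v`, then `a` fixes `c ^ j v`; if `a v = c ^ (2 * j + 1) v`, then `b`
  -- fixes `c ^ (j + 1) v`. Both are excluded.
  have orbit : ∀ v, ¬ c.SameCycle v (a v) := by
    rintro v ⟨k, hk⟩
    obtain ⟨j, rfl | rfl⟩ := Int.even_or_odd' k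
    · refine ha' ((c ^ j) v) ?_
      have := DFunLike.congr_fun (conj j) v
      simp only [Equiv.Perm.mul_apply] at this
      rw [this, ← hk, ← Equiv.Perm.mul_apply, ← zpow_add]
      congr 2; ring
    · refine hb' ((c ^ (j + 1)) v) ?_
      have hb2 : b = c * a := by
        simp only [c, mul_assoc]; rw [show a * a = 1 from Equiv.ext ha, mul_one]
      have := DFunLike.congr_fun (conj (j + 1)) v
      simp only [Equiv.Perm.mul_apply] at this
      rw [show b ((c ^ (j + 1)) v) = c (a ((c ^ (j + 1)) v)) by
        rw [← Equiv.Perm.mul_apply c a, ← hb2], this, ← hk,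
        ← Equiv.Perm.mul_apply (c ^ _) (c ^ _), ← zpow_add, ← Equiv.Perm.mul_apply, ← zpow_one_add]
      congr 2; ring
  let S : Setoid V := Equiv.Perm.SameCycle.setoid c
  let q : V → Quotient S := Quotient.mk S
  -- Both `a` and `b` exchange the `c`-orbit of `v` with that of `a v`. Any linear order on the
  -- orbits then gives a colouring: compare the orbit of `v` with that of `a v`.
  let : LinearOrder (Quotient S) := linearOrderOfSTO WellOrderingRel
  have hqc : ∀ v, q (c v) = q v := fun v => Quotient.sound (by
    exact Equiv.Perm.sameCycle_apply_left.2 (Equiv.Perm.SameCycle.refl _ _))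
  have hq : ∀ v w, q v = q w ↔ c.SameCycle v w := fun v w => Quotient.eq (r := S)
  have hqa : ∀ v, q v ≠ q (a v) := fun v h => orbit v ((hq _ _).1 h)
  have hba : ∀ v, q (b v) = q (a v) := fun v => by
    rw [← hqc (a v)]; simp [c, ha]
  have hab : ∀ v, q (a (b v)) = q v := fun v => by
    rw [← hqc (a (b v))]; simp [c, ha, hb]
  have key : ∀ v, decide (q (a v) < q v) ≠ decide (q v < q (a v)) := by
    intro v h
    have h' := decide_eq_decide.1 h
    rcases lt_trichotomy (q v) (q (a v)) with h1 | h1 | h1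
    · exact lt_asymm h1 (h'.2 h1)
    · exact hqa v h1
    · exact lt_asymm h1 (h'.1 h1)
  refine ⟨fun v => decide (q v < q (a v)), fun v => ⟨?_, ?_⟩⟩
  · simpa only [ha] using key v
  · simpa only [hab, hba] using key v

/-- The other number of the pair `{2 i, 2 i + 1}`. -/
def dual (i : ℕ) : ℕ := if i % 2 = 0 then i + 1 else i - 1

theorem dual_dual (i : ℕ) : dual (dual i) = i := by unfold dual; split_ifs <;> omega
theorem dual_ne (i : ℕ) : dual i ≠ i := by unfold dual; split_ifs <;> omega
theorem dual_div (i : ℕ) : dual i / 2 = i / 2 := by unfold dual; split_ifs <;> omega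
theorem dual_lt {i M : ℕ} (hM : M % 2 = 0) (hi : i < M) : dual i < M := by
  unfold dual; split_ifs <;> omega
theorem eq_dual {i j : ℕ} (h : i / 2 = j / 2) (hij : i ≠ j) : j = dual i := by
  unfold dual; split_ifs <;> omega

/-- `ρ` restricts to a permutation of `{0, …, N - 1}`. -/
def PermBelow (N : ℕ) (ρ : ℕ → ℕ) : Prop :=
  (∀ i < N, ρ i < N) ∧ ∀ i < N, ∀ j < N, ρ i = ρ j → i = j

theorem PermBelow.surj {N ρ} (h : PermBelow N ρ) {i : ℕ} (hi : i < N) : ∃ j < N, ρ j = i := by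
  have := Finset.surj_on_of_inj_on_of_card_le (s := Finset.range N) (t := Finset.range N)
    (fun a _ => ρ a) (fun a ha => by simpa using h.1 a (by simpa using ha))
    (fun a b ha hb hab => h.2 a (by simpa using ha) b (by simpa using hb) hab) le_rfl i
    (by simpa using hi)
  obtain ⟨j, hj, e⟩ := this
  exact ⟨j, by simpa using hj, e.symm⟩

/-- For odd `N` a phantom vertex `N`, fixed by the permutation, is added so that all gates have two
wires. Input duality `δ` and output duality `R * δ * R⁻¹` are then fixed-point-free involutions, and
every edge of `loopGraph` belongs to one of them. The phantom is joined to `N - 1` on the input side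
and to `ρ (N - 1)` on the output side, so these two have the same colour. -/
theorem exists_colouring (N : ℕ) (ρ : ℕ → ℕ) (hρ : PermBelow N ρ) :
    ∃ χ : ℕ → Bool, (∀ i j, (loopGraph N ρ).Adj i j → χ i ≠ χ j) ∧
      (N % 2 = 1 → χ (N - 1) = χ (ρ (N - 1))) := by
  obtain ⟨M, hM, hNM, hM2⟩ : ∃ M, M % 2 = 0 ∧ N ≤ M ∧ M ≤ N + N % 2 :=
    ⟨N + N % 2, by omega, by omega, le_rfl⟩
  let δ : Equiv.Perm (Fin M) := Function.Involutive.toPerm (fun i => ⟨dual i, dual_lt hM i.2⟩)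
    fun i => Fin.ext (dual_dual i)
  let r : Fin M → Fin M := fun i => if h : (i : ℕ) < N then ⟨ρ i, (hρ.1 i h).trans_le hNM⟩ else i
  have hr : Function.Injective r := by
    intro i j hij
    simp only [r] at hij
    split_ifs at hij with h1 h2 h2
    · exact Fin.ext (hρ.2 i h1 j h2 (Fin.ext_iff.1 hij))
    · have := hρ.1 i h1
      have := Fin.ext_iff.1 hij
      simp only at this
      omega
    · have := hρ.1 j h2
      have := Fin.ext_iff.1 hij
      simp only at this
      omega
    · exact hij
  let R : Equiv.Perm (Fin M) := Equiv.ofBijective r (Finite.injective_iff_bijective.1 hr)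
  have hδ : ∀ i, δ (δ i) = i := fun i => Fin.ext (dual_dual i)
  have hδ' : ∀ i, δ i ≠ i := fun i h => dual_ne i (Fin.ext_iff.1 h)
  obtain ⟨χ, hχ⟩ := exists_colouring_of_involutions δ (R * δ * R⁻¹) hδ
    (by intro v; simp [hδ]) hδ' (by
      intro v h
      apply hδ' (R⁻¹ v)
      rw [Equiv.Perm.eq_inv_iff_eq]
      exact h)
  have hχR : ∀ i, χ (R (δ i)) ≠ χ (R i) := fun i => by simpa using (hχ (R i)).2
  let χ' : ℕ → Bool := fun i => if h : i < M then χ ⟨i, h⟩ else false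
  have hχ' : ∀ i (h : i < M), χ' i = χ ⟨i, h⟩ := fun i h => dif_pos h
  have hRρ : ∀ i (h : i < N), (⟨ρ i, (hρ.1 i h).trans_le hNM⟩ : Fin M) =
      R ⟨i, h.trans_le hNM⟩ := fun i h => by
    simp [R, r, h]
  refine ⟨χ', ?_, fun hN => ?_⟩
  · have main : ∀ i j, i ≠ j → ((i < N ∧ j < N ∧ i / 2 = j / 2) ∨
      ∃ a b, a < N ∧ b < N ∧ a / 2 = b / 2 ∧ ρ a = i ∧ ρ b = j) → χ' i ≠ χ' j := by
      rintro i j hij (⟨hi, hj, h⟩ | ⟨a, b, ha, hb, h, rfl, rfl⟩)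
      · rw [hχ' i (by omega), hχ' j (by omega)]
        have := (hχ ⟨i, by omega⟩).1
        rw [ne_comm]
        convert this
        exact eq_dual h hij
      · have hab : a ≠ b := fun e => hij (by rw [e])
        rw [hχ' _ ((hρ.1 a ha).trans_le hNM), hχ' _ ((hρ.1 b hb).trans_le hNM), hRρ a ha, hRρ b hb]
        have := hχR ⟨a, by omega⟩
        rw [ne_comm]
        convert this
        exact eq_dual h hab
    intro i j hij
    rw [loopGraph, SimpleGraph.fromRel_adj] at hij
    rcases hij with ⟨hij, h | h⟩
    · exact main i j hij h
    · exact (main j i hij.symm h).symm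
  · have hM' : M = N + 1 := by omega
    have e1 : δ ⟨N - 1, by omega⟩ = ⟨N, by omega⟩ := Fin.ext (by
      simp only [δ, Function.Involutive.coe_toPerm, dual]; split_ifs <;> omega)
    have h1 := (hχ ⟨N - 1, by omega⟩).1
    have h2 := hχR ⟨N - 1, by omega⟩
    have e2 : R ⟨N, by omega⟩ = ⟨N, by omega⟩ := by simp [R, r]
    rw [e1] at h1 h2
    rw [e2, ← hRρ (N - 1) (by omega)] at h2
    rw [hχ' (N - 1) (by omega), hχ' _ ((hρ.1 _ (by omega)).trans_le hNM)]
    revert h1 h2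
    generalize χ ⟨N, _⟩ = x
    generalize χ ⟨N - 1, _⟩ = y
    generalize χ ⟨ρ (N - 1), _⟩ = z
    revert x y z
    decide

/-- A count modulo 2 on the component `S` of `N - 1`. Input duality pairs the elements of `S` other
than `N - 1`, so `S` is odd. If `ρ (N - 1)` were outside `S`, output duality would pair all elements
of `S`, which would then be even. -/
theorem reachable_last (N : ℕ) (ρ : ℕ → ℕ) (hρ : PermBelow N ρ) (hN : N % 2 = 1) :
    (loopGraph N ρ).Reachable (N - 1) (ρ (N - 1)) := by
  classical
  by_contra hcon
  let G := loopGraph N ρ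
  let S : Finset ℕ := (Finset.range N).filter fun i => G.Reachable (N - 1) i
  have hS : ∀ i, i ∈ S ↔ i < N ∧ G.Reachable (N - 1) i := fun i => by simp [S]
  have hlast : N - 1 ∈ S := (hS _).2 ⟨by omega, SimpleGraph.Reachable.refl _⟩
  have hdual : ∀ i < N, i ≠ N - 1 → dual i < N ∧ dual i ≠ N - 1 := by
    intro i hi h; unfold dual; split_ifs <;> omega
  have adj_in : ∀ i < N, i ≠ N - 1 → G.Adj i (dual i) := by
    intro i hi h
    refine (SimpleGraph.fromRel_adj _ _ _).2 ⟨(dual_ne i).symm, Or.inl (Or.inl ⟨hi, ?_, ?_⟩)⟩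
    · exact (hdual i hi h).1
    · exact (dual_div i).symm
  have h0 : ∑ i ∈ S.erase (N - 1), (1 : ZMod 2) = 0 := by
    refine Finset.sum_involution (fun i _ => dual i) (fun i hi => by decide) (fun i hi _ => dual_ne i)
      (fun i hi => ?_) (fun i hi => dual_dual i)
    rw [Finset.mem_erase, hS] at hi ⊢
    have := hdual i hi.2.1 hi.1
    exact ⟨this.2, this.1, hi.2.2.trans (adj_in i hi.2.1 hi.1).reachable⟩
  choose! g hg hg' using fun i (hi : i < N) => hρ.surj hi
  have hgl : ∀ i ∈ S, g i ≠ N - 1 := by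
    intro i hi h
    have e : ρ (N - 1) = i := by rw [← h]; exact hg' i ((hS i).1 hi).1
    exact hcon (by rw [e]; exact ((hS i).1 hi).2)
  have hgρ : ∀ j < N, g (ρ j) = j := fun j hj => hρ.2 _ (hg _ (hρ.1 j hj)) _ hj (hg' _ (hρ.1 j hj))
  have h1 : ∑ i ∈ S, (1 : ZMod 2) = 0 := by
    refine Finset.sum_involution (fun i _ => ρ (dual (g i))) (fun i hi => by decide)
      (fun i hi _ h => ?_) (fun i hi => ?_) (fun i hi => ?_)
    · have hi' := ((hS i).1 hi).1
      refine dual_ne (g i) (hρ.2 _ (hdual _ (hg i hi') (hgl i hi)).1 _ (hg i hi') ?_)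
      rw [h, hg' i hi']
    · have hi' := ((hS i).1 hi).1
      have hd := (hdual _ (hg i hi') (hgl i hi)).1
      refine (hS _).2 ⟨hρ.1 _ hd, ((hS i).1 hi).2.trans (SimpleGraph.Adj.reachable ?_)⟩
      refine (SimpleGraph.fromRel_adj _ _ _).2 ⟨fun h => ?_, Or.inl (Or.inr
        ⟨g i, dual (g i), hg i hi', hd, (dual_div _).symm, hg' i hi', rfl⟩)⟩
      refine dual_ne (g i) (hρ.2 _ hd _ (hg i hi') ?_)
      rw [← h, hg' i hi']
    · have hi' := ((hS i).1 hi).1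
      rw [hgρ _ (hdual _ (hg i hi') (hgl i hi)).1, dual_dual, hg' i hi']
  rw [← Finset.add_sum_erase _ _ hlast, h0] at h1
  exact absurd h1 (by decide)

/-- In a bipartite graph the parity of the distance to a root tells whether the colours agree, and
adjacent vertices have the same root. Hence graph search finds a proper colouring once some
two-colouring exists. -/
theorem colour_proper (N : ℕ) (ρ : ℕ → ℕ) (hρ : PermBelow N ρ) {i j : ℕ}
    (h : (loopGraph N ρ).Adj i j) : colour N ρ i ≠ colour N ρ j := by
  classical
  obtain ⟨χ, hχ, -⟩ := exists_colouring N ρ hρ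
  let C : (loopGraph N ρ).Coloring Bool := SimpleGraph.Coloring.mk χ fun h => hχ _ _ h
  have parity : ∀ u v, (loopGraph N ρ).Reachable u v →
      (Even ((loopGraph N ρ).dist u v) ↔ (χ u ↔ χ v)) := by
    intro u v huv
    obtain ⟨p, hp⟩ := huv.exists_walk_length_eq_dist
    rw [← hp]
    exact C.even_length_iff_congr p
  have hij := hχ i j h
  have hr : ∀ v, (loopGraph N ρ).Reachable v i ↔ (loopGraph N ρ).Reachable v j := fun v =>
    ⟨fun hv => hv.trans h.reachable, fun hv => hv.trans h.symm.reachable⟩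
  unfold colour
  simp only [hr]
  have hroot : (loopGraph N ρ).Reachable (sInf {v | (loopGraph N ρ).Reachable v j}) j :=
    Nat.sInf_mem (s := {v | (loopGraph N ρ).Reachable v j}) ⟨j, SimpleGraph.Reachable.refl _⟩
  split_ifs with hc
  · rw [Ne, decide_eq_decide, parity _ _ ((hr _).2 hc.2), parity _ _ hc.2]
    revert hij
    generalize χ i = x
    generalize χ j = y
    generalize χ (N - 1) = z
    revert x y z
    decide
  · rw [Ne, decide_eq_decide, ← Nat.not_even_iff_odd, ← Nat.not_even_iff_odd,
      parity _ _ ((hr _).2 hroot), parity _ _ hroot]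
    revert hij
    generalize χ i = x
    generalize χ j = y
    generalize χ (sInf _) = z
    revert x y z
    decide

/-- Both vertices lie in the component rooted at `N - 1`, at even distance from the root. So the
unpaired input and the input that leaves on the unpaired track both use the lower sub-network, the
only one that contains this track. -/
theorem colour_last (N : ℕ) (ρ : ℕ → ℕ) (hρ : PermBelow N ρ) (hN : N % 2 = 1) :
    colour N ρ (N - 1) = true ∧ colour N ρ (ρ (N - 1)) = true := by
  classical
  obtain ⟨χ, hχ, hl⟩ := exists_colouring N ρ hρ
  let C : (loopGraph N ρ).Coloring Bool := SimpleGraph.Coloring.mk χ fun h => hχ _ _ h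
  have hr := reachable_last N ρ hρ hN
  constructor
  · unfold colour
    rw [if_pos ⟨hN, SimpleGraph.Reachable.refl _⟩]
    simp
  · unfold colour
    rw [if_pos ⟨hN, hr⟩]
    obtain ⟨p, hp⟩ := hr.exists_walk_length_eq_dist
    rw [← hp, decide_eq_true_iff, C.even_length_iff_congr p]
    show (χ _ = true ↔ χ _ = true)
    rw [hl hN]

theorem colour_in (N : ℕ) (ρ : ℕ → ℕ) (hρ : PermBelow N ρ) {i : ℕ} (hi : 2 * i + 1 < N) :
    colour N ρ (2 * i) ≠ colour N ρ (2 * i + 1) :=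
  colour_proper N ρ hρ ((SimpleGraph.fromRel_adj _ _ _).2
    ⟨by omega, Or.inl (Or.inl ⟨by omega, by omega, by omega⟩)⟩)

theorem colour_out (N : ℕ) (ρ : ℕ → ℕ) (hρ : PermBelow N ρ) {i : ℕ} (hi : 2 * i + 1 < N) :
    colour N ρ (ρ (2 * i)) ≠ colour N ρ (ρ (2 * i + 1)) :=
  colour_proper N ρ hρ ((SimpleGraph.fromRel_adj _ _ _).2
    ⟨fun h => by have := hρ.2 _ (by omega) _ hi h; omega,
      Or.inl (Or.inr ⟨_, _, by omega, hi, by omega, rfl, rfl⟩)⟩)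

/-! ## Correctness of the looping algorithm -/

section Route

variable {α β : Type} [DecidableEq α]

/-- The values on the tracks after switches `ss` at gates `gs`. -/
def route : List (α × α) → List Bool → (α → β) → (α → β)
  | p :: gs, s :: ss, w =>
    route gs ss (if s then Function.update (Function.update w p.1 (w p.2)) p.2 (w p.1) else w)
  | _, _, w => w

theorem route_append : ∀ (gs : List (α × α)) (ss : List Bool) (gs' : List (α × α)) (ss' : List Bool)
    (w : α → β), gs.length = ss.length →
    route (gs ++ gs') (ss ++ ss') w = route gs' ss' (route gs ss w)
  | [], [], _, _, _, _ => rfl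
  | _ :: gs, _ :: ss, gs', ss', w, h => by
    simp only [List.cons_append, route]
    exact route_append gs ss gs' ss' _ (by simpa using h)

theorem route_of_forall_ne : ∀ (gs : List (α × α)) (ss : List Bool) (w : α → β) (a : α),
    (∀ p ∈ gs, a ≠ p.1 ∧ a ≠ p.2) → route gs ss w a = w a
  | [], _, _, _, _ => by simp [route]
  | _ :: _, [], _, _, _ => by simp [route]
  | p :: gs, s :: ss, w, a, h => by
    rw [route, route_of_forall_ne gs ss _ a fun q hq => h q (List.mem_cons_of_mem _ hq)]
    have := h p List.mem_cons_self
    split_ifs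
    · rw [Function.update_of_ne this.2, Function.update_of_ne this.1]
    · rfl

theorem route_layer (f : ℕ → α) (s : ℕ → Bool) (m : ℕ)
    (hf : ∀ i < 2 * m, ∀ j < 2 * m, f i = f j → i = j) (w : α → β) (p : ℕ) (hp : p < 2 * m) :
    route ((List.range m).map fun i => (f (2 * i), f (2 * i + 1))) ((List.range m).map s) w (f p) =
      w (f (if s (p / 2) then dual p else p)) := by
  induction m with
  | zero => omega
  | succ m ih =>
    have inj : ∀ i j, i < 2 * (m + 1) → j < 2 * (m + 1) → i ≠ j → f i ≠ f j :=
      fun i j hi hj h h' => h (hf i hi j hj h')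
    have hw : ∀ q, 2 * m ≤ q → q < 2 * (m + 1) → route ((List.range m).map fun i =>
        (f (2 * i), f (2 * i + 1))) ((List.range m).map s) w (f q) = w (f q) := by
      intro q hq hq'
      refine route_of_forall_ne _ _ _ _ fun p hp => ?_
      simp only [List.mem_map, List.mem_range] at hp
      obtain ⟨i, hi, rfl⟩ := hp
      exact ⟨inj _ _ hq' (by omega) (by omega), inj _ _ hq' (by omega) (by omega)⟩
    rw [List.range_succ, List.map_append, List.map_append, route_append _ _ _ _ _ (by simp)]
    simp only [List.map_cons, List.map_nil, route]
    by_cases h : p < 2 * m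
    · rw [← ih (fun i hi j hj => hf i (by omega) j (by omega)) h]
      split_ifs
      · rw [Function.update_of_ne (inj _ _ hp (by omega) (by omega)),
          Function.update_of_ne (inj _ _ hp (by omega) (by omega))]
      · rfl
    · rw [show p / 2 = m by omega, hw _ le_rfl (by omega), hw (2 * m + 1) (by omega) (by omega)]
      split_ifs with hs
      · obtain rfl | rfl : p = 2 * m ∨ p = 2 * m + 1 := by omega
        · rw [Function.update_of_ne (inj _ _ (by omega) (by omega) (by omega)),
            Function.update_self, dual, if_pos (by omega)]
        · rw [Function.update_self, dual, if_neg (by omega), Nat.add_sub_cancel]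
      · exact hw p (by omega) hp

theorem length_looping (N : ℕ) : ∀ ρ, (looping N ρ).length = gateCount N := by
  induction N using Nat.strong_induction_on with
  | _ N ih =>
    intro ρ
    rw [looping, gateCount]
    split_ifs with h1 h2 h3
    · rw [List.length_nil]; omega
    · omega
    · simp; omega
    · omega
    · omega
    · simp only [List.length_append, List.length_map, List.length_range]
      rw [ih _ (by omega), ih _ (by omega), show (N + 1) / 2 = N - N / 2 by omega]
      omega

/-- Induction on the size. Inputs of colour `false` pass through the upper sub-network, the others
through the lower one. Since the colouring is proper along both kinds of edges, each complete gate
of the outer layers sends or receives exactly one value through each half, so `ρu` and `ρl` are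
permutations and the induction hypothesis applies to them. -/
theorem route_net (N : ℕ) : ∀ (f : ℕ → α) (ρ : ℕ → ℕ) (w : α → β),
    (∀ i < N, ∀ j < N, f i = f j → i = j) → PermBelow N ρ → ∀ j < N,
      route (net N f) (looping N ρ) w (f j) = w (f (ρ j)) := by
  induction N using Nat.strong_induction_on with
  | _ N ih =>
  intro f ρ w hf hρ j hj
  by_cases hN : N ≤ 2
  · obtain rfl | rfl : N = 1 ∨ N = 2 := by omega
    · have := hρ.1 0 (by omega)
      obtain rfl : j = 0 := by omega
      rw [net_one, show ρ 0 = 0 by omega]; rfl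
    · have h0 := hρ.1 0 (by omega)
      have h1 := hρ.1 1 (by omega)
      have h01 : ρ 0 ≠ ρ 1 := fun h => by have := hρ.2 0 (by omega) 1 (by omega) h; omega
      have hf01 : f 0 ≠ f 1 := fun h => by have := hf 0 (by omega) 1 (by omega) h; omega
      rw [net_two, looping, if_neg (by omega), if_pos rfl]
      simp only [route]
      obtain h0 | h0 : ρ 0 = 0 ∨ ρ 0 = 1 := by omega
      · have h1 : ρ 1 = 1 := by omega
        obtain rfl | rfl : j = 0 ∨ j = 1 := by omega
        · simp [h0]
        · simp [h0, h1]
      · have h1 : ρ 1 = 0 := by omega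
        obtain rfl | rfl : j = 0 ∨ j = 1 := by omega
        · simp [h0, hf01]
        · simp [h0, h1]
  have inj : ∀ i j, i < N → j < N → i ≠ j → f i ≠ f j :=
      fun i j hi hj h h' => h (hf i hi j hj h')
  set C := colour N ρ with hC
  have c1 : ∀ i, 2 * i + 1 < N → C (2 * i) ≠ C (2 * i + 1) := fun i hi => colour_in N ρ hρ hi
  have c2 : ∀ i, 2 * i + 1 < N → C (ρ (2 * i)) ≠ C (ρ (2 * i + 1)) :=
    fun i hi => colour_out N ρ hρ hi
  have c3 : N % 2 = 1 → C (N - 1) = true ∧ C (ρ (N - 1)) = true := colour_last N ρ hρ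
  set ρu : ℕ → ℕ := fun k => if C (ρ (2 * k)) = false then ρ (2 * k) / 2 else ρ (2 * k + 1) / 2
    with hρu
  set ρl : ℕ → ℕ := fun k => if 2 * k + 1 < N ∧ C (ρ (2 * k)) = false then ρ (2 * k + 1) / 2
      else ρ (2 * k) / 2 with hρl
  -- the inputs that leave the sub-networks at `k`
  obtain ⟨vu, hvu⟩ : ∃ vu : ℕ → ℕ, ∀ k < N / 2, ρu k = vu k / 2 ∧ C (vu k) = false ∧
      ∃ t, t / 2 = k ∧ t < N ∧ vu k = ρ t := by
    refine ⟨fun k => if C (ρ (2 * k)) = false then ρ (2 * k) else ρ (2 * k + 1), fun k hk => ?_⟩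
    have := c2 k (by omega)
    by_cases h : C (ρ (2 * k)) = false
    · simp only [hρu, if_pos h]
      exact ⟨trivial, h, _, by omega, by omega, rfl⟩
    · simp only [hρu, if_neg h]
      rw [Bool.not_eq_false] at h
      rw [h] at this
      exact ⟨trivial, by simpa using this.symm, _, by omega, by omega, rfl⟩
  obtain ⟨vl, hvl⟩ : ∃ vl : ℕ → ℕ, ∀ k < (N + 1) / 2, ρl k = vl k / 2 ∧ C (vl k) = true ∧
      ∃ t, t / 2 = k ∧ t < N ∧ vl k = ρ t := by
    refine ⟨fun k => if 2 * k + 1 < N ∧ C (ρ (2 * k)) = false then ρ (2 * k + 1)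
      else ρ (2 * k), fun k hk => ?_⟩
    by_cases h' : 2 * k + 1 < N
    · have := c2 k (by omega)
      by_cases h : C (ρ (2 * k)) = false
      · simp only [hρl, if_pos (And.intro h' h)]
        rw [h] at this
        exact ⟨trivial, by simpa using this.symm, _, by omega, by omega, rfl⟩
      · simp only [hρl, if_neg (fun hh : _ ∧ _ => h hh.2)]
        rw [Bool.not_eq_false] at h
        exact ⟨trivial, h, _, by omega, by omega, rfl⟩
    · simp only [hρl, if_neg (fun hh : _ ∧ _ => h' hh.1)]
      refine ⟨trivial, ?_, _, by omega, by omega, rfl⟩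
      rw [show 2 * k = N - 1 by omega]
      exact (c3 (by omega)).2
  -- An input is determined by its gate and its colour; this gives injectivity of `ρu` and `ρl`.
  have same : ∀ v v', v < N → v' < N → C v = C v' → v / 2 = v' / 2 → v = v' := by
    intro v v' hv hv' hc h
    by_contra hne
    have hd := eq_dual h hne
    unfold dual at hd
    split_ifs at hd with h2
    · have := c1 (v / 2) (by omega)
      rw [show 2 * (v / 2) = v by omega, ← hd] at this
      exact this hc
    · have := c1 (v / 2) (by omega)
      rw [show 2 * (v / 2) + 1 = v by omega, show 2 * (v / 2) = v' by omega] at this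
      exact this hc.symm
  -- For odd `N` the last input has colour `true`, so inputs of colour `false` all enter through
  -- gates of the first layer.
  have small : ∀ v < N, C v = false → v < 2 * (N / 2) := by
    intro v hv hc
    by_contra h
    have := c3 (by omega)
    rw [show N - 1 = v by omega, hc] at this
    exact absurd this.1 (by decide)
  have pu : PermBelow (N / 2) ρu := by
    constructor
    · intro k hk
      obtain ⟨e, hc, t, ht, htN, e'⟩ := hvu k hk
      have := small (vu k) (by rw [e']; exact hρ.1 t htN) hc
      omega
    · intro k hk k' hk' h
      obtain ⟨e, hc, t, ht, htN, e'⟩ := hvu k hk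
      obtain ⟨e2, hc2, t2, ht2, htN2, e2'⟩ := hvu k' hk'
      have := same (vu k) (vu k') (by rw [e']; exact hρ.1 t htN) (by rw [e2']; exact hρ.1 _ htN2)
        (by rw [hc, hc2]) (by omega)
      rw [e', e2'] at this
      have := hρ.2 _ htN _ htN2 this
      omega
  have pl : PermBelow ((N + 1) / 2) ρl := by
    constructor
    · intro k hk
      obtain ⟨e, hc, t, ht, htN, e'⟩ := hvl k hk
      have := hρ.1 t htN
      omega
    · intro k hk k' hk' h
      obtain ⟨e, hc, t, ht, htN, e'⟩ := hvl k hk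
      obtain ⟨e2, hc2, t2, ht2, htN2, e2'⟩ := hvl k' hk'
      have := same (vl k) (vl k') (by rw [e']; exact hρ.1 t htN) (by rw [e2']; exact hρ.1 _ htN2)
        (by rw [hc, hc2]) (by omega)
      rw [e', e2'] at this
      have := hρ.2 _ htN _ htN2 this
      omega
  have hloop : looping N ρ = ((List.range (N / 2)).map fun i => C (2 * i)) ++ looping (N / 2) ρu ++
      looping ((N + 1) / 2) ρl ++ ((List.range (N / 2)).map fun i => C (ρ (2 * i))) := by
    rw [looping, if_neg (by omega), if_neg (by omega)]
  rw [hloop, net_of_three_le N f (by omega), route_append _ _ _ _ _ (by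
    simp [length_netLayer, length_net, length_looping]), route_append _ _ _ _ _ (by
    simp [length_netLayer, length_net, length_looping]), route_append _ _ _ _ _ (by
    simp [length_netLayer])]
  set w₁ := route (netLayer N f) ((List.range (N / 2)).map fun i => C (2 * i)) w with hw₁
  set w₂ := route (net (N / 2) fun i => f (2 * i)) (looping (N / 2) ρu) w₁ with hw₂
  set w₃ := route (net ((N + 1) / 2) fun i => f (min (2 * i + 1) (N - 1)))
    (looping ((N + 1) / 2) ρl) w₂ with hw₃
  have inj2 : ∀ i < 2 * (N / 2), ∀ j < 2 * (N / 2), f i = f j → i = j :=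
    fun i hi j hj => hf i (by omega) j (by omega)
  have v1 : ∀ p < 2 * (N / 2), w₁ (f p) = w (f (if C (2 * (p / 2)) then dual p else p)) :=
    fun p hp => route_layer f (fun i => C (2 * i)) (N / 2) inj2 w p hp
  have v1' : N % 2 = 1 → w₁ (f (N - 1)) = w (f (N - 1)) := by
    intro hodd
    refine route_of_forall_ne _ _ _ _ fun p hp => ?_
    simp only [netLayer, List.mem_map, List.mem_range] at hp
    obtain ⟨i, hi, rfl⟩ := hp
    exact ⟨inj _ _ (by omega) (by omega) (by omega), inj _ _ (by omega) (by omega) (by omega)⟩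
  have up1 : ∀ v < N, C v = false → w₁ (f (2 * (v / 2))) = w (f v) := by
    intro v hv hc
    have hs := small v hv hc
    rw [v1 _ (by omega), show 2 * (v / 2) / 2 = v / 2 by omega]
    rcases Nat.mod_two_eq_zero_or_one v with h | h
    · rw [show 2 * (v / 2) = v by omega, hc]; rfl
    · have := c1 (v / 2) (by omega)
      rw [show 2 * (v / 2) + 1 = v by omega, hc] at this
      rw [if_pos (by simpa using this), dual, if_pos (by omega), show 2 * (v / 2) + 1 = v by omega]
  have low1 : ∀ v < N, C v = true → w₁ (f (min (2 * (v / 2) + 1) (N - 1))) = w (f v) := by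
    intro v hv hc
    by_cases hvN : 2 * (v / 2) + 1 < N
    · rw [min_eq_left (by omega), v1 _ (by omega), show (2 * (v / 2) + 1) / 2 = v / 2 by omega]
      rcases Nat.mod_two_eq_zero_or_one v with h | h
      · rw [show 2 * (v / 2) = v by omega, hc, if_pos rfl, dual, if_neg (by omega)]; rfl
      · have := c1 (v / 2) (by omega)
        rw [show 2 * (v / 2) + 1 = v by omega, hc] at this
        rw [if_neg (by simpa using this), show 2 * (v / 2) + 1 = v by omega]
    · rw [min_eq_right (by omega), v1' (by omega), show N - 1 = v by omega]
  have up2 : ∀ k < N / 2, w₂ (f (2 * k)) = w (f (vu k)) := by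
    intro k hk
    obtain ⟨e, hc, t, ht, htN, e'⟩ := hvu k hk
    rw [hw₂, ih (N / 2) (by omega) (fun i => f (2 * i)) ρu w₁ ?_ pu k hk, e,
      up1 _ (by rw [e']; exact hρ.1 t htN) hc]
    intro i hi j hj h
    have := hf _ (by omega) _ (by omega) h
    omega
  -- The upper sub-network does not touch the tracks of the lower one, and below `up3` uses the
  -- converse.
  have low2 : ∀ k < (N + 1) / 2, w₂ (f (min (2 * k + 1) (N - 1))) =
      w₁ (f (min (2 * k + 1) (N - 1))) := by
    intro k hk
    refine route_of_forall_ne _ _ _ _ fun p hp => ?_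
    obtain ⟨i, j, hi, hj, _, rfl⟩ := mem_net _ _ _ hp
    exact ⟨inj _ _ (by omega) (by omega) (by omega), inj _ _ (by omega) (by omega) (by omega)⟩
  have low3 : ∀ k < (N + 1) / 2, w₃ (f (min (2 * k + 1) (N - 1))) = w (f (vl k)) := by
    intro k hk
    obtain ⟨e, hc, t, ht, htN, e'⟩ := hvl k hk
    rw [hw₃, ih ((N + 1) / 2) (by omega) (fun i => f (min (2 * i + 1) (N - 1))) ρl w₂ ?_ pl k hk,
      low2 _ (pl.1 k hk), e, low1 _ (by rw [e']; exact hρ.1 t htN) hc]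
    intro i hi j hj h
    have := hf _ (by omega) _ (by omega) h
    omega
  have up3 : ∀ k < N / 2, w₃ (f (2 * k)) = w (f (vu k)) := by
    intro k hk
    rw [← up2 k hk]
    refine route_of_forall_ne _ _ _ _ fun p hp => ?_
    obtain ⟨i, j, hi, hj, _, rfl⟩ := mem_net _ _ _ hp
    exact ⟨inj _ _ (by omega) (by omega) (by omega), inj _ _ (by omega) (by omega) (by omega)⟩
  -- Of the two inputs requested at output gate `k` only one has colour `false`, so `vu k` must be
  -- that one.
  have tu : ∀ k < N / 2, ∀ t, t / 2 = k → C (ρ t) = false → vu k = ρ t := by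
    intro k hk t ht hc
    obtain ⟨e, hc', t', ht', htN', e'⟩ := hvu k hk
    by_contra hne
    have htt : t' ≠ t := fun h => hne (by rw [e', h])
    have := c2 k (by omega)
    have hd := eq_dual (ht'.trans ht.symm) htt
    rw [e'] at hc'
    apply this
    rcases Nat.mod_two_eq_zero_or_one t' with h | h
    · rw [dual, if_pos h] at hd
      rw [show 2 * k = t' by omega, ← hd, hc, hc']
    · rw [dual, if_neg (by omega)] at hd
      rw [show 2 * k + 1 = t' by omega, show 2 * k = t by omega, hc, hc']
  have tl : ∀ k < (N + 1) / 2, ∀ t < N, t / 2 = k → C (ρ t) = true → vl k = ρ t := by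
    intro k hk t htN ht hc
    obtain ⟨e, hc', t', ht', htN', e'⟩ := hvl k hk
    by_contra hne
    have htt : t' ≠ t := fun h => hne (by rw [e', h])
    have hd := eq_dual (ht'.trans ht.symm) htt
    rw [e'] at hc'
    rcases Nat.mod_two_eq_zero_or_one t' with h | h
    · rw [dual, if_pos h] at hd
      have := c2 k (by omega)
      apply this
      rw [show 2 * k = t' by omega, ← hd, hc, hc']
    · rw [dual, if_neg (by omega)] at hd
      have := c2 k (by omega)
      apply this
      rw [show 2 * k + 1 = t' by omega, show 2 * k = t by omega, hc, hc']
  -- An output on a gate of the last layer comes straight or crossed according to the colour of the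
  -- input requested on the upper wire; the unpaired output bypasses the layer.
  by_cases hjl : j < 2 * (N / 2)
  · rw [netLayer, route_layer f (fun i => C (ρ (2 * i))) (N / 2) inj2 w₃ j hjl]
    have low3' := low3 (j / 2) (by omega)
    rw [min_eq_left (by omega)] at low3'
    have hc2 := c2 (j / 2) (by omega)
    by_cases hc : C (ρ (2 * (j / 2))) = true
    · rw [if_pos hc]
      rcases Nat.mod_two_eq_zero_or_one j with h | h
      · rw [dual, if_pos h, show j + 1 = 2 * (j / 2) + 1 by omega, low3',
          tl (j / 2) (by omega) j hj rfl]
        rw [← hc]; congr 2; omega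
      · rw [dual, if_neg (by omega), show j - 1 = 2 * (j / 2) by omega, up3 _ (by omega),
          tu (j / 2) (by omega) j rfl]
        rw [hc, show 2 * (j / 2) + 1 = j by omega] at hc2
        simpa using hc2.symm
    · rw [if_neg hc]
      rw [Bool.not_eq_true] at hc
      rcases Nat.mod_two_eq_zero_or_one j with h | h
      · nth_rw 1 [show j = 2 * (j / 2) by omega]
        rw [up3 _ (by omega), tu (j / 2) (by omega) j rfl]
        rw [← hc]; congr 2; omega
      · nth_rw 1 [show j = 2 * (j / 2) + 1 by omega]
        rw [low3', tl (j / 2) (by omega) j hj rfl]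
        rw [hc, show 2 * (j / 2) + 1 = j by omega] at hc2
        simpa using hc2.symm
  · rw [route_of_forall_ne]
    · have := low3 (j / 2) (by omega)
      rw [show min (2 * (j / 2) + 1) (N - 1) = j by omega] at this
      rw [this, tl (j / 2) (by omega) j hj rfl]
      rw [show j = N - 1 by omega]
      exact (c3 (by omega)).2
    · intro p hp
      simp only [netLayer, List.mem_map, List.mem_range] at hp
      obtain ⟨i, hi, rfl⟩ := hp
      exact ⟨inj _ _ (by omega) (by omega) (by omega), inj _ _ (by omega) (by omega) (by omega)⟩

end Route

/-! ### The switching network: correctness, positions of the output labels, uniform messages. -/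

/-! ## Exclusive or -/

@[simp] theorem Str.xor_xor_cancel {k : ℕ} (a b : Str k) : (a.xor b).xor b = a := by
  funext i; simp [Str.xor]

theorem Str.xor_comm {k : ℕ} (a b : Str k) : a.xor b = b.xor a := by
  funext i; simp [Str.xor, Bool.xor_comm]

theorem Str.xor_assoc {k : ℕ} (a b c : Str k) : (a.xor b).xor c = a.xor (b.xor c) := by
  funext i; simp [Str.xor]

theorem Str.xor_self_cancel {k : ℕ} (a b : Str k) : a.xor (a.xor b) = b := by
  rw [Str.xor_comm a (a.xor b), Str.xor_comm a b, Str.xor_xor_cancel]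

theorem Str.xor_right_injective {k : ℕ} (a : Str k) : Function.Injective a.xor :=
  Function.LeftInverse.injective (g := a.xor) fun b => Str.xor_self_cancel a b

/-! ## Folds over gates -/

section Fold

variable {α β : Type} [DecidableEq α]

theorem foldl_finRange_eq_route : ∀ (gs : List (α × α)) (ss : List Bool) (w : α → β),
    gs.length = ss.length → (List.finRange gs.length).foldl (fun w (k : Fin gs.length) =>
      if ss.getD k false then Function.update (Function.update w (gs.get k).1 (w (gs.get k).2))
        (gs.get k).2 (w (gs.get k).1) else w) w = route gs ss w
  | [], [], _, _ => by simp [route]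
  | p :: gs, s :: ss, w, h => by
    rw [route, ← foldl_finRange_eq_route gs ss _ (by simpa using h)]
    simp only [List.length_cons, List.finRange_succ, List.foldl_cons, List.foldl_map]
    simp

/-- The labels on the tracks after the gates `gs`, when the labels of their outgoing wires are the
entries of `y`. -/
def relabelList : List (α × α) → (ℕ → β) → (α → β) → (α → β)
  | p :: gs, y, w => relabelList gs (fun i => y (i + 2))
      (Function.update (Function.update w p.1 (y 0)) p.2 (y 1))
  | [], _, w => w

theorem foldl_finRange_eq_relabelList : ∀ (gs : List (α × α)) (y : ℕ → β) (w : α → β),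
    (List.finRange gs.length).foldl (fun w (k : Fin gs.length) =>
      Function.update (Function.update w (gs.get k).1 (y (2 * k))) (gs.get k).2 (y (2 * k + 1))) w =
        relabelList gs y w
  | [], _, _ => by simp [relabelList]
  | p :: gs, y, w => by
    rw [relabelList, ← foldl_finRange_eq_relabelList gs]
    simp only [List.length_cons, List.finRange_succ, List.foldl_cons, List.foldl_map]
    simp [mul_add, add_assoc, add_comm 2 1]

theorem relabelList_append : ∀ (gs gs' : List (α × α)) (y : ℕ → β) (w : α → β),
    relabelList (gs ++ gs') y w =
      relabelList gs' (fun i => y (i + 2 * gs.length)) (relabelList gs y w)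
  | [], _, _, _ => rfl
  | p :: gs, gs', y, w => by
    simp only [List.cons_append, relabelList]
    rw [relabelList_append gs gs']
    simp [mul_add, add_assoc]

theorem relabelList_of_forall_ne : ∀ (gs : List (α × α)) (y : ℕ → β) (w : α → β) (a : α),
    (∀ p ∈ gs, a ≠ p.1 ∧ a ≠ p.2) → relabelList gs y w a = w a
  | [], _, _, _, _ => rfl
  | p :: gs, y, w, a, h => by
    rw [relabelList, relabelList_of_forall_ne gs _ _ a fun q hq => h q (List.mem_cons_of_mem _ hq)]
    have := h p List.mem_cons_self
    rw [Function.update_of_ne this.2, Function.update_of_ne this.1]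

theorem relabelList_layer (f : ℕ → α) (y : ℕ → β) (m : ℕ)
    (hf : ∀ i < 2 * m, ∀ j < 2 * m, f i = f j → i = j) (w : α → β) (p : ℕ) (hp : p < 2 * m) :
    relabelList ((List.range m).map fun i => (f (2 * i), f (2 * i + 1))) y w (f p) = y p := by
  induction m with
  | zero => omega
  | succ m ih =>
    have inj : ∀ i j, i < 2 * (m + 1) → j < 2 * (m + 1) → i ≠ j → f i ≠ f j :=
      fun i j hi hj h h' => h (hf i hi j hj h')
    rw [List.range_succ, List.map_append, relabelList_append]
    simp only [List.map_cons, List.map_nil, relabelList, List.length_map, List.length_range]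
    by_cases h : p < 2 * m
    · rw [← ih (fun i hi j hj => hf i (by omega) j (by omega)) h]
      rw [Function.update_of_ne (inj _ _ hp (by omega) (by omega)),
          Function.update_of_ne (inj _ _ hp (by omega) (by omega))]
    · obtain rfl | rfl : p = 2 * m ∨ p = 2 * m + 1 := by omega
      · rw [Function.update_of_ne (inj _ _ (by omega) (by omega) (by omega)),
          Function.update_self, zero_add]
      · rw [Function.update_self, add_comm]

/-- Ensures that the subtraction in `labelIdx` is not truncated and stays beyond the incoming
labels. -/
theorem lastOffset_le (n : ℕ) : 2 ≤ n → lastOffset n ≤ 2 * gateCount n := by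
  induction n using Nat.strong_induction_on with
  | _ n ih =>
    intro hn
    rw [lastOffset, gateCount]
    split_ifs with h1 h2 h2
    · omega
    · omega
    · omega
    · have := ih (n - n / 2) (by omega) (by omega)
      omega

/-- For odd `n` the label on the last track comes before all `2 * (n / 2) = n - 1` labels of the
output layer, so its position cannot coincide with one of theirs. -/
theorem le_lastOffset (n : ℕ) : n % 2 = 1 → n ≤ lastOffset n := by
  intro h
  have pos : ∀ k, 1 ≤ lastOffset k := by
    intro k
    induction k using Nat.strong_induction_on with
    | _ k ih =>
      rw [lastOffset]
      split_ifs with h1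
      · exact le_rfl
      · have := ih (k - k / 2) (by omega); omega
  rw [lastOffset]
  split_ifs with h1
  · omega
  · have := pos (n - n / 2); omega

/-- The position, in the list of all wire labels of the network on `n` tracks, of the label of the
outgoing wire on track `j`. -/
def labelIdx (n j : ℕ) : ℕ :=
  if j + 1 = n then n + 2 * gateCount n - lastOffset n
  else n + 2 * gateCount n - 2 * (n / 2) + j

theorem half_le_gateCount (n : ℕ) (hn : 2 ≤ n) : n / 2 ≤ gateCount n := by
  rw [gateCount]; split_ifs <;> omega

/-- Outputs on paired tracks carry the labels of the output layer, which are the last `2 * (n / 2)`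
in the list. For odd `n` the last track skips that layer; its label is the last-track label of the
lower sub-network, whose labels directly precede those of the output layer. This is the recursion of
`lastOffset`. The shift by `n` accounts for the incoming labels, which `y` omits. -/
theorem relabelList_net (n : ℕ) : ∀ (f : ℕ → α) (y : ℕ → β) (w : α → β), 2 ≤ n →
    (∀ i < n, ∀ j < n, f i = f j → i = j) → ∀ j < n,
      relabelList (net n f) y w (f j) = y (labelIdx n j - n) := by
  induction n using Nat.strong_induction_on with
  | _ n ih =>
  intro f y w hn hf j hj
  by_cases hn3 : n = 2
  · subst hn3
    have hf01 : f 0 ≠ f 1 := fun h => by have := hf 0 (by omega) 1 (by omega) h; omega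
    have hg : gateCount 2 = 1 := by rw [gateCount]; rfl
    have hl : lastOffset 2 = 1 := by rw [lastOffset]; rfl
    obtain rfl | rfl : j = 0 ∨ j = 1 := by omega
    · simp [net_two, relabelList, hf01, labelIdx, hg]
    · simp [net_two, relabelList, labelIdx, hg, hl]
  have inj : ∀ i j, i < n → j < n → i ≠ j → f i ≠ f j :=
      fun i j hi hj h h' => h (hf i hi j hj h')
  have hG := half_le_gateCount n hn
  have hg : gateCount n = n / 2 + n / 2 + gateCount (n / 2) + gateCount (n - n / 2) := by
    rw [gateCount, if_neg (by omega)]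
  have e1 : (n + 1) / 2 = n - n / 2 := by omega
  rw [net_of_three_le n f (by omega), relabelList_append]
  by_cases hjl : j < 2 * (n / 2)
  · rw [netLayer, relabelList_layer f _ (n / 2)
      (fun i hi j hj => hf i (by omega) j (by omega)) _ j hjl]
    refine congrArg y ?_
    simp only [List.length_append, List.length_map, List.length_range, length_net]
    rw [e1]
    unfold labelIdx
    split_ifs with h
    · rw [lastOffset, if_pos (by omega)]
      omega
    · omega
  · rw [relabelList_of_forall_ne]
    · rw [relabelList_append]
      have h1 := ih ((n + 1) / 2) (by omega) (fun i => f (min (2 * i + 1) (n - 1)))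
        (fun i => y (i + 2 * (netLayer n f ++ net (n / 2) fun i => f (2 * i)).length))
        (relabelList (netLayer n f ++ net (n / 2) fun i => f (2 * i)) y w) (by omega)
        (by
          intro i hi j hj h
          have := hf _ (by omega) _ (by omega) h
          omega) (n / 2) (by omega)
      rw [show min (2 * (n / 2) + 1) (n - 1) = j by omega] at h1
      rw [h1]
      refine congrArg y ?_
      simp only [List.length_append, length_netLayer, length_net]
      have := lastOffset_le (n - n / 2) (by omega)
      rw [e1]
      unfold labelIdx
      rw [if_pos (by omega), if_pos (by omega), lastOffset.eq_def n, if_neg (by omega)]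
      omega
    · intro p hp
      simp only [netLayer, List.mem_map, List.mem_range] at hp
      obtain ⟨i, hi, rfl⟩ := hp
      exact ⟨inj _ _ (by omega) (by omega) (by omega), inj _ _ (by omega) (by omega) (by omega)⟩

theorem labelIdx_lt {n j : ℕ} (hj : j < n) : labelIdx n j < n + 2 * gateCount n := by
  have h1 : 1 ≤ lastOffset n := by
    by_cases h : n % 2 = 1
    · have := le_lastOffset n h; omega
    · rw [lastOffset, if_pos (by omega)]
  unfold labelIdx
  split_ifs with h
  · omega
  · have := half_le_gateCount n (by omega); omega

theorem le_labelIdx {n j : ℕ} (hn : 2 ≤ n) : n ≤ labelIdx n j := by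
  have h1 := lastOffset_le n hn
  have h2 := half_le_gateCount n hn
  unfold labelIdx
  split_ifs <;> omega

/-- Shares planted on distinct outgoing wires therefore never compete for the same label. -/
theorem labelIdx_injective {n i j : ℕ} (hi : i < n) (hj : j < n) (h : labelIdx n i = labelIdx n j) :
    i = j := by
  have key : ∀ j, j < n → j + 1 ≠ n → labelIdx n j ≠ labelIdx n (n - 1) := by
    intro j hj hj'
    have h1 := lastOffset_le n (by omega)
    have h2 := half_le_gateCount n (by omega)
    unfold labelIdx
    rw [if_neg hj', if_pos (by omega)]
    by_cases hodd : n % 2 = 1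
    · have := le_lastOffset n hodd; omega
    · rw [lastOffset, if_pos (by omega)]; omega
  by_cases h1 : i + 1 = n
  · by_cases h2 : j + 1 = n
    · omega
    · exact absurd h.symm (by rw [show i = n - 1 by omega]; exact key j hj h2)
  · by_cases h2 : j + 1 = n
    · exact absurd h (by rw [show j = n - 1 by omega]; exact key i hi h1)
    · unfold labelIdx at h
      rw [if_neg h1, if_neg h2] at h
      omega

end Fold

/-! ## The gates of the network -/

theorem gates_eq_net (n : ℕ) : gates (n + 1) = net (n + 1) (Fin.ofNat (n + 1)) := by
  rw [gates, net]
  congr 1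
  refine List.ext_getElem (by simp) fun i h₁ h₂ => ?_
  have : i < n + 1 := by simpa using h₁
  simp [Fin.ext_iff, Nat.mod_eq_of_lt this]

theorem numGates_eq (N : ℕ) : numGates N = gateCount N := by
  cases N with
  | zero => simp [numGates, gates, benes, gateCount]
  | succ n => rw [numGates, gates_eq_net, length_net]

theorem ofNat_injective {n : ℕ} : ∀ i < n + 1, ∀ j < n + 1,
    Fin.ofNat (n + 1) i = Fin.ofNat (n + 1) j → i = j := by
  intro i hi j hj h
  simpa [Fin.ext_iff, Nat.mod_eq_of_lt hi, Nat.mod_eq_of_lt hj] using h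

theorem ofNat_val {n : ℕ} (j : Fin (n + 1)) : Fin.ofNat (n + 1) j = j := by
  simp

/-- A gate writes two tracks one after the other; distinctness prevents the second update from
erasing the first. -/
theorem gates_get_ne {N : ℕ} (k : Fin (numGates N)) :
    ((gates N).get k).1 ≠ ((gates N).get k).2 := by
  cases N with
  | zero => exact absurd k.2 (by simp [numGates, gates, benes])
  | succ n =>
    have hsub : ∀ p ∈ gates (n + 1), p ∈ net (n + 1) (Fin.ofNat (n + 1)) := by
      rw [gates_eq_net]; exact fun _ h => h
    have h : (gates (n + 1)).get k ∈ gates (n + 1) := List.get_mem _ _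
    obtain ⟨i, j, hi, hj, hij, e⟩ := mem_net _ _ _ (hsub _ h)
    have e' : (gates (n + 1)).get k = (Fin.ofNat (n + 1) i, Fin.ofNat (n + 1) j) := by
      rw [← e]
    rw [e']
    exact fun h' => hij (ofNat_injective i hi j hj h')

/-- A switch of the network, applied to plain values. -/
def plainGate {N l : ℕ} (s : Fin (numGates N) → Bool) (w : Fin N → Str l) (k : Fin (numGates N)) :
    Fin N → Str l :=
  if s k then Function.update (Function.update w ((gates N).get k).1 (w ((gates N).get k).2))
    ((gates N).get k).2 (w ((gates N).get k).1) else w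

theorem take_succ_finRange {n k : ℕ} (hk : k < n) :
    (List.finRange n).take (k + 1) = (List.finRange n).take k ++ [⟨k, hk⟩] := by
  rw [List.take_add_one, List.getElem?_eq_getElem (by simpa using hk)]
  simp

/-- The invariant is that each track carries its plain value masked by its current label. The
transferred string is the exclusive or of an old and a new label, so adding it exchanges the mask.
-/
theorem foldl_evalGate {N l : ℕ} (W : Wires N l) (s : Fin (numGates N) → Bool) (u : Fin N → Str l)
    (k : ℕ) (hk : k ≤ numGates N) :
    ((List.finRange (numGates N)).take k).foldl
      (evalGate s fun k => idealOT (otMessages W k) (s k)) (maskedInput W u) =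
    fun j => (((List.finRange (numGates N)).take k).foldl (plainGate s) u j).xor
      (((List.finRange (numGates N)).take k).foldl (relabel W) W.1 j) := by
  induction k with
  | zero => rfl
  | succ k ih =>
    rw [take_succ_finRange (by omega)]
    simp only [List.foldl_append, List.foldl_cons, List.foldl_nil]
    rw [ih (by omega)]
    funext j
    set v := ((List.finRange (numGates N)).take k).foldl (plainGate s) u
    set a := ((List.finRange (numGates N)).take k).foldl (relabel W) W.1 with ha
    have hb : labelsBefore W ⟨k, by omega⟩ = a := rfl
    have hne := gates_get_ne (⟨k, by omega⟩ : Fin (numGates N))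
    have hx : ∀ x y z : Str l, (x.xor y).xor (y.xor z) = x.xor z := fun x y z => by
      rw [Str.xor_assoc, Str.xor_self_cancel]
    cases hs : s ⟨k, by omega⟩ <;>
      simp only [evalGate, plainGate, relabel, idealOT, otMessages, hs, hb, hx, if_true,
        Bool.false_eq_true, if_false, Function.update_apply] <;> split_ifs <;> simp_all

/-- Taking the masking invariant after all gates reduces the claim to plain values, where
`route_net` applies. -/
theorem evaluate_switch {N l : ℕ} (W : Wires N l) (ρ : Equiv.Perm (Fin N)) (u : Fin N → Str l) :
    evaluate (switch ρ) (otOutputs W ρ) (maskedInput W u) =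
      fun j => (u (ρ j)).xor (outLabels W j) := by
  have h := foldl_evalGate W (switch ρ) u (numGates N) le_rfl
  rw [List.take_of_length_le (by simp)] at h
  refine Eq.trans h (funext fun j => ?_)
  congr 1
  cases N with
  | zero => exact j.elim0
  | succ n =>
    set r : ℕ → ℕ := fun i => if h : i < n + 1 then (ρ ⟨i, h⟩ : ℕ) else i with hr
    have hlen : (gates (n + 1)).length = (looping (n + 1) r).length := by
      rw [length_looping, ← numGates_eq]
    have h1 := foldl_finRange_eq_route (gates (n + 1)) (looping (n + 1) r) u hlen
    have h2 := route_net (n + 1) (Fin.ofNat (n + 1)) r u ofNat_injective ⟨fun i hi => ?_,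
      fun i hi j hj hij => ?_⟩ j j.2
    · rw [← gates_eq_net, ofNat_val, show r j = ρ j by simp only [hr, dif_pos j.2],
        ofNat_val, ← h1] at h2
      exact h2
    · simp only [hr, dif_pos hi]; exact (ρ _).2
    · simp only [hr, dif_pos hi, dif_pos hj] at hij
      simpa using ρ.injective (Fin.ext hij)

theorem receiverShares_eq {N l c : ℕ} (W : Wires N l) (ρ : Equiv.Perm (Fin N)) (u : Fin N → Str l)
    (r : Fin c → Fin N) :
    receiverShares ρ (maskedInput W u) (otOutputs W ρ) r =
      fun i => (u (ρ (r i))).xor (outLabels W (r i)) := by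
  funext i
  rw [receiverShares, evaluate_switch]

/-! ## Wire labels as a list -/

/-- The wire labels with values `y 0`, `y 1`, …. -/
def wiresOf {N l : ℕ} (y : ℕ → Str l) : Wires N l :=
  (fun i => y i, fun k => (y (N + 2 * k), y (N + 2 * k + 1)))

/-- The labels of all wires: incoming wires first, then the outgoing wires of the gates. -/
def flatLabels {N l : ℕ} (W : Wires N l) (i : ℕ) : Str l :=
  if h : i < N then W.1 ⟨i, h⟩ else if h : (i - N) / 2 < numGates N then
    (if (i - N) % 2 = 0 then (W.2 ⟨_, h⟩).1 else (W.2 ⟨_, h⟩).2) else fun _ => false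

theorem wiresOf_flatLabels {N l : ℕ} (W : Wires N l) : wiresOf (flatLabels W) = W := by
  refine Prod.ext (funext fun i => ?_) (funext fun k => Prod.ext ?_ ?_)
  · simp [wiresOf, flatLabels]
  · simp only [wiresOf, flatLabels]
    have := k.2
    rw [dif_neg (by omega), dif_pos (by omega), if_pos (by omega)]
    congr 2
    exact congrArg W.2 (Fin.ext (by simp only; omega))
  · simp only [wiresOf, flatLabels]
    have := k.2
    rw [dif_neg (by omega), dif_pos (by omega), if_neg (by omega)]
    congr 2
    exact congrArg W.2 (Fin.ext (by simp only; omega))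

theorem outLabels_wiresOf {N l : ℕ} (y : ℕ → Str l) (j : Fin N) :
    outLabels (wiresOf y) j = y (labelIdx N j) := by
  cases N with
  | zero => exact j.elim0
  | succ n =>
    have h1 := foldl_finRange_eq_relabelList (gates (n + 1)) (fun i => y (n + 1 + i))
      (wiresOf (N := n + 1) y).1
    have h2 : outLabels (wiresOf y) j = relabelList (gates (n + 1)) (fun i => y (n + 1 + i))
      (wiresOf (N := n + 1) y).1 j := by
      rw [← h1]; rfl
    rw [h2, gates_eq_net]
    by_cases hn : 2 ≤ n + 1
    · have h3 := relabelList_net (n + 1) (Fin.ofNat (n + 1)) (fun i => y (n + 1 + i))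
        (wiresOf (N := n + 1) y).1 hn ofNat_injective j j.2
      rw [ofNat_val] at h3
      rw [h3]
      have := le_labelIdx (j := j) hn
      congr 1; omega
    -- On a single track there are no gates: the outgoing wire is the incoming one, at position `1 +
    -- 0 - 1 = 0`.
    · obtain rfl : n = 0 := by omega
      have hj : (j : ℕ) = 0 := by omega
      simp [net_one, relabelList, wiresOf, labelIdx, gateCount, lastOffset]

/-! ## The messages of the sender determine the labels -/

/-- Dependence on earlier gates only makes the map from labels to messages triangular, as
`messages_bijective` requires. -/
theorem labelsBefore_congr {N l : ℕ} {W W' : Wires N l} (h₁ : W.1 = W'.1) (k : Fin (numGates N))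
    (h₂ : ∀ i < k, W.2 i = W'.2 i) : labelsBefore W k = labelsBefore W' k := by
  unfold labelsBefore
  rw [h₁]
  refine List.foldl_ext _ _ _ fun a i hi => ?_
  have : i < k := by
    obtain ⟨m, hm, rfl⟩ := List.getElem_of_mem hi
    simp only [List.length_take, List.length_finRange] at hm
    simp only [List.getElem_take, List.getElem_finRange, Fin.lt_def, Fin.val_cast]
    omega
  unfold relabel
  rw [h₂ i this]

/-- The masked vector reveals the incoming labels, and gate by gate the transferred pair reveals the
outgoing labels from the labels before it. Messages and labels range over the same finite type, so
injectivity suffices. Hence the messages are uniform for every input vector and every programming of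
the network. -/
theorem messages_bijective {N l : ℕ} (u : Fin N → Str l) (ρ : Equiv.Perm (Fin N)) :
    Function.Bijective fun W : Wires N l => ((maskedInput W u, otOutputs W ρ) : Wires N l) := by
  rw [← Finite.injective_iff_bijective]
  intro W W' h
  obtain ⟨h₁, h₂⟩ := Prod.ext_iff.1 h
  have e₁ : W.1 = W'.1 := funext fun j => Str.xor_right_injective _ (congrFun h₁ j)
  refine Prod.ext e₁ (funext fun k => ?_)
  have key : ∀ n, ∀ k : Fin (numGates N), (k : ℕ) = n → W.2 k = W'.2 k := by
    intro n
    induction n using Nat.strong_induction_on with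
    | _ n ih =>
      intro k hk
      have hl := labelsBefore_congr e₁ k fun i hi => ih i (by rw [← hk]; exact hi) i rfl
      have ht : otOutputs W ρ k = otOutputs W' ρ k := congrFun h₂ k
      simp only [otOutputs, otMessages, idealOT, hl] at ht
      split_ifs at ht
      · obtain ⟨t₁, t₂⟩ := Prod.ext_iff.1 ht
        exact Prod.ext (Str.xor_right_injective _ t₂) (Str.xor_right_injective _ t₁)
      · obtain ⟨t₁, t₂⟩ := Prod.ext_iff.1 ht
        exact Prod.ext (Str.xor_right_injective _ t₁) (Str.xor_right_injective _ t₂)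
  exact key _ k rfl

/-! ### The simulators as programs, with their exact output laws. -/

/-! ## Copying parts of the input -/

theorem range_map_getD {w pre body post : List ℕ} (h : w = pre ++ body ++ post) {q m : ℕ}
    (hq : pre.length = q) (hm : body.length = m) :
    (List.range m).map (fun t => w.getD (q + t) 0) = body := by
  subst h hq hm
  refine List.ext_getElem (by simp) fun i h₁ h₂ => ?_
  simp only [List.getElem_map, List.getElem_range, List.append_assoc]
  rw [List.getD_append_right _ _ _ _ (by omega), Nat.add_sub_cancel_left,
    List.getD_append _ _ _ _ h₂, List.getD_eq_getElem _ _ h₂]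

theorem getD_at {w pre post : List ℕ} {x q : ℕ} (h : w = pre ++ x :: post) (hq : pre.length = q) :
    w.getD q 0 = x := by
  subst h hq
  simp

/-- Emit part of the input. -/
def emitSlice (i r : ℕ) (e : Ex) : Cmd := .rep i e (.emit (.get 0 (.add (.reg r) (.reg i))))

theorem emitSlice_spec {B i r n q : ℕ} {e : Ex} {s : Mem} (hri : r ≠ i) (hr : s.reg r = q)
    (hn : e.eval s = n) (hB : n ≤ B) :
    Spec B (emitSlice i r e) s (PMF.pure ((List.range n).map fun t => s.arr 0 (q + t)))
      fun l s' => s'.out = s.out ++ l := by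
  have := Spec.rep_emit (B := B) (a := i) (e := e) (P := .emit (.get 0 (.add (.reg r) (.reg i))))
    (s := s) (μ := fun k => PMF.pure [s.arr 0 (q + k)]) hn hB fun k hk s' hf => Spec.of_pure rfl ?_
  · rwa [seqLaw_pure, ← List.map_eq_flatMap] at this
  · have h1 := hf.reg r (by simp [Cmd.regs, hri])
    simp [Ex.eval, hf.arr 0 (by simp [Cmd.arrs]), Mem.set_reg_ne _ _ hri, h1, hr]

theorem Spec.unit_of_emit {B P s} {l : List ℕ} {Q : List ℕ → Mem → Prop}
    (h : Spec B P s (PMF.pure l) Q) : Spec B P s (PMF.pure ()) fun _ s' => Q l s' := by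
  intro k ν hk
  have := h k (fun _ => ν ()) fun a ha s' hs' hQ => ?_
  · rwa [PMF.pure_bind] at this ⊢
  · rw [PMF.mem_support_pure_iff] at ha
    subst ha
    exact hk () (by simp) s' hs' hQ

/-! ## The simulator for a data owner

Registers: `1`, `2` lengths of the attributes of the owner and of the other party; `3`, `4` offsets,
within a row of the shares, of the part kept by the owner and the part sent by the server; `5` size
of the dataset; `10` number of rows; `12` position of the shares in the input. -/

/-- Copy the dataset to the output. -/
def copyData : Cmd :=
  .seq (.set 5 (.get 0 (.lit 5))) (.seq (.emit (.reg 5)) (.seq (.set 6 (.lit 6))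
    (.seq (.rep 7 (.reg 5) (.seq (.emit (.get 0 (.reg 6))) (.seq (.set 9 (.get 0 (.reg 6)))
      (.seq (.set 6 (.add (.reg 6) (.lit 1))) (.seq (emitSlice 8 6 (.add (.reg 9) (.reg 1)))
        (.set 6 (.add (.reg 6) (.add (.reg 9) (.reg 1)))))))))
    (.seq (.set 10 (.get 0 (.reg 6))) (.set 12 (.add (.reg 6) (.lit 1)))))))

/-- A record announces only the length of its identifier; the attribute length `la` is public,
whence `b.length - la`. The five parameters occupy positions 0 to 4, the dataset size position 5,
the records start at 6, and the number of rows comes just after them, so the shares begin at `7 +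
recs.flatten.length`. -/
theorem copyData_spec {B la : ℕ} {s : Mem} {w pre post : List ℕ} {recs : List (List ℕ)} {c : ℕ}
    (hw : w = pre ++ recs.length :: recs.flatten ++ c :: post) (hpre : pre.length = 5)
    (hs : ∀ i, s.arr 0 i = w.getD i 0) (h1 : s.reg 1 = la) (hB : recs.length ≤ B)
    (hrec : ∀ l ∈ recs, ∃ b, l = (b.length - la) :: b ∧ la ≤ b.length ∧ b.length ≤ B) :
    Spec B copyData s (PMF.pure ()) fun _ s' =>
      s'.reg 5 = recs.length ∧ s'.reg 10 = c ∧ s'.reg 12 = 7 + recs.flatten.length ∧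
      s'.out = s.out ++ recs.length :: recs.flatten := by
  have w5 : w.getD 5 0 = recs.length := getD_at (pre := pre)
    (post := recs.flatten ++ c :: post) (by rw [hw]; simp) hpre
  refine Spec.set_seq (Spec.emit_seq (Spec.set_seq ?_))
  simp only [Ex.eval, hs, w5, Mem.set_reg_self]
  refine Spec.seq_unit (Q' := fun _ s' => s'.reg 6 = 6 + recs.flatten.length ∧
    s'.out = s.out ++ recs.length :: recs.flatten) ?_ fun s₁ hf₁ ⟨h6, ho⟩ => ?_
  · have := Spec.rep (α := Unit) (B := B) (a := 7) (e := .reg 5) (P := .seq (.emit (.get 0 (.reg 6)))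
      (.seq (.set 9 (.get 0 (.reg 6)))
      (.seq (.set 6 (.add (.reg 6) (.lit 1))) (.seq (emitSlice 8 6 (.add (.reg 9) (.reg 1)))
        (.set 6 (.add (.reg 6) (.add (.reg 9) (.reg 1))))))))
      (s := ((s.set 5 recs.length).emit recs.length).set 6 6) (n := recs.length)
      (D := fun _ => PMF.pure ()) (x₀ := ()) (fun _ _ => PMF.pure ())
      (I := fun k _ s' => s'.reg 6 = 6 + (recs.take k).flatten.length ∧
        s'.out = s.out ++ recs.length :: (recs.take k).flatten)
      (by simp [Ex.eval, Mem.set]) hB rfl (fun _ _ => (PMF.pure_bind _ _).symm)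
      (by simp) (fun k hk _ s' hf ⟨h6, ho⟩ => ?_)
    · rwa [List.take_length] at this
    · obtain ⟨b, hb, hla, hbB⟩ := hrec recs[k] (List.getElem_mem hk)
      have ht : recs.take (k + 1) = recs.take k ++ [recs[k]] := by
        rw [List.take_add_one, List.getElem?_eq_getElem hk]; rfl
      have hfl : recs.flatten = (recs.take k).flatten ++
          ((b.length - la) :: b) ++ (recs.drop (k + 1)).flatten := by
        conv_lhs => rw [← List.take_append_drop (k + 1) recs, ht]
        rw [hb]; simp
      have ha : ∀ i, s'.arr 0 i = w.getD i 0 := fun i => by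
        rw [hf.arr 0 (by decide)]; exact hs i
      have hlen : w.getD (6 + (recs.take k).flatten.length) 0 = b.length - la :=
        getD_at (pre := pre ++ recs.length :: (recs.take k).flatten)
          (post := b ++ (recs.drop (k + 1)).flatten ++ c :: post)
          (by rw [hw, hfl]; simp) (by simp [hpre]; omega)
      have hbody := range_map_getD (w := w) (pre := pre ++ recs.length ::
        (recs.take k).flatten ++ [b.length - la]) (body := b)
        (post := (recs.drop (k + 1)).flatten ++ c :: post)
        (q := 6 + (recs.take k).flatten.length + 1) (m := b.length)
          (by rw [hw, hfl]; simp) (by simp [hpre]; omega) rfl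
      have r1 : s'.reg 1 = la := by rw [hf.reg 1 (by decide)]; exact h1
      refine Spec.emit_seq (Spec.set_seq (Spec.set_seq ?_))
      simp only [Ex.eval, Mem.emit_reg, Mem.emit_arr, Mem.set_arr, ha, Mem.set_reg_ne _ _
        (show 6 ≠ 7 by decide), Mem.set_reg_ne _ _ (show 6 ≠ 9 by decide), h6, hlen]
      refine Spec.seq_unit (Spec.unit_of_emit (emitSlice_spec (by decide) (Mem.set_reg_self _ _ _)
        (n := b.length) ?_ hbB)) fun s₂ hf₂ h₂ => Spec.set ?_
      · simp [Ex.eval, Mem.set, r1]; omega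
      · have r6 := hf₂.reg 6 (by decide)
        have r9 := hf₂.reg 9 (by decide)
        have r1' := hf₂.reg 1 (by decide)
        rw [Mem.set_reg_self] at r6
        rw [Mem.set_reg_ne _ _ (by decide), Mem.set_reg_self] at r9
        rw [Mem.set_reg_ne _ _ (by decide), Mem.set_reg_ne _ _ (by decide), Mem.emit_reg,
          Mem.set_reg_ne _ _ (by decide), r1] at r1'
        refine ⟨?_, ?_⟩
        · rw [Mem.set_reg_self]
          simp only [Ex.eval, r6, r9, r1', ht, hb]
          simp; omega
        · rw [Mem.set_out, h₂]
          simp only [Mem.set_out, Mem.emit_out, Mem.set_arr, Mem.emit_arr, ha, hbody, ho, ht, hb]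
          simp
  · have ha : ∀ i, s₁.arr 0 i = w.getD i 0 := fun i => by
      rw [hf₁.arr 0 (by decide)]; exact hs i
    have hc : w.getD (6 + recs.flatten.length) 0 = c :=
      getD_at (pre := pre ++ recs.length :: recs.flatten) hw (by simp [hpre]; omega)
    have r5 : s₁.reg 5 = recs.length := by
      rw [hf₁.reg 5 (by decide), Mem.set_reg_ne _ _ (by decide), Mem.emit_reg, Mem.set_reg_self]
    refine Spec.set_seq (Spec.set ⟨?_, ?_, ?_, ?_⟩)
    · simp only [Mem.set_reg_ne _ _ (show 5 ≠ 12 by decide),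
        Mem.set_reg_ne _ _ (show 5 ≠ 10 by decide), r5]
    · simp only [Mem.set_reg_ne _ _ (show 10 ≠ 12 by decide), Mem.set_reg_self, Ex.eval, ha, h6, hc]
    · simp only [Mem.set_reg_self, Ex.eval, Mem.set_reg_ne _ _ (show 6 ≠ 10 by decide), h6]
      omega
    · simp only [Mem.set_out, ho]

/-- Record, for every wire whose label is prescribed by a share, the position of the share. -/
def markOwners : Cmd :=
  .seq (.set 11 (.add (.reg 5) (.add (.get 3 (.reg 5)) (.get 3 (.reg 5)))))
  (.seq (.set 6 (.add (.reg 12) (.reg 3)))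
  (.rep 7 (.reg 10) (.seq (.set 16 (.get 1 (.reg 7)))
    (.seq (.ite (.sub (.reg 5) (.add (.reg 16) (.lit 1)))
      (.set 15 (.add (.sub (.reg 11) (.add (.get 2 (.reg 5)) (.get 2 (.reg 5)))) (.reg 16)))
      (.set 15 (.sub (.reg 11) (.get 4 (.reg 5)))))
    (.seq (.put 5 (.reg 15) (.reg 6))
      (.set 6 (.add (.reg 6) (.add (.reg 1) (.reg 2)))))))))

/-- In array 5 the value 0 stands for an unmarked wire; a true position of a share is never 0,
because shares come after the parameters in the input. The two clauses are consistent because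
distinct tracks have distinct label positions. -/
theorem markOwners_spec {B n c la ls p : ℕ} {s : Mem} {ρ : List ℕ} (hB : c ≤ B) (hc : c ≤ n)
    (h1 : s.reg 1 = la) (h2 : s.reg 2 = ls) (h5 : s.reg 5 = n) (h10 : s.reg 10 = c)
    (hp : s.reg 12 + s.reg 3 = p) (ht2 : s.arr 2 n = n / 2) (ht3 : s.arr 3 n = gateCount n)
    (ht4 : s.arr 4 n = lastOffset n) (hρ : ∀ k < n, s.arr 1 k = ρ.getD k 0)
    (hρn : ∀ k < n, ρ.getD k 0 < n)
    (hρi : ∀ k < n, ∀ j < n, ρ.getD k 0 = ρ.getD j 0 → k = j) (h0 : ∀ i, s.arr 5 i = 0) :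
    Spec B markOwners s (PMF.pure ()) fun _ s' => ∀ i,
      (∀ t < c, labelIdx n (ρ.getD t 0) = i → s'.arr 5 i = p + t * (la + ls)) ∧
      ((∀ t < c, labelIdx n (ρ.getD t 0) ≠ i) → s'.arr 5 i = 0) := by
  refine Spec.set_seq (Spec.set_seq ?_)
  simp only [Ex.eval, h5, ht3, Mem.set_reg_ne _ _ (show 12 ≠ 11 by decide),
    Mem.set_reg_ne _ _ (show 3 ≠ 11 by decide), hp]
  refine (Spec.rep (α := Unit) (n := c) (D := fun _ => PMF.pure ()) (x₀ := ())
    (fun _ _ => PMF.pure ()) (I := fun k _ s' => s'.reg 6 = p + k * (la + ls) ∧ ∀ i,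
      (∀ t < k, labelIdx n (ρ.getD t 0) = i → s'.arr 5 i = p + t * (la + ls)) ∧
      ((∀ t < k, labelIdx n (ρ.getD t 0) ≠ i) → s'.arr 5 i = 0)) ?_ hB rfl
    (fun _ _ => (PMF.pure_bind _ _).symm) ?_ fun k hk _ s' hf ⟨h6, hI⟩ => ?_).weaken
    fun _ _ s' _ h => h.2
  · simp [Ex.eval, Mem.set, h10]
  · simp [h0]
  · have r1 : s'.reg 1 = la := by rw [hf.reg 1 (by decide)]; simp [Mem.set, h1]
    have r2 : s'.reg 2 = ls := by rw [hf.reg 2 (by decide)]; simp [Mem.set, h2]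
    have r5 : s'.reg 5 = n := by rw [hf.reg 5 (by decide)]; simp [Mem.set, h5]
    have r11 : s'.reg 11 = n + (gateCount n + gateCount n) := by
      rw [hf.reg 11 (by decide)]; simp [Mem.set]
    have a1 : s'.arr 1 = s.arr 1 := by rw [hf.arr 1 (by decide)]; rfl
    have a2 : s'.arr 2 = s.arr 2 := by rw [hf.arr 2 (by decide)]; rfl
    have a4 : s'.arr 4 = s.arr 4 := by rw [hf.arr 4 (by decide)]; rfl
    have hρk := hρn k (by omega)
    refine Spec.set_seq (Spec.seq_unit (Q' := fun _ s₂ => s₂.reg 15 = labelIdx n (ρ.getD k 0))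
      (Spec.ite (fun h => Spec.set ?_) (fun h => Spec.set ?_)) fun s₂ hf₂ h₂ => ?_)
    -- The truncated difference `n - (ρ k + 1)` vanishes exactly on the last track, the special case
    -- in `labelIdx`.
    · simp [Ex.eval, Mem.set, r5, a1, hρ k (by omega)] at h
      simp only [Ex.eval, Mem.set_reg_self, Mem.set_arr]
      rw [Mem.set_reg_ne _ _ (by decide), Mem.set_reg_ne _ _ (by decide),
        Mem.set_reg_ne _ _ (by decide), Mem.set_reg_ne _ _ (by decide), r5, r11, a4, ht4]
      unfold labelIdx
      rw [if_pos (by rw [List.getD_eq_getElem?_getD] at hρk ⊢; omega)]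
      omega
    · simp [Ex.eval, Mem.set, r5, a1, hρ k (by omega)] at h
      simp only [Ex.eval, Mem.set_reg_self, Mem.set_arr]
      rw [Mem.set_reg_ne _ _ (by decide), Mem.set_reg_ne _ _ (by decide),
        Mem.set_reg_ne _ _ (by decide), Mem.set_reg_ne _ _ (by decide), r5, r11, a2, ht2, a1,
        hρ k (by omega)]
      unfold labelIdx
      rw [if_neg (by rw [List.getD_eq_getElem?_getD] at hρk ⊢; omega)]
      omega
    · have q6 : s₂.reg 6 = p + k * (la + ls) := by
        rw [hf₂.reg 6 (by decide), Mem.set_reg_ne _ _ (by decide), Mem.set_reg_ne _ _ (by decide), h6]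
      have q1 : s₂.reg 1 = la := by
        rw [hf₂.reg 1 (by decide), Mem.set_reg_ne _ _ (by decide), Mem.set_reg_ne _ _ (by decide), r1]
      have q2 : s₂.reg 2 = ls := by
        rw [hf₂.reg 2 (by decide), Mem.set_reg_ne _ _ (by decide), Mem.set_reg_ne _ _ (by decide), r2]
      have q5 : s₂.arr 5 = s'.arr 5 := by rw [hf₂.arr 5 (by decide)]; rfl
      refine Spec.put_seq (Spec.set ?_)
      simp only [Ex.eval, h₂, q6, Mem.put_reg, q1, q2, Mem.set_reg_self, Mem.set_arr, Mem.put_arr,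
        if_true, Function.update_apply, q5]
      refine ⟨by ring, fun i => ⟨fun t ht hi => ?_, fun hi => ?_⟩⟩
      · by_cases htk : t = k
        · rw [if_pos (by rw [← hi, htk]), htk]
        · rw [if_neg, (hI i).1 t (by omega) hi]
          intro h
          rw [← hi] at h
          exact htk (hρi _ (by omega) _ (by omega)
            (labelIdx_injective (hρn _ (by omega)) (hρn _ (by omega)) h))
      · rw [if_neg fun h => hi k (by omega) h.symm]
        exact (hI i).2 fun t ht => hi t (by omega)

/-- Emit a wire label: a share, if the wire is marked, otherwise uniform bits. -/
def emitLabel (ix : Ex) : Cmd :=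
  .seq (.set 17 (.get 5 ix)) (.ite (.reg 17) (emitSlice 8 17 (.reg 1)) (emitBits 8 9 (.reg 1)))

/-- The law of a label that is fixed or uniform. -/
noncomputable def fixedOr (l : ℕ) : Option (List ℕ) → PMF (List ℕ)
  | some b => PMF.pure b
  | none => bitsLaw l

theorem emitLabel_spec {B la : ℕ} {ix : Ex} {s : Mem} {o : Option (List ℕ)} (h1 : s.reg 1 = la)
    (hB : la ≤ B) (h₁ : ∀ b, o = some b → s.arr 5 (ix.eval s) ≠ 0 ∧
      (List.range la).map (fun t => s.arr 0 (s.arr 5 (ix.eval s) + t)) = b)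
    (h₀ : o = none → s.arr 5 (ix.eval s) = 0) :
    Spec B (emitLabel ix) s (fixedOr la o) fun l s' => s'.out = s.out ++ l := by
  refine Spec.set_seq (Spec.ite (fun h => ?_) fun h => ?_) <;>
    simp only [Ex.eval, Mem.set_reg_self] at h ⊢
  · cases o with
    | some b => exact absurd h (h₁ b rfl).1
    | none =>
      exact emitBits_spec (by simp [Ex.eval, Mem.set, h1]) hB
  · cases o with
    | none => exact absurd (h₀ rfl) h
    | some b =>
      have := emitSlice_spec (B := B) (i := 8) (r := 17) (e := .reg 1) (n := la) (by decide)
        (Mem.set_reg_self s 17 (s.arr 5 (ix.eval s))) (by simp [Ex.eval, Mem.set, h1]) hB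
      simp only [Mem.set_arr, (h₁ b rfl).2] at this
      exact this

/-- Emit the rows of the shares sent by the server. -/
def emitSent : Cmd :=
  .seq (.set 6 (.add (.reg 12) (.reg 4))) (.rep 7 (.reg 10)
    (.seq (emitSlice 8 6 (.reg 2)) (.set 6 (.add (.reg 6) (.add (.reg 1) (.reg 2))))))

theorem emitSent_spec {B c la ls p : ℕ} {s : Mem} {sent : ℕ → List ℕ} (hB : c ≤ B) (hB' : ls ≤ B)
    (h1 : s.reg 1 = la) (h2 : s.reg 2 = ls) (h10 : s.reg 10 = c) (hp : s.reg 12 + s.reg 4 = p)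
    (hs : ∀ k < c, (List.range ls).map (fun t => s.arr 0 (p + k * (la + ls) + t)) = sent k) :
    Spec B emitSent s (PMF.pure ()) fun _ s' =>
      s'.out = s.out ++ (List.range c).flatMap sent := by
  refine Spec.set_seq ?_
  simp only [Ex.eval, hp]
  refine (Spec.rep (α := Unit) (n := c) (D := fun _ => PMF.pure ()) (x₀ := ())
    (fun _ _ => PMF.pure ()) (I := fun k _ s' => s'.reg 6 = p + k * (la + ls) ∧
      s'.out = s.out ++ (List.range k).flatMap sent) ?_ hB rfl
    (fun _ _ => (PMF.pure_bind _ _).symm) ?_ fun k hk _ s' hf ⟨h6, ho⟩ => ?_).weaken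
    fun _ _ s' _ h => h.2
  · simp [Ex.eval, Mem.set, h10]
  · simp
  · have r1 : s'.reg 1 = la := by rw [hf.reg 1 (by decide)]; simp [Mem.set, h1]
    have r2 : s'.reg 2 = ls := by rw [hf.reg 2 (by decide)]; simp [Mem.set, h2]
    have a0 : s'.arr 0 = s.arr 0 := by rw [hf.arr 0 (by decide)]; rfl
    refine Spec.seq_unit (Spec.unit_of_emit (emitSlice_spec (by decide)
      ((Mem.set_reg_ne _ _ (by decide)).trans h6) (n := ls) (by simp [Ex.eval, Mem.set, r2])
      hB')) fun s₂ hf₂ h₂ => Spec.set ⟨?_, ?_⟩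
    · simp only [Ex.eval, Mem.set_reg_self]
      rw [hf₂.reg 6 (by decide), hf₂.reg 1 (by decide), hf₂.reg 2 (by decide),
        Mem.set_reg_ne _ _ (by decide), Mem.set_reg_ne _ _ (by decide),
        Mem.set_reg_ne _ _ (by decide), h6, r1, r2]
      ring
    · rw [Mem.set_out, h₂]
      simp only [Mem.set_out, Mem.set_arr, a0, hs k hk, ho, List.range_succ]
      simp

/-- Set the registers that depend on the role of the data owner. -/
def partySetup (second : Bool) : Cmd :=
  if second then
    .seq (.set 1 (.get 0 (.lit 4))) (.seq (.set 2 (.get 0 (.lit 3)))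
      (.seq (.set 3 (.get 0 (.lit 3))) (.set 4 (.lit 0))))
  else
    .seq (.set 1 (.get 0 (.lit 3))) (.seq (.set 2 (.get 0 (.lit 4)))
      (.seq (.set 3 (.lit 0)) (.set 4 (.get 0 (.lit 3)))))

/-- The part of the simulator for a data owner after the initialization. -/
def partyMain : Cmd :=
  .seq copyData
  (.seq (emitBits 7 9 (.get 0 (.lit 1)))
  (.seq (shuffle 1 7 9 (.reg 5))
  (.seq (.emit (.reg 5))
  (.seq (emitArr 1 7 (.reg 5))
  (.seq (tables 2 7 13 14 (.reg 5))
  (.seq (shuffle 1 7 9 (.reg 5))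
  (.seq markOwners
  (.seq (.emit (.reg 5))
  (.seq (.rep 7 (.reg 5) (emitLabel (.reg 7)))
  (.seq (.emit (.get 3 (.reg 5)))
  (.seq (.rep 7 (.add (.get 3 (.reg 5)) (.get 3 (.reg 5))) (emitLabel (.add (.reg 5) (.reg 7))))
  (.seq (.emit (.reg 10))
  (.seq (emitArr 1 7 (.reg 10))
  (.seq (.emit (.reg 10)) emitSent))))))))))))))

/-- The simulator for a data owner. -/
def partyCmd (second : Bool) : Cmd := .seq (partySetup second) partyMain

/-- The label of wire `i` prescribed by the shares. -/
def prescribed (n c : ℕ) (ρ : List ℕ) (kept : ℕ → List ℕ) (i : ℕ) : Option (List ℕ) :=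
  ((List.range c).find? fun t => labelIdx n (ρ.getD t 0) = i).map kept

/-- The law of the output of the simulator for a data owner. -/
noncomputable def partyLaw (κ₁ la n c : ℕ) (ds : List ℕ) (kept sent : ℕ → List ℕ) :
    PMF (List ℕ) :=
  (bitsLaw κ₁).bind fun key => (permLaw n).bind fun σ => (permLaw n).bind fun ρ =>
    (seqLaw n fun i => fixedOr la (prescribed n c ρ kept i)).bind fun lab₁ =>
    (seqLaw (gateCount n + gateCount n) fun i => fixedOr la (prescribed n c ρ kept (n + i))).bind
      fun lab₂ => PMF.pure (ds ++ key ++ n :: σ ++ n :: lab₁ ++ gateCount n :: lab₂ ++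
        c :: ρ.take c ++ c :: (List.range c).flatMap sent)

/-- The contents of the registers of the simulator that stay fixed. -/
structure PartyCtx (w : List ℕ) (la ls ko so n c p : ℕ) (s : Mem) : Prop where
  arr0 : ∀ i, s.arr 0 i = w.getD i 0
  r1 : s.reg 1 = la
  r2 : s.reg 2 = ls
  r3 : s.reg 3 = ko
  r4 : s.reg 4 = so
  r5 : s.reg 5 = n
  r10 : s.reg 10 = c
  r12 : s.reg 12 = p

theorem PartyCtx.frame {w la ls ko so n c p P s s'} (h : PartyCtx w la ls ko so n c p s)
    (hf : Frame P s s') (hr : ∀ r ∈ [1, 2, 3, 4, 5, 10, 12], r ∉ P.regs) (ha : 0 ∉ P.arrs) :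
    PartyCtx w la ls ko so n c p s' where
  arr0 i := by rw [hf.arr 0 ha, h.arr0]
  r1 := by rw [hf.reg 1 (hr 1 (by decide)), h.r1]
  r2 := by rw [hf.reg 2 (hr 2 (by decide)), h.r2]
  r3 := by rw [hf.reg 3 (hr 3 (by decide)), h.r3]
  r4 := by rw [hf.reg 4 (hr 4 (by decide)), h.r4]
  r5 := by rw [hf.reg 5 (hr 5 (by decide)), h.r5]
  r10 := by rw [hf.reg 10 (hr 10 (by decide)), h.r10]
  r12 := by rw [hf.reg 12 (hr 12 (by decide)), h.r12]

theorem PartyCtx.emit {w la ls ko so n c p s} (h : PartyCtx w la ls ko so n c p s) (v : ℕ) :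
    PartyCtx w la ls ko so n c p (s.emit v) :=
  ⟨h.arr0, h.r1, h.r2, h.r3, h.r4, h.r5, h.r10, h.r12⟩

theorem permList_length {n : ℕ} (σ : Equiv.Perm (Fin n)) : (permList σ).length = n := by
  simp [permList]

theorem permList_getD {n : ℕ} (σ : Equiv.Perm (Fin n)) {k : ℕ} (hk : k < n) :
    (permList σ).getD k 0 = σ ⟨k, hk⟩ := by
  rw [List.getD_eq_getElem _ _ (by simpa [permList] using hk)]
  simp [permList]

theorem mem_support_permLaw {n : ℕ} {a : List ℕ} (h : a ∈ (permLaw n).support) :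
    ∃ σ : Equiv.Perm (Fin n), a = permList σ := by
  obtain ⟨σ, _, h⟩ := (PMF.mem_support_map_iff _ _ _).1 h
  exact ⟨σ, h.symm⟩

theorem range_map_eq_take {n c : ℕ} {a : List ℕ} {f : ℕ → ℕ} (ha : a.length = n) (hc : c ≤ n)
    (h : ∀ k < n, f k = a.getD k 0) : (List.range c).map f = a.take c := by
  refine List.ext_getElem (by simp; omega) fun i h₁ h₂ => ?_
  have : i < c := by simpa using h₁
  simp only [List.getElem_map, List.getElem_range, List.getElem_take]
  rw [h i (by omega), List.getD_eq_getElem]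

/-- The simulator announces the first `c` values of a random permutation as the injection, uses the
shares of the owner as labels of the outgoing wires so selected, and draws all other labels
uniformly. The bounds by `B` guarantee that no loop is truncated. -/
theorem partyMain_spec {B κ₁ la ls ko so n c : ℕ} {s : Mem} {w pre post : List ℕ}
    {recs : List (List ℕ)} {kept sent : ℕ → List ℕ}
    (hw : w = pre ++ recs.length :: recs.flatten ++ c :: post) (hpre : pre.length = 5)
    (hκ : w.getD 1 0 = κ₁) (hn : recs.length = n) (hcn : c ≤ n)
    (hs : ∀ i, s.arr 0 i = w.getD i 0) (h1 : s.reg 1 = la) (h2 : s.reg 2 = ls) (h3 : s.reg 3 = ko)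
    (h4 : s.reg 4 = so) (h0 : ∀ i, s.arr 5 i = 0) (ho : s.out = [])
    (hrec : ∀ l ∈ recs, ∃ b, l = (b.length - la) :: b ∧ la ≤ b.length ∧ b.length ≤ B)
    (hkept : ∀ k < c, (List.range la).map
      (fun t => w.getD (7 + recs.flatten.length + ko + k * (la + ls) + t) 0) = kept k)
    (hsent : ∀ k < c, (List.range ls).map
      (fun t => w.getD (7 + recs.flatten.length + so + k * (la + ls) + t) 0) = sent k)
    (hBn : n + 1 ≤ B) (hBκ : κ₁ ≤ B) (hBa : la ≤ B) (hBs : ls ≤ B)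
    (hBg : gateCount n + gateCount n ≤ B) :
    Spec B partyMain s (partyLaw κ₁ la n c (n :: recs.flatten) kept sent)
      fun a s' => s'.out = a := by
  set p := 7 + recs.flatten.length with hp
  unfold partyMain partyLaw
  refine Spec.seq_unit (copyData_spec hw hpre hs h1 (by omega) hrec)
    fun s₁ f₁ ⟨e5, e10, e12, e_out⟩ => ?_
  have c₁ : PartyCtx w la ls ko so n c p s₁ :=
    ⟨fun i => by rw [f₁.arr 0 (by decide), hs], by rw [f₁.reg 1 (by decide), h1],
      by rw [f₁.reg 2 (by decide), h2], by rw [f₁.reg 3 (by decide), h3],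
      by rw [f₁.reg 4 (by decide), h4], by rw [e5, hn], e10, e12⟩
  refine Spec.seq (emitBits_spec (n := κ₁) (by simp only [Ex.eval, c₁.arr0, hκ]) hBκ)
    fun key _ s₂ f₂ o₂ => ?_
  have c₂ := c₁.frame f₂ (by decide) (by decide)
  refine Spec.seq (shuffle_spec (n := n) (by decide) c₂.r5 (by omega)) fun σ hσ s₃ f₃ hσ₃ => ?_
  obtain ⟨σ, rfl⟩ := mem_support_permLaw hσ
  have c₃ := c₂.frame f₃ (by decide) (by decide)
  have o₃ := f₃.out (by decide)
  refine Spec.emit_seq ?_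
  simp only [Ex.eval, c₃.r5]
  refine Spec.seq_unit (Spec.unit_of_emit (emitArr_spec (n := n) (c₃.emit n).r5 (by omega)))
    fun s₄ f₄ o₄ => ?_
  have c₄ := (c₃.emit n).frame f₄ (by decide) (by decide)
  rw [Mem.emit_arr, range_map_eq_take (permList_length σ) le_rfl hσ₃,
    List.take_of_length_le (permList_length σ).le] at o₄
  refine Spec.seq_unit (tables_spec (n := n) (by decide) (by decide) (by decide)
    (fun u v => by
      simp only [Ex.eval]
      rw [Mem.set_reg_ne _ _ (by decide), Mem.set_reg_ne _ _ (by decide), c₄.r5]) hBn)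
    fun s₅ f₅ h₅ => ?_
  have c₅ := c₄.frame f₅ (by decide) (by decide)
  have o₅ := f₅.out (by decide)
  refine Spec.seq (shuffle_spec (n := n) (by decide) c₅.r5 (by omega)) fun ρ hρ s₆ f₆ hρ₆ => ?_
  obtain ⟨ρ, rfl⟩ := mem_support_permLaw hρ
  have c₆ := c₅.frame f₆ (by decide) (by decide)
  have o₆ := f₆.out (by decide)
  have z₆ : ∀ i, s₆.arr 5 i = 0 := fun i => by
    rw [f₆.arr 5 (by decide), f₅.arr 5 (by decide), f₄.arr 5 (by decide), Mem.emit_arr,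
      f₃.arr 5 (by decide), f₂.arr 5 (by decide), f₁.arr 5 (by decide), h0]
  have t₆ := h₅ n le_rfl
  refine Spec.seq_unit (markOwners_spec (n := n) (ρ := permList ρ) (p := p + ko)
    (by omega : c ≤ B) hcn c₆.r1 c₆.r2 c₆.r5 c₆.r10
    (by rw [c₆.r12, c₆.r3]) (by rw [f₆.arr 2 (by decide)]; exact t₆.1)
    (by rw [f₆.arr 3 (by decide)]; exact t₆.2.1) (by rw [f₆.arr 4 (by decide)]; exact t₆.2.2) hρ₆
    (fun k hk => by rw [permList_getD ρ hk]; exact (ρ _).2) (fun k hk j hj h => by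
      rw [permList_getD ρ hk, permList_getD ρ hj] at h
      simpa using ρ.injective (Fin.ext h)) z₆) fun s₇ f₇ own₇ => ?_
  have c₇ := c₆.frame f₇ (by decide) (by decide)
  have o₇ := f₇.out (by decide)
  have g₇ : s₇.arr 3 n = gateCount n := by
    rw [f₇.arr 3 (by decide), f₆.arr 3 (by decide)]; exact t₆.2.1
  -- Emitting a label depends only on the fixed registers, the input and array 5, so one statement
  -- serves the incoming wires and, with indices shifted by `n`, the outgoing ones.
  have label : ∀ (s : Mem) (ix : Ex) (i : ℕ), PartyCtx w la ls ko so n c p s →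
      (∀ i, s.arr 5 i = s₇.arr 5 i) → ix.eval s = i →
      Spec B (emitLabel ix) s (fixedOr la (prescribed n c (permList ρ) kept i))
        fun l s' => s'.out = s.out ++ l := by
    intro s ix i hc h5 hi
    refine emitLabel_spec hc.r1 hBa (fun b hb => ?_) fun hb => ?_
    · unfold prescribed at hb
      obtain ⟨t, ht, rfl⟩ := Option.map_eq_some_iff.1 hb
      have htc := List.mem_range.1 (List.mem_of_find?_eq_some ht)
      have htl := List.find?_some ht
      rw [decide_eq_true_iff] at htl
      rw [hi, h5, (own₇ i).1 t htc htl]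
      refine ⟨by omega, ?_⟩
      simp only [hc.arr0]
      exact hkept t htc
    · unfold prescribed at hb
      rw [Option.map_eq_none_iff, List.find?_eq_none] at hb
      rw [hi, h5]
      exact (own₇ i).2 fun t ht => by simpa using hb t (List.mem_range.2 ht)
  refine Spec.emit_seq ?_
  simp only [Ex.eval, c₇.r5]
  refine Spec.seq (Spec.rep_emit (n := n) (c₇.emit n).r5 (by omega) fun i hi s' hf =>
    ((label (s'.set 7 i) (.reg 7) i ?_ ?_ ?_).weaken fun _ _ _ _ h => h))
    fun lab₁ _ s₈ f₈ o₈ => ?_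
  · have c' := (c₇.emit n).frame hf (by decide) (by decide)
    exact c'.frame (P := .set 7 (.lit 0)) (frame_set (by decide) s' i) (by decide) (by decide)
  · intro i; rw [Mem.set_arr, hf.arr 5 (by decide)]; rfl
  · simp [Ex.eval]
  have c₈ := (c₇.emit n).frame f₈ (by decide) (by decide)
  have g₈ : s₈.arr 3 n = gateCount n := by rw [f₈.arr 3 (by decide)]; exact g₇
  refine Spec.emit_seq ?_
  simp only [Ex.eval, c₈.r5, g₈]
  refine Spec.seq (Spec.rep_emit (n := gateCount n + gateCount n) ?_ hBg fun i hi s' hf =>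
    ((label (s'.set 7 i) (.add (.reg 5) (.reg 7)) (n + i) ?_ ?_ ?_).weaken fun _ _ _ _ h => h))
    fun lab₂ _ s₉ f₉ o₉ => ?_
  · simp [Ex.eval, c₈.r5, g₈]
  · have c' := (c₈.emit (gateCount n)).frame hf (by decide) (by decide)
    exact c'.frame (P := .set 7 (.lit 0)) (frame_set (by decide) s' i) (by decide) (by decide)
  · intro i
    rw [Mem.set_arr, hf.arr 5 (by decide), Mem.emit_arr, f₈.arr 5 (by decide)]; rfl
  · have c' := (c₈.emit (gateCount n)).frame hf (by decide) (by decide)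
    simp only [Ex.eval, Mem.set_reg_self]
    rw [Mem.set_reg_ne _ _ (by decide), c'.r5]
  have c₉ := (c₈.emit (gateCount n)).frame f₉ (by decide) (by decide)
  have hρ₉ : ∀ k < n, s₉.arr 1 k = (permList ρ).getD k 0 := fun k hk => by
    rw [f₉.arr 1 (by decide), Mem.emit_arr, f₈.arr 1 (by decide), Mem.emit_arr,
      f₇.arr 1 (by decide), hρ₆ k hk]
  refine Spec.emit_seq ?_
  simp only [Ex.eval, c₉.r10]
  refine Spec.seq_unit (Spec.unit_of_emit (emitArr_spec (n := c) (c₉.emit c).r10 (by omega)))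
    fun s₁₀ f₁₀ o₁₀ => ?_
  have c₁₀ := (c₉.emit c).frame f₁₀ (by decide) (by decide)
  rw [Mem.emit_arr, range_map_eq_take (permList_length ρ) hcn hρ₉] at o₁₀
  refine Spec.emit_seq ?_
  simp only [Ex.eval, c₁₀.r10]
  have hc' := c₁₀.emit c
  have h2 := emitSent_spec (B := B) (c := c) (p := p + so) (sent := sent) (by omega) hBs hc'.r1
    hc'.r2 hc'.r10 (by rw [hc'.r12, hc'.r4]) (fun k hk => by
      simp only [hc'.arr0]; exact hsent k hk)
  intro k ν hk
  have h3 := h2 k (fun _ => ν _) fun _ _ s' hs' ho' => hk _ ((PMF.mem_support_pure_iff _ _).2 rfl)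
    s' hs' ?_
  · rw [h3, PMF.pure_bind, PMF.pure_bind]
  · show s'.out = _
    rw [show s'.out = _ from ho']
    simp only [Mem.emit_out, o₁₀, o₉, o₈, o₇, o₆, o₅, o₄, o₃, o₂, e_out, ho, hn]
    simp

/-- A crude quadratic bound is enough: it shows that the loops over all gate labels stay within the
square of the input size. -/
theorem two_mul_gateCount_le (n : ℕ) : 2 * gateCount n + n ≤ n * n := by
  induction n using Nat.strong_induction_on with
  | _ n ih =>
    rw [gateCount]
    split_ifs with h
    · obtain rfl | rfl | rfl : n = 0 ∨ n = 1 ∨ n = 2 := by omega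
      all_goals simp
    · have h1 := ih (n / 2) (by omega)
      have h2 := ih (n - n / 2) (by omega)
      obtain ⟨a, b, ha, hb, hab, hb2⟩ : ∃ a b, n / 2 = a ∧ n - n / 2 = b ∧ n = a + b ∧ 2 ≤ b :=
        ⟨_, _, rfl, rfl, by omega, by omega⟩
      rw [ha] at h1
      rw [hb] at h2
      rw [hb, ha]
      -- Given the induction hypotheses, what is left is `4 * a ≤ 2 * a * b`, which follows from `2
      -- ≤ b`.
      nlinarith

theorem chunk_eq {w pre post : List ℕ} {chunks : List (List ℕ)} {q m : ℕ}
    (hw : w = pre ++ chunks.flatten ++ post) (hq : pre.length = q)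
    (hm : ∀ l ∈ chunks, l.length = m) {k : ℕ} (hk : k < chunks.length) {x y z : List ℕ}
    (hc : chunks[k] = x ++ y ++ z) {o r : ℕ} (ho : x.length = o) (hr : y.length = r) :
    (List.range r).map (fun t => w.getD (q + o + k * m + t) 0) = y := by
  have hl : ∀ k ≤ chunks.length, (chunks.take k).flatten.length = k * m := by
    intro k hk
    induction k with
    | zero => simp
    | succ k ih =>
      rw [List.take_add_one, List.getElem?_eq_getElem (by omega)]
      simp only [Option.toList_some, List.flatten_append, List.length_append, ih (by omega)]
      simp only [List.flatten_cons, List.flatten_nil, List.append_nil,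
        hm _ (List.getElem_mem (by omega : k < chunks.length))]
      ring
  have hfl : chunks.flatten = (chunks.take k).flatten ++ (x ++ y ++ z) ++
      (chunks.drop (k + 1)).flatten := by
    conv_lhs => rw [← List.take_append_drop (k + 1) chunks, List.take_add_one,
      List.getElem?_eq_getElem hk]
    rw [hc]; simp
  refine range_map_getD (pre := pre ++ (chunks.take k).flatten ++ x)
    (post := z ++ (chunks.drop (k + 1)).flatten ++ post) (by rw [hw, hfl]; simp) ?_ hr
  simp [hq, ho, ← hl k hk.le, List.length_flatten]
  omega

@[simp] theorem encStr_length {k : ℕ} (s : Str k) : (encStr s).length = k := by simp [encStr]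

/-- The records in the encoding of a dataset. -/
def records {l : ℕ} (D : Dataset l) : List (List ℕ) :=
  (List.ofFn fun i : Fin D.size => i).map fun i =>
    encList (fun b : Bool => [b.toNat]) (D.id i) ++ encStr (D.attr i)

theorem records_length {l : ℕ} (D : Dataset l) : (records D).length = D.size := by simp [records]

theorem encDataset_eq {l : ℕ} (D : Dataset l) :
    encDataset D = (records D).length :: (records D).flatten := by
  simp only [encDataset, encVec, encList, records, List.length_map, List.flatMap_def]
  rfl

theorem mem_records {l : ℕ} (D : Dataset l) {r : List ℕ} (hr : r ∈ records D) :
    ∃ b, r = (b.length - l) :: b ∧ l ≤ b.length := by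
  simp only [records, List.mem_map] at hr
  obtain ⟨i, _, rfl⟩ := hr
  exact ⟨(D.id i).flatMap (fun b : Bool => [b.toNat]) ++ encStr (D.attr i), by simp [encList],
    by simp⟩

/-- The Boolean only exchanges the two halves of a row: which is kept and which was sent by the
server. Every length that bounds a loop is at most the input size, except the number of gate labels,
for which the square is needed. -/
theorem partyCmd_output {second : Bool} {κ κ₁ κ₂ x₃ x₄ la ls ko so : ℕ} (D : Dataset la)
    (chunks : List (List ℕ)) (kept sent : ℕ → List ℕ) (hc : chunks.length ≤ D.size)
    (hm : ∀ l ∈ chunks, l.length = la + ls)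
    (hla : la = if second then x₄ else x₃) (hls : ls = if second then x₃ else x₄)
    (hko : ko = if second then x₃ else 0) (hso : so = if second then 0 else x₃)
    (hkept : ∀ k (hk : k < chunks.length), ∃ x z, chunks[k] = x ++ kept k ++ z ∧ x.length = ko ∧
      (kept k).length = la)
    (hsent : ∀ k (hk : k < chunks.length), ∃ x z, chunks[k] = x ++ sent k ++ z ∧ x.length = so ∧
      (sent k).length = ls) :
    (partyCmd second).toPPT.output ([κ, κ₁, κ₂, x₃, x₄] ++ encDataset D ++
      chunks.length :: chunks.flatten) =
    partyLaw κ₁ la D.size chunks.length (encDataset D) kept sent := by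
  set w := [κ, κ₁, κ₂, x₃, x₄] ++ encDataset D ++ chunks.length :: chunks.flatten with hw
  have hw' : w = [κ, κ₁, κ₂, x₃, x₄] ++ (records D).length :: (records D).flatten ++
      chunks.length :: chunks.flatten := by rw [hw, encDataset_eq]
  have hS : inputSize w = κ + κ₁ + κ₂ + x₃ + x₄ + (records D).length + (records D).flatten.sum +
      chunks.length + chunks.flatten.sum + 7 + (records D).flatten.length +
      chunks.flatten.length := by
    simp only [inputSize, hw', List.length_append, List.sum_append, List.length_cons,
      List.length_nil, List.sum_cons, List.sum_nil]
    omega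
  have hSB : inputSize w ≤ inputSize w ^ 2 := Nat.le_self_pow (by decide) _
  have hla' : la ≤ inputSize w := by cases second <;> simp at hla <;> omega
  have hls' : ls ≤ inputSize w := by cases second <;> simp at hls <;> omega
  have hg := two_mul_gateCount_le D.size
  have hn := records_length D
  have hg' : D.size * D.size ≤ inputSize w ^ 2 := by
    rw [sq]; exact Nat.mul_le_mul (by omega) (by omega)
  rw [Cmd.toPPT_output]
  have harr : ∀ i, (Mem.init w).arr 0 i = w.getD i 0 := fun i => rfl
  have hpos : (([κ, κ₁, κ₂, x₃, x₄] ++ (records D).length :: (records D).flatten ++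
      [chunks.length] : List ℕ)).length = 7 + (records D).flatten.length := by
    simp; omega
  have hwc : w = ([κ, κ₁, κ₂, x₃, x₄] ++ (records D).length :: (records D).flatten ++
      [chunks.length]) ++ chunks.flatten ++ [] := by rw [hw']; simp
  have main : Spec (inputSize w ^ 2) (partyCmd second) (Mem.init w)
      (partyLaw κ₁ la D.size chunks.length (encDataset D) kept sent) fun a s' => s'.out = a := by
    have setup : Spec (inputSize w ^ 2) (partySetup second) (Mem.init w) (PMF.pure ()) fun _ s' =>
        s'.reg 1 = la ∧ s'.reg 2 = ls ∧ s'.reg 3 = ko ∧ s'.reg 4 = so := by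
      unfold partySetup
      cases second
      · rw [if_neg (by decide)]
        refine Spec.set_seq (Spec.set_seq (Spec.set_seq (Spec.set ?_)))
        simp [Ex.eval, Mem.set, Mem.init, hw', hla, hls, hko, hso]
      · rw [if_pos rfl]
        refine Spec.set_seq (Spec.set_seq (Spec.set_seq (Spec.set ?_)))
        simp [Ex.eval, Mem.set, Mem.init, hw', hla, hls, hko, hso]
    refine Spec.seq_unit setup fun s hf ⟨h1, h2, h3, h4⟩ => ?_
    have hreg : (partySetup second).arrs = [] ∧ (partySetup second).silent = true := by
      cases second <;> exact ⟨rfl, rfl⟩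
    rw [encDataset_eq, hn]
    refine partyMain_spec (w := w) (post := chunks.flatten) hw' rfl (by rw [hw']; rfl) hn hc
      (fun i => by rw [hf.arr 0 (by rw [hreg.1]; simp), harr]) h1 h2 h3 h4
      (fun i => by rw [hf.arr 5 (by rw [hreg.1]; simp)]; rfl) (by rw [hf.out hreg.2]; rfl)
      (fun l hl => ?_) (fun k hk => ?_) (fun k hk => ?_) (by omega) (by omega) (by omega)
      (by omega) (by omega)
    · obtain ⟨b, rfl, hb⟩ := mem_records D hl
      refine ⟨b, rfl, hb, ?_⟩
      have := (List.sublist_flatten_of_mem hl).length_le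
      rw [List.length_cons] at this
      omega
    · obtain ⟨x, z, e, hx, hy⟩ := hkept k hk
      exact chunk_eq hwc hpos hm hk e hx hy
    · obtain ⟨x, z, e, hx, hy⟩ := hsent k hk
      exact chunk_eq hwc hpos hm hk e hx hy
  have := main.output (f := id) fun a _ s' _ h => h
  rw [this, PMF.map_id]

theorem party₁_output {l₁ l₂ : ℕ} (κ κ₁ κ₂ : ℕ) (D : Dataset l₁) (sh : Shares l₁ l₂)
    (hc : sh.length ≤ D.size) :
    (partyCmd false).toPPT.output (params κ κ₁ κ₂ l₁ l₂ ++ encDataset D ++ encList encPair sh) =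
      partyLaw κ₁ l₁ D.size sh.length (encDataset D)
        (fun k => (sh.map fun p => encStr p.1).getD k [])
        (fun k => (sh.map fun p => encStr p.2).getD k []) := by
  have := partyCmd_output (second := false) (κ := κ) (κ₁ := κ₁) (κ₂ := κ₂) (x₃ := l₁) (x₄ := l₂)
    (ls := l₂) (ko := 0) (so := l₁) D (sh.map encPair) (fun k => (sh.map fun p => encStr p.1).getD k [])
    (fun k => (sh.map fun p => encStr p.2).getD k []) (by simpa using hc)
    (by simp only [List.mem_map]; rintro l ⟨p, _, rfl⟩; simp [encPair]) rfl rfl rfl rfl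
    (fun k hk => ⟨[], encStr (sh[k]'(by simpa using hk)).2, ?_, rfl, ?_⟩)
    (fun k hk => ⟨encStr (sh[k]'(by simpa using hk)).1, [], ?_, ?_, ?_⟩)
  · rwa [List.length_map] at this
  all_goals
    have hk' : k < sh.length := by simpa using hk
    simp [encPair, hk']

theorem party₂_output {l₁ l₂ : ℕ} (κ κ₁ κ₂ : ℕ) (D : Dataset l₂) (sh : Shares l₁ l₂)
    (hc : sh.length ≤ D.size) :
    (partyCmd true).toPPT.output (params κ κ₁ κ₂ l₁ l₂ ++ encDataset D ++ encList encPair sh) =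
      partyLaw κ₁ l₂ D.size sh.length (encDataset D)
        (fun k => (sh.map fun p => encStr p.2).getD k [])
        (fun k => (sh.map fun p => encStr p.1).getD k []) := by
  have := partyCmd_output (second := true) (κ := κ) (κ₁ := κ₁) (κ₂ := κ₂) (x₃ := l₁) (x₄ := l₂)
    (ls := l₁) (ko := l₁) (so := 0) D (sh.map encPair) (fun k => (sh.map fun p => encStr p.2).getD k [])
    (fun k => (sh.map fun p => encStr p.1).getD k []) (by simpa using hc)
    (by simp only [List.mem_map]; rintro l ⟨p, _, rfl⟩; simp [encPair, add_comm]) rfl rfl rfl rfl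
    (fun k hk => ⟨encStr (sh[k]'(by simpa using hk)).1, [], ?_, ?_, ?_⟩)
    (fun k hk => ⟨[], encStr (sh[k]'(by simpa using hk)).2, ?_, rfl, ?_⟩)
  · rwa [List.length_map] at this
  all_goals
    have hk' : k < sh.length := by simpa using hk
    simp [encPair, hk']

/-! ## The simulator for the server

Registers: `1` length of the hash values; `2`, `3` lengths of the attributes; `4` number of common
identifiers; `5`, `6` sizes of the datasets. -/

/-- Read the input of the simulator for the server. -/
def serverSetup : Cmd :=
  .seq (.set 1 (.get 0 (.lit 2))) (.seq (.set 2 (.get 0 (.lit 3))) (.seq (.set 3 (.get 0 (.lit 4)))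
    (.seq (.set 4 (.get 0 (.lit 5))) (.seq (.set 5 (.get 0 (.lit 6))) (.set 6 (.get 0 (.lit 7)))))))

/-- Emit and store uniform strings. -/
def freshHashes : Cmd :=
  .seq (.set 10 (.lit 0)) (.rep 7 (.reg 5) (.seq (.put 4 (.reg 7) (.reg 10))
    (.rep 8 (.reg 1) (.seq (.rand 9 (.lit 2)) (.seq (.emit (.reg 9)) (.seq (.put 3 (.reg 10) (.reg 9))
      (.set 10 (.add (.reg 10) (.lit 1)))))))))

/-- Array 3 stores the emitted bits consecutively; array 4 records where each string begins, which
replaces the multiplication `i * k` at later lookups. -/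
theorem freshHashes_spec {B n k : ℕ} {s : Mem} (h1 : s.reg 1 = k) (h5 : s.reg 5 = n) (hB : n ≤ B)
    (hB' : k ≤ B) :
    Spec B freshHashes s (seqLaw n fun _ => bitsLaw k) fun a s' => s'.out = s.out ++ a ∧
      (∀ t < n * k, s'.arr 3 t = a.getD t 0) ∧ ∀ i < n, s'.arr 4 i = i * k := by
  refine Spec.set_seq ?_
  simp only [Ex.eval]
  refine (Spec.rep (n := n) (x₀ := []) (D := fun i => seqLaw i fun _ => bitsLaw k)
    (fun _ a => (bitsLaw k).map (a ++ ·)) (I := fun i a s' => s'.reg 10 = i * k ∧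
      s'.out = s.out ++ a ∧ a.length = i * k ∧
      (∀ t < i * k, s'.arr 3 t = a.getD t 0) ∧ ∀ j < i, s'.arr 4 j = j * k) ?_ hB rfl
      (fun _ _ => rfl) ?_ fun i hi a s' hf ⟨h10, ho, hl, h3, h4⟩ => ?_).weaken
      fun a _ s' _ h => ⟨h.2.1, h.2.2.2⟩
  · simp [Ex.eval, Mem.set, h5]
  · simp
  · refine Spec.put_seq (Spec.map ?_)
    have r1 : s'.reg 1 = k := by rw [hf.reg 1 (by decide), Mem.set_reg_ne _ _ (by decide), h1]
    simp only [Ex.eval, Mem.set_reg_self, Mem.set_reg_ne _ _ (show 10 ≠ 7 by decide), h10]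
    refine (Spec.rep (n := k) (x₀ := [])
      (D := fun i => seqLaw i fun _ => (randBelow 2).map fun v => [v])
      (fun _ a => ((randBelow 2).map fun v => [v]).map (a ++ ·)) (I := fun u b s'' =>
        s''.reg 10 = i * k + u ∧ s''.out = s.out ++ (a ++ b) ∧ b.length = u ∧
        (∀ t < i * k + u, s''.arr 3 t = (a ++ b).getD t 0)) ?_ hB' rfl
      (fun _ _ => rfl) ?_ fun u hu b s₂ hf₂ ⟨g10, go, gl, g3⟩ => ?_).weaken
      fun b _ s'' hf₂ ⟨g10, go, gl, g3⟩ => ⟨?_, go, ?_, ?_, ?_⟩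
    · simp [Ex.eval, Mem.set, r1]
    · refine ⟨?_, by simpa using ho, rfl, fun t ht => ?_⟩
      · rw [Mem.put_reg, Mem.set_reg_ne _ _ (by decide), h10]; rfl
      · rw [Mem.put_arr, if_neg (by decide)]
        simpa using h3 t ht
    · rw [PMF.map_comp]
      refine Spec.map ?_
      have h := Spec.rand B 9 (.lit 2) (s₂.set 8 u)
      simp only [Ex.eval] at h
      have h2 := h.seq (R := .seq (.emit (.reg 9)) (.seq (.put 3 (.reg 10) (.reg 9))
        (.set 10 (.add (.reg 10) (.lit 1))))) (d' := PMF.pure) (Q' := fun v s'' =>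
        s''.reg 10 = i * k + (u + 1) ∧ s''.out = s.out ++ (a ++ (b ++ [v])) ∧
        (b ++ [v]).length = u + 1 ∧
        (∀ t < i * k + (u + 1), s''.arr 3 t = (a ++ (b ++ [v])).getD t 0))
        fun v _ s₃ _ h₃ => ?_
      · rw [PMF.bind_pure] at h2
        exact h2
      · subst h₃
        refine Spec.emit_seq (Spec.put_seq (Spec.set ⟨?_, ?_, ?_, ?_⟩))
        · simp [Ex.eval, Mem.set, g10, add_assoc]
        · simp [Ex.eval, go]
        · simp [gl]
        · intro t ht
          simp only [Mem.set_arr, Mem.put_arr, if_true, Mem.emit_reg, Mem.emit_arr, Ex.eval,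
            Mem.set_reg_self, Function.update_apply, Mem.set_reg_ne _ _ (show 10 ≠ 9 by decide),
            Mem.set_reg_ne _ _ (show 10 ≠ 8 by decide), g10]
          rw [← List.append_assoc]
          by_cases htu : t = i * k + u
          · rw [if_pos htu, htu, List.getD_append_right _ _ _ _ (by simp [hl, gl])]
            simp [hl, gl]
          · rw [if_neg htu, List.getD_append _ _ _ _ (by simp [hl, gl]; omega), g3 t (by omega)]
    · rw [g10]; ring
    · rw [List.length_append, hl, gl]; ring
    · intro t ht
      exact g3 t (by rwa [add_mul, one_mul] at ht)
    · intro j hj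
      rw [hf₂.arr 4 (by decide), Mem.put_arr, if_pos rfl, Function.update_apply]
      split_ifs with hji
      · rw [hji]
      · exact h4 j (by omega)

/-- Emit strings that are copies of stored ones or uniform. -/
def matchedHashes : Cmd :=
  .rep 7 (.reg 6) (.seq (.set 11 (.get 2 (.reg 7))) (.ite (.sub (.reg 4) (.reg 11))
    (.seq (.set 12 (.get 4 (.get 1 (.reg 11))))
      (.rep 8 (.reg 1) (.emit (.get 3 (.add (.reg 12) (.reg 8))))))
    (emitBits 8 9 (.reg 1))))

/-- The `i`-th string of length `k` of a concatenation. -/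
def chunk (k : ℕ) (a : List ℕ) (i : ℕ) : List ℕ := (List.range k).map fun t => a.getD (i * k + t) 0

/-- `σ₂` selects the matched positions, those with value below `c`, and `σ₁` their partners in the
first vector; for uniform permutations this is a random partial matching of size `c`. The truncated
difference of `c` and the value decides between copying and drawing. -/
theorem matchedHashes_spec {B n m c k : ℕ} {s : Mem} {a σ₁ σ₂ : List ℕ} (h1 : s.reg 1 = k)
    (h4 : s.reg 4 = c) (h6 : s.reg 6 = m) (hB : m ≤ B) (hB' : k ≤ B) (hc : c ≤ n)
    (a3 : ∀ t < n * k, s.arr 3 t = a.getD t 0) (a4 : ∀ i < n, s.arr 4 i = i * k)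
    (a1 : ∀ i < n, s.arr 1 i = σ₁.getD i 0) (a2 : ∀ i < m, s.arr 2 i = σ₂.getD i 0)
    (hσ : ∀ i < n, σ₁.getD i 0 < n) :
    Spec B matchedHashes s (seqLaw m fun j => fixedOr k
      (if σ₂.getD j 0 < c then some (chunk k a (σ₁.getD (σ₂.getD j 0) 0)) else none))
      fun b s' => s'.out = s.out ++ b := by
  refine Spec.rep_emit h6 hB fun j hj s' hf => Spec.set_seq ?_
  have e : (Ex.get 2 (.reg 7)).eval (s'.set 7 j) = σ₂.getD j 0 := by
    simp only [Ex.eval, Mem.set_reg_self, Mem.set_arr]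
    rw [hf.arr 2 (by decide), a2 j hj]
  rw [e]
  have r1 : s'.reg 1 = k := by rw [hf.reg 1 (by decide), h1]
  have r4 : s'.reg 4 = c := by rw [hf.reg 4 (by decide), h4]
  generalize σ₂.getD j 0 = v
  refine Spec.ite (fun h => ?_) (fun h => ?_) <;>
    simp only [Ex.eval, Mem.set_reg_self, Mem.set_reg_ne _ _ (show 4 ≠ 11 by decide),
      Mem.set_reg_ne _ _ (show 4 ≠ 7 by decide), r4] at h
  · rw [if_neg (by omega)]
    exact (emitBits_spec (n := k) (by simp [Ex.eval, Mem.set, r1]) hB').weaken fun _ _ _ _ h => h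
  · rw [if_pos (by omega)]
    refine Spec.set_seq ?_
    have hv := hσ v (by omega)
    have e2 : (Ex.get 4 (.get 1 (.reg 11))).eval ((s'.set 7 j).set 11 v) = σ₁.getD v 0 * k := by
      simp only [Ex.eval, Mem.set_reg_self, Mem.set_arr]
      rw [hf.arr 1 (by decide), a1 v (by omega), hf.arr 4 (by decide), a4 _ hv]
    rw [e2]
    have := Spec.rep_emit (B := B) (a := 8) (e := .reg 1)
      (P := .emit (.get 3 (.add (.reg 12) (.reg 8))))
      (s := ((s'.set 7 j).set 11 v).set 12 (σ₁.getD v 0 * k)) (n := k)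
      (μ := fun t => PMF.pure [a.getD (σ₁.getD v 0 * k + t) 0])
      (by simp [Ex.eval, Mem.set, r1]) hB' fun t ht s'' hf' => Spec.emit ?_
    · rwa [seqLaw_pure, ← List.map_eq_flatMap] at this
    · have e12 : s''.reg 12 = σ₁.getD v 0 * k := by rw [hf'.reg 12 (by decide), Mem.set_reg_self]
      simp only [Ex.eval, Mem.set_reg_self, Mem.set_reg_ne _ _ (show 12 ≠ 8 by decide), e12,
        Mem.emit_out, Mem.set_out, Mem.set_arr]
      rw [hf'.arr 3 (by decide)]
      simp only [Mem.set_arr]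
      rw [hf.arr 3 (by decide), a3]
      -- The index is in range: `σ₁ v < n` and `t < k` give `σ₁ v * k + t < n * k`.
      nlinarith

/-- Emit a uniform permutation of `[N]` and uniform messages of the sender, where register `r` holds
`N` and register `r'` the length of the entries. -/
def emitSwitching (r r' : ℕ) : Cmd :=
  .seq (shuffle 1 7 9 (.reg r)) (.seq (.emit (.reg r)) (.seq (emitArr 1 7 (.reg r))
    (.seq (.emit (.reg r)) (.seq (.rep 7 (.reg r) (emitBits 8 9 (.reg r')))
    (.seq (tables 10 7 13 14 (.reg r)) (.seq (.emit (.get 11 (.reg r)))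
      (.rep 7 (.add (.get 11 (.reg r)) (.get 11 (.reg r))) (emitBits 8 9 (.reg r')))))))))

/-- The law of the view of the receiver in a switching network. -/
noncomputable def switchingLaw (N l : ℕ) : PMF (List ℕ) :=
  (permLaw N).bind fun ρ => (seqLaw N fun _ => bitsLaw l).bind fun x =>
    (seqLaw (gateCount N + gateCount N) fun _ => bitsLaw l).map fun y =>
      N :: ρ ++ N :: x ++ gateCount N :: y

/-- No labels are simulated: the received messages are uniform, so they are drawn directly. A flat
list of twice as many strings has the same entries as the list of pairs, and only the number of
pairs is announced before it. -/
theorem emitSwitching_spec {B r r' N l : ℕ} {s : Mem} (hr : r < 7) (hr' : r' < 7) (h : s.reg r = N)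
    (h' : s.reg r' = l) (hB : N + 1 ≤ B) (hB' : l ≤ B) (hg : gateCount N + gateCount N ≤ B) :
    Spec B (emitSwitching r r') s (switchingLaw N l) fun a s' => s'.out = s.out ++ a := by
  have regs : ∀ P s s', Frame P s s' → (∀ q ∈ P.regs, 7 ≤ q) → s.reg r = N ∧ s.reg r' = l →
      s'.reg r = N ∧ s'.reg r' = l := fun P s s' hf hP hs =>
    ⟨by rw [hf.reg r fun hh => by have := hP r hh; omega, hs.1],
      by rw [hf.reg r' fun hh => by have := hP r' hh; omega, hs.2]⟩
  unfold emitSwitching switchingLaw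
  refine Spec.seq (shuffle_spec (n := N) (by decide) h (by omega)) fun ρ hρ s₁ f₁ hρ₁ => ?_
  obtain ⟨ρ, rfl⟩ := mem_support_permLaw hρ
  have c₁ := regs _ _ _ f₁ (by simp [Cmd.regs, shuffle]) ⟨h, h'⟩
  have o₁ := f₁.out rfl
  refine Spec.emit_seq ?_
  simp only [Ex.eval, c₁.1]
  refine Spec.seq_unit (Spec.unit_of_emit (emitArr_spec (n := N) c₁.1 (by omega)))
    fun s₂ f₂ o₂ => ?_
  rw [Mem.emit_arr, range_map_eq_take (permList_length ρ) le_rfl hρ₁,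
    List.take_of_length_le (permList_length ρ).le] at o₂
  have c₂ := regs _ _ _ f₂ (by simp [Cmd.regs, emitArr]) c₁
  refine Spec.emit_seq ?_
  simp only [Ex.eval, c₂.1]
  refine Spec.seq (Spec.rep_emit (n := N) (μ := fun _ => bitsLaw l) c₂.1 (by omega)
    fun i hi s' hf => (emitBits_spec (n := l) ?_ hB').weaken fun _ _ _ _ h => h)
    fun x _ s₃ f₃ o₃ => ?_
  · have c' := regs _ _ _ hf (by simp [Cmd.regs, emitBits]) c₂
    rw [Ex.eval, Mem.set_reg_ne _ _ (by omega), c'.2]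
  have c₃ := regs _ _ _ f₃ (by simp [Cmd.regs, emitBits]) c₂
  refine Spec.seq_unit (tables_spec (n := N) (by decide) (by decide) (by decide)
    (fun u v => by
      simp only [Ex.eval]
      rw [Mem.set_reg_ne _ _ (by omega), Mem.set_reg_ne _ _ (by omega), c₃.1]) hB)
    fun s₄ f₄ h₄ => ?_
  have c₄ := regs _ _ _ f₄ (by simp [Cmd.regs, tables, tablesStep]) c₃
  have o₄ := f₄.out rfl
  have g₄ := (h₄ N le_rfl).2.1
  refine Spec.emit_seq ?_
  simp only [Ex.eval, c₄.1]
  have h₅ := Spec.rep_emit (B := B) (a := 7) (e := .add (.get 11 (.reg r)) (.get 11 (.reg r)))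
    (P := emitBits 8 9 (.reg r')) (s := s₄.emit (s₄.arr 11 N)) (n := gateCount N + gateCount N)
    (μ := fun _ => bitsLaw l) (by simp [Ex.eval, c₄.1, g₄]) hg
    fun i hi s' hf => (emitBits_spec (n := l) ?_ hB').weaken fun _ _ _ _ h => h
  · refine Spec.map (h₅.weaken fun y _ s₅ _ o₅ => ?_)
    rw [o₅]
    simp only [Mem.emit_out, o₄, o₃, o₂, o₁, g₄]
    simp
  · have c' := regs _ _ _ hf (by simp [Cmd.regs, emitBits]) c₄
    rw [Ex.eval, Mem.set_reg_ne _ _ (by omega), c'.2]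

/-- The simulator for the server. -/
def serverCmd : Cmd :=
  .seq serverSetup (.seq (shuffle 1 7 9 (.reg 5)) (.seq (shuffle 2 7 9 (.reg 6))
    (.seq (.emit (.reg 5)) (.seq freshHashes (.seq (.emit (.reg 6)) (.seq matchedHashes
    (.seq (shuffle 1 7 9 (.reg 4)) (.seq (.emit (.reg 4)) (.seq (emitArr 1 7 (.reg 4))
    (.seq (emitSwitching 5 2) (emitSwitching 6 3)))))))))))

/-- The law of the output of the simulator for the server. -/
noncomputable def serverLaw (κ₂ l₁ l₂ c n m : ℕ) : PMF (List ℕ) :=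
  (permLaw n).bind fun σ₁ => (permLaw m).bind fun σ₂ =>
    (seqLaw n fun _ => bitsLaw κ₂).bind fun a =>
    (seqLaw m fun j => fixedOr κ₂ (if σ₂.getD j 0 < c then
      some (chunk κ₂ a (σ₁.getD (σ₂.getD j 0) 0)) else none)).bind fun b =>
    (permLaw c).bind fun τ => (switchingLaw n l₁).bind fun o₁ => (switchingLaw m l₂).map fun o₂ =>
      n :: a ++ m :: b ++ c :: τ ++ o₁ ++ o₂

set_option maxHeartbeats 1000000 in
-- The condition `c ≤ n` makes the lookups in the first permutation valid for all matched values.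
theorem serverCmd_output {κ κ₁ κ₂ l₁ l₂ c n m : ℕ} (hc : c ≤ n) :
    serverCmd.toPPT.output (params κ κ₁ κ₂ l₁ l₂ ++ [c, n, m]) = serverLaw κ₂ l₁ l₂ c n m := by
  set w := params κ κ₁ κ₂ l₁ l₂ ++ [c, n, m] with hw
  have hS : inputSize w = κ + κ₁ + κ₂ + l₁ + l₂ + c + n + m + 8 := by
    simp [inputSize, hw, params]; omega
  have hSB : inputSize w ≤ inputSize w ^ 2 := Nat.le_self_pow (by decide) _
  have hgn := two_mul_gateCount_le n
  have hgm := two_mul_gateCount_le m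
  have hgn' : n * n ≤ inputSize w ^ 2 := by
    rw [sq]; exact Nat.mul_le_mul (by omega) (by omega)
  have hgm' : m * m ≤ inputSize w ^ 2 := by
    rw [sq]; exact Nat.mul_le_mul (by omega) (by omega)
  rw [Cmd.toPPT_output]
  generalize inputSize w ^ 2 = B at *
  have regs : ∀ P s s', Frame P s s' → (∀ q ∈ P.regs, 7 ≤ q) → (s.reg 1 = κ₂ ∧ s.reg 2 = l₁ ∧
      s.reg 3 = l₂ ∧ s.reg 4 = c ∧ s.reg 5 = n ∧ s.reg 6 = m) → (s'.reg 1 = κ₂ ∧ s'.reg 2 = l₁ ∧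
      s'.reg 3 = l₂ ∧ s'.reg 4 = c ∧ s'.reg 5 = n ∧ s'.reg 6 = m) := by
    intro P s s' hf hP hs
    have : ∀ q < 7, s'.reg q = s.reg q := fun q hq => hf.reg q fun h => by
      have := hP q h; omega
    rw [this 1 (by omega), this 2 (by omega), this 3 (by omega), this 4 (by omega),
      this 5 (by omega), this 6 (by omega)]
    exact hs
  have main : Spec B serverCmd (Mem.init w) (serverLaw κ₂ l₁ l₂ c n m) fun a s' => s'.out = a := by
    unfold serverCmd serverLaw
    refine Spec.seq_unit (Q' := fun _ s => s.reg 1 = κ₂ ∧ s.reg 2 = l₁ ∧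
      s.reg 3 = l₂ ∧ s.reg 4 = c ∧ s.reg 5 = n ∧ s.reg 6 = m) ?_ fun s₁ f₁ c₁ => ?_
    · refine Spec.set_seq (Spec.set_seq (Spec.set_seq (Spec.set_seq (Spec.set_seq (Spec.set ?_)))))
      simp [Ex.eval, Mem.set, Mem.init, hw, params]
    have o₁ : s₁.out = [] := f₁.out (by decide)
    refine Spec.seq (shuffle_spec (n := n) (by decide) c₁.2.2.2.2.1 (by omega))
      fun σ₁ hσ₁ s₂ f₂ a₂ => ?_
    obtain ⟨σ₁, rfl⟩ := mem_support_permLaw hσ₁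
    have c₂ := regs _ _ _ f₂ (by decide) c₁
    have o₂ := f₂.out (by decide)
    refine Spec.seq (shuffle_spec (n := m) (by decide) c₂.2.2.2.2.2 (by omega))
      fun σ₂ hσ₂ s₃ f₃ a₃ => ?_
    have c₃ := regs _ _ _ f₃ (by decide) c₂
    have o₃ := f₃.out (by decide)
    refine Spec.emit_seq ?_
    simp only [Ex.eval, c₃.2.2.2.2.1]
    refine Spec.seq (freshHashes_spec (n := n) (k := κ₂) c₃.1 c₃.2.2.2.2.1 (by omega) (by omega))
      fun a ha s₄ f₄ ⟨o₄, a₄, p₄⟩ => ?_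
    have c₄ := regs _ _ _ f₄ (by decide) c₃
    refine Spec.emit_seq ?_
    simp only [Ex.eval, c₄.2.2.2.2.2]
    refine Spec.seq (matchedHashes_spec (n := n) (m := m) (k := κ₂) (c := c) (a := a)
      (σ₁ := permList σ₁) (σ₂ := σ₂)
      c₄.1 c₄.2.2.2.1 c₄.2.2.2.2.2 (by omega) (by omega) hc a₄ p₄ (fun i hi => ?_) (fun i hi => ?_)
      (fun i hi => by rw [permList_getD σ₁ hi]; exact (σ₁ _).2)) fun b _ s₅ f₅ o₅ => ?_
    · rw [Mem.emit_arr, f₄.arr 1 (by decide), Mem.emit_arr, f₃.arr 1 (by decide), a₂ i hi]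
    · rw [Mem.emit_arr, f₄.arr 2 (by decide), Mem.emit_arr, a₃ i hi]
    have c₅ := regs _ _ _ f₅ (by decide) c₄
    refine Spec.seq (shuffle_spec (n := c) (by decide) c₅.2.2.2.1 (by omega))
      fun τ hτ s₆ f₆ a₆ => ?_
    obtain ⟨τ, rfl⟩ := mem_support_permLaw hτ
    have c₆ := regs _ _ _ f₆ (by decide) c₅
    have o₆ := f₆.out (by decide)
    refine Spec.emit_seq ?_
    simp only [Ex.eval, c₆.2.2.2.1]
    refine Spec.seq_unit (Spec.unit_of_emit (emitArr_spec (n := c) c₆.2.2.2.1 (by omega)))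
      fun s₇ f₇ o₇ => ?_
    rw [Mem.emit_arr, range_map_eq_take (permList_length τ) le_rfl a₆,
      List.take_of_length_le (permList_length τ).le] at o₇
    have c₇ := regs _ _ _ f₇ (by decide) c₆
    refine Spec.seq (emitSwitching_spec (N := n) (l := l₁) (by decide) (by decide) c₇.2.2.2.2.1 c₇.2.1 (by omega)
      (by omega) (by omega)) fun x _ s₈ f₈ o₈ => ?_
    have c₈ := regs _ _ _ f₈ (by decide) c₇
    refine Spec.map ((emitSwitching_spec (N := m) (l := l₂) (by decide) (by decide) c₈.2.2.2.2.2 c₈.2.2.1 (by omega)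
      (by omega) (by omega)).weaken fun y _ s₉ _ o₉ => ?_)
    rw [o₉, o₈, o₇]
    simp only [Mem.emit_out, o₆, o₅, o₄, o₃, o₂, o₁]
    simp
  have := main.output (f := id) fun a _ s' _ h => h
  rw [this, PMF.map_id]

/-! ### Exact equality of real and simulated views of a data owner when no hash values collide. -/

/-! ## Uniform functions and permutations -/

section Uniform

variable {α β γ : Type}

theorem unif_pi_append_bind {A : Type} [Fintype A] [Nonempty A] (m n : ℕ)
    (f : (Fin (m + n) → A) → PMF γ) :
    (unif (Fin (m + n) → A)).bind f =
      (unif (Fin m → A)).bind fun a => (unif (Fin n → A)).bind fun b => f (Fin.append a b) := by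
  rw [unif_bind_equiv (Fin.appendEquiv m n), unif_prod_bind]
  rfl

theorem unif_pi_prod_bind {ι A B : Type} [Fintype ι] [DecidableEq ι] [Fintype A] [Nonempty A]
    [Fintype B] [Nonempty B] (f : (ι → A × B) → PMF γ) :
    (unif (ι → A × B)).bind f =
      (unif (ι → A)).bind fun a => (unif (ι → B)).bind fun b => f fun i => (a i, b i) := by
  rw [unif_bind_equiv (Equiv.arrowProdEquivProdArrow ι (fun _ => A) (fun _ => B)).symm,
    unif_prod_bind]
  rfl

/-- Overwriting a uniform function at given places with uniform values. -/
theorem unif_bind_extend {ι κ A : Type} [Fintype ι] [DecidableEq ι] [Fintype κ] [DecidableEq κ]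
    [Fintype A] [Nonempty A] {q : κ → ι} (hq : Function.Injective q)
    (f : (ι → A) → (κ → A) → PMF γ) :
    ((unif (κ → A)).bind fun s => (unif (ι → A)).bind fun y => f (Function.extend q s y) s) =
      (unif (ι → A)).bind fun y => f y (y ∘ q) := by
  -- Exchanging the values of `y` along `q` with `s` is an involution, so overwriting is a change of
  -- variables; the discarded old values then integrate out.
  have hinv : Function.Involutive fun p : (κ → A) × (ι → A) =>
      (p.2 ∘ q, Function.extend q p.1 p.2) := by
    rintro ⟨s, y⟩
    refine Prod.ext (funext fun k => hq.extend_apply _ _ k) (funext fun i => ?_)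
    by_cases h : ∃ k, q k = i
    · obtain ⟨k, rfl⟩ := h
      simp [hq.extend_apply]
    · simp [Function.extend_apply' _ _ _ h]
  have h := unif_bind_equiv hinv.toPerm fun p => f (Function.extend q p.1 p.2) p.1
  rw [unif_prod_bind, unif_prod_bind] at h
  rw [h]
  have e : ∀ (s : κ → A) (y : ι → A), Function.extend q (y ∘ q) (Function.extend q s y) = y :=
    fun s y => congrArg Prod.snd (hinv (s, y))
  simp only [Function.Involutive.coe_toPerm, e, PMF.bind_const]

/-- Let the permutation `e` extend `a` along the inclusion; the substitution `ρ ↦ ρ⁻¹ * e` turns one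
side into the other. Both are the law of a uniform injection, so the map sent to the sender hides
the target. -/
theorem unif_perm_symm_bind {c n : ℕ} (hc : c ≤ n) {a : Fin c → Fin n} (ha : Function.Injective a)
    (f : (Fin c → Fin n) → PMF γ) :
    ((unif (Equiv.Perm (Fin n))).bind fun ρ => f fun k => ρ.symm (a k)) =
      (unif (Equiv.Perm (Fin n))).bind fun ρ => f fun k => ρ (Fin.castLE hc k) := by
  obtain ⟨e, he⟩ := Equiv.Perm.exists_extending_pair (Fin.castLE hc) a
    (Fin.castLE_injective hc) ha
  rw [unif_bind_equiv ((Equiv.inv (Equiv.Perm (Fin n))).trans (Equiv.mulRight e))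
    fun ρ => f fun k => ρ (Fin.castLE hc k)]
  simp [he, Equiv.Perm.inv_def]

/-- The fibres of `f` and `g` have equal cardinalities, namely multiplicities in the lists;
bijections between fibres glue together. -/
theorem exists_perm_of_perm_ofFn [DecidableEq α] {c : ℕ} {f g : Fin c → α}
    (h : (List.ofFn f).Perm (List.ofFn g)) : ∃ σ : Equiv.Perm (Fin c), ∀ i, g (σ i) = f i := by
  have key : ∀ (f : Fin c → α) (a : α), Fintype.card {i // f i = a} = (List.ofFn f).count a := by
    intro f a
    rw [List.ofFn_eq_map, List.count, List.countP_map, Fintype.card_subtype]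
    rw [← List.toFinset_finRange c, Finset.card_def]
    rw [List.countP_eq_length_filter, ← List.toFinset_card_of_nodup
      ((List.nodup_finRange c).filter _), Finset.card_def, List.toFinset_filter]
    simp
  have e : ∀ a, Nonempty ({i // f i = a} ≃ {i // g i = a}) := fun a =>
    Fintype.card_eq.1 (by rw [key, key, h.count_eq])
  exact ⟨Equiv.ofFiberEquiv fun a => (e a).some, fun i => Equiv.ofFiberEquiv_map _ i⟩

/-- A uniform shuffle of a family does not depend on the order of the family. -/
theorem unif_perm_bind_of_perm [DecidableEq α] {c : ℕ} {f g : Fin c → α}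
    (h : (List.ofFn f).Perm (List.ofFn g)) (F : (Fin c → α) → PMF γ) :
    ((unif (Equiv.Perm (Fin c))).bind fun τ => F fun i => f (τ i)) =
      (unif (Equiv.Perm (Fin c))).bind fun τ => F fun i => g (τ i) := by
  obtain ⟨σ, hσ⟩ := exists_perm_of_perm_ofFn h
  rw [unif_bind_equiv (Equiv.mulLeft σ) fun τ => F fun i => g (τ i)]
  simp [hσ]

end Uniform

/-! ## Uniform wire labels -/

/-- The wire labels listed by a function. -/
def labelsOf {n l : ℕ} (y : Fin (n + (gateCount n + gateCount n)) → Str l) : Wires n l :=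
  wiresOf fun i => if h : i < n + (gateCount n + gateCount n) then y ⟨i, h⟩ else fun _ => false

theorem labelsOf_bijective (n l : ℕ) : Function.Bijective (labelsOf (n := n) (l := l)) := by
  have hg := numGates_eq n
  refine ⟨fun y y' h => funext fun i => ?_, fun W => ⟨fun i => flatLabels W i, ?_⟩⟩
  · have h1 := congrArg Prod.fst h
    have h2 := congrArg Prod.snd h
    by_cases hi : (i : ℕ) < n
    · have := congrFun h1 ⟨i, hi⟩
      simpa [labelsOf, wiresOf] using this
    · have hk : (i - n : ℕ) / 2 < numGates n := by omega
      have := congrFun h2 ⟨_, hk⟩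
      simp only [labelsOf, wiresOf, Prod.mk.injEq] at this
      rcases Nat.mod_two_eq_zero_or_one (i - n) with h0 | h0
      · have := this.1
        have e : n + 2 * ((i - n) / 2) = i := by omega
        simpa only [e, i.2, dif_pos] using this
      · have := this.2
        have e : n + 2 * ((i - n) / 2) + 1 = i := by omega
        simpa only [e, i.2, dif_pos] using this
  · conv_rhs => rw [← wiresOf_flatLabels W]
    refine Prod.ext (funext fun i => ?_) (funext fun k => Prod.ext ?_ ?_)
    · have := i.2
      simp only [labelsOf, wiresOf]
      rw [dif_pos (by omega)]
    · have := k.2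
      simp only [labelsOf, wiresOf]
      rw [dif_pos (by omega)]
    · have := k.2
      simp only [labelsOf, wiresOf]
      rw [dif_pos (by omega)]

theorem unif_wires_bind {n l : ℕ} {γ : Type} (f : Wires n l → PMF γ) :
    (unif (Wires n l)).bind f =
      (unif (Fin (n + (gateCount n + gateCount n)) → Str l)).bind fun y => f (labelsOf y) :=
  unif_bind_equiv (Equiv.ofBijective _ (labelsOf_bijective n l)) f

theorem labelIdx_lt' {n : ℕ} (j : Fin n) : labelIdx n j < n + (gateCount n + gateCount n) := by
  have := labelIdx_lt j.2; omega

theorem outLabels_labelsOf {n l : ℕ} (y : Fin (n + (gateCount n + gateCount n)) → Str l)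
    (j : Fin n) : outLabels (labelsOf y) j = y ⟨labelIdx n j, labelIdx_lt' j⟩ := by
  rw [labelsOf, outLabels_wiresOf, dif_pos (labelIdx_lt' j)]

theorem flatten_ofFn_pairs {A : Type} (F : ℕ → List A) (g : ℕ) :
    (List.ofFn fun k : Fin g => F (2 * k) ++ F (2 * k + 1)).flatten =
      ((List.range (g + g)).map F).flatten := by
  rw [List.ofFn_eq_map]
  have : (List.finRange g).map (fun k : Fin g => F (2 * (k : ℕ)) ++ F (2 * (k : ℕ) + 1)) =
      (List.range g).map fun k => F (2 * k) ++ F (2 * k + 1) := by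
    rw [← List.map_coe_finRange_eq_range, List.map_map]; rfl
  rw [this]
  clear this
  induction g with
  | zero => rfl
  | succ g ih =>
    rw [show g + 1 + (g + 1) = g + g + 1 + 1 by ring, List.range_succ, List.range_succ,
      List.range_succ, List.map_append, List.map_append, List.map_append, List.flatten_append,
      List.flatten_append, List.flatten_append, ih]
    simp [two_mul]

theorem encWires_labelsOf_append {n l : ℕ} (a : Fin n → Str l)
    (b : Fin (gateCount n + gateCount n) → Str l) :
    encWires (labelsOf (Fin.append a b)) =
      n :: (List.ofFn fun i => encStr (a i)).flatten ++
        gateCount n :: (List.ofFn fun i => encStr (b i)).flatten := by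
  set y : ℕ → Str l := fun i => if h : i < gateCount n + gateCount n then b ⟨i, h⟩ else fun _ => false
    with hy
  have e1 : (labelsOf (Fin.append a b)).1 = a := by
    funext i
    have := i.2
    simp only [labelsOf, wiresOf]
    rw [dif_pos (by omega)]
    exact Fin.append_left a b i
  have e2 : ∀ k, (labelsOf (Fin.append a b)).2 k = (y (2 * k), y (2 * k + 1)) := by
    intro k
    have := k.2
    have hg := numGates_eq n
    have e : ∀ t (ht : t < gateCount n + gateCount n) (h : n + t < n + (gateCount n + gateCount n)),
        Fin.append a b ⟨n + t, h⟩ = y t := fun t ht h => by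
      rw [hy]
      simp only [ht, dif_pos]
      exact Fin.append_right a b ⟨t, ht⟩
    simp only [labelsOf, wiresOf]
    rw [dif_pos (by omega), dif_pos (by omega), e _ (by omega)]
    simp only [add_assoc]
    rw [e _ (by omega)]
  rw [encWires, encVec, encVec, encList, encList, e1]
  congr 1
  · simp [List.flatMap_def, List.map_ofFn, Function.comp_def]
  · rw [List.length_ofFn]
    congr 1
    · exact numGates_eq n
    have e3 : (labelsOf (Fin.append a b)).2 = fun k : Fin (numGates n) => (y (2 * k), y (2 * k + 1)) := funext e2
    rw [e3, List.flatMap_def, List.map_ofFn]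
    have := flatten_ofFn_pairs (fun i => encStr (y i)) (numGates n)
    simp only [Function.comp_def, encPair]
    rw [this, numGates_eq, ← List.map_coe_finRange_eq_range, List.map_map, List.ofFn_eq_map]
    congr 1
    refine List.map_congr_left fun i _ => ?_
    simp [hy]

/-- Uniform wire labels that agree with the shares of a data owner. -/
theorem prescribed_wires_bind {n l c : ℕ} {γ : Type} (hc : c ≤ n) (ρ : Equiv.Perm (Fin n))
    (kept : (Fin c → Str l) → ℕ → List ℕ) (hk : ∀ s (k : Fin c), kept s k = encStr (s k))
    (F : List ℕ → (Fin c → Str l) → PMF γ) :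
    ((unif (Fin c → Str l)).bind fun s =>
      (seqLaw n fun i => fixedOr l (prescribed n c (permList ρ) (kept s) i)).bind fun lab₁ =>
      (seqLaw (gateCount n + gateCount n) fun i =>
        fixedOr l (prescribed n c (permList ρ) (kept s) (n + i))).bind fun lab₂ =>
      F (n :: lab₁ ++ gateCount n :: lab₂) s) =
    (unif (Wires n l)).bind fun W => F (encWires W) fun k => outLabels W (ρ (Fin.castLE hc k)) := by
  classical
  set q : Fin c → Fin (n + (gateCount n + gateCount n)) := fun k =>
    ⟨labelIdx n (ρ (Fin.castLE hc k)), labelIdx_lt' _⟩ with hq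
  have q_inj : Function.Injective q := fun k k' h => by
    have h := labelIdx_injective (Fin.is_lt _) (Fin.is_lt _) (Fin.ext_iff.1 h)
    exact Fin.castLE_injective hc (ρ.injective (Fin.ext h))
  set ext : (Fin c → Str l) → ℕ → Str l → Str l := fun s i a =>
    if h : ∃ k, (q k : ℕ) = i then s h.choose else a with hext
  -- Since `q` is injective, the search in `prescribed` returns the only share placed at `i`; a
  -- planted label is the image of a uniform string under a constant map, so both cases have the
  -- form that `unif_pi_flatten` accepts.
  have fix : ∀ s i, fixedOr l (prescribed n c (permList ρ) (kept s) i) =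
      (unif (Str l)).map fun a => encStr (ext s i a) := by
    intro s i
    have hget : ∀ k : Fin c, (permList ρ).getD k 0 = ρ (Fin.castLE hc k) := fun k =>
      permList_getD ρ (lt_of_lt_of_le k.2 hc)
    unfold prescribed
    by_cases h : ∃ k, (q k : ℕ) = i
    · have hs := h.choose_spec
      set k := h.choose with hkk
      have : (List.range c).find? (fun t => labelIdx n ((permList ρ).getD t 0) = i) = some (k : ℕ) := by
        cases hf : (List.range c).find? (fun t => labelIdx n ((permList ρ).getD t 0) = i) with
        | none =>
          rw [List.find?_eq_none] at hf
          have := hf k (List.mem_range.2 k.2)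
          rw [hget] at this
          exact absurd (decide_eq_true hs) this
        | some t =>
          have htc := List.mem_range.1 (List.mem_of_find?_eq_some hf)
          have htl := List.find?_some hf
          rw [decide_eq_true_iff, hget ⟨t, htc⟩] at htl
          have : (⟨t, htc⟩ : Fin c) = k := q_inj (Fin.ext (htl.trans hs.symm))
          rw [← this]
      rw [this]
      have e : (fun a => encStr (ext s i a)) = Function.const _ (encStr (s k)) := by
        funext a
        simp only [hext, dif_pos h, Function.const, hkk]
      rw [e, PMF.map_const, Option.map_some, hk]
      rfl
    · have : (List.range c).find? (fun t => labelIdx n ((permList ρ).getD t 0) = i) = none := by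
        rw [List.find?_eq_none]
        intro t ht
        rw [decide_eq_true_iff, hget ⟨t, List.mem_range.1 ht⟩]
        exact fun h' => h ⟨_, h'⟩
      rw [this]
      have e : (fun a => encStr (ext s i a)) = encStr := by
        funext a
        simp only [hext, dif_neg h]
      rw [e, unif_str_map]
      rfl
  have hext' : ∀ s (a : Fin n → Str l) (b : Fin (gateCount n + gateCount n) → Str l),
      Function.extend q s (Fin.append a b) =
        Fin.append (fun i => ext s i (a i)) fun i => ext s (n + i) (b i) := by
    intro s a b
    have val : ∀ i z, Function.extend q s z i = ext s i (z i) := by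
      intro i z
      by_cases h : ∃ k, (q k : ℕ) = i
      · simp only [hext, dif_pos h]
        conv_lhs => rw [show i = q h.choose from Fin.ext h.choose_spec.symm]
        exact q_inj.extend_apply _ _ _
      · simp only [hext, dif_neg h]
        exact Function.extend_apply' _ _ _ fun ⟨k, hk⟩ => h ⟨k, congrArg Fin.val hk⟩
    funext i
    rw [val]
    refine Fin.addCases (fun i => ?_) (fun i => ?_) i
    · simp
    · simp
  rw [unif_wires_bind]
  simp only [outLabels_labelsOf]
  -- Planting uniform shares in a uniform list of labels gives a uniform list, from which the shares
  -- are read off at the places `q`.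
  refine Eq.trans ?_ (unif_bind_extend q_inj fun y t => F (encWires (labelsOf y)) t)
  refine congrArg _ (funext fun s => ?_)
  simp only [fix]
  rw [← unif_pi_flatten, ← unif_pi_flatten, unif_pi_append_bind, PMF.bind_map]
  refine congrArg _ (funext fun a => ?_)
  simp only [Function.comp]
  rw [PMF.bind_map]
  refine congrArg _ (funext fun b => ?_)
  simp only [Function.comp, hext', encWires_labelsOf_append]

/-- The labels at distinct outgoing wires are uniform. -/
theorem unif_outLabels_bind {n l c : ℕ} {γ : Type} {q : Fin c → Fin n} (hq : Function.Injective q)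
    (f : (Fin c → Str l) → PMF γ) :
    ((unif (Wires n l)).bind fun W => f fun k => outLabels W (q k)) =
      (unif (Fin c → Str l)).bind f := by
  rw [unif_wires_bind]
  simp only [outLabels_labelsOf]
  have h := unif_bind_extend (A := Str l)
    (q := fun k => (⟨labelIdx n (q k), labelIdx_lt' _⟩ : Fin (n + (gateCount n + gateCount n))))
    (fun k k' h => hq (Fin.ext (labelIdx_injective (Fin.is_lt _) (Fin.is_lt _) (Fin.ext_iff.1 h))))
    fun _ s => f s
  simp only [PMF.bind_const] at h
  exact h.symm

/-! ## Matching positions -/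

section Matching

variable {n m : ℕ}

theorem get_fst_injective {L : List (Fin n × Fin m)} (h : L.Nodup)
    (h' : ∀ p ∈ L, ∀ q ∈ L, p.1 = q.1 → p.2 = q.2) :
    Function.Injective fun k : Fin L.length => (L.get k).1 := fun _ _ e =>
  List.nodup_iff_injective_get.1 h
    (Prod.ext e (h' _ (List.get_mem _ _) _ (List.get_mem _ _) e))

theorem get_snd_injective {L : List (Fin n × Fin m)} (h : L.Nodup)
    (h' : ∀ p ∈ L, ∀ q ∈ L, p.2 = q.2 → p.1 = q.1) :
    Function.Injective fun k : Fin L.length => (L.get k).2 := fun _ _ e =>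
  List.nodup_iff_injective_get.1 h
    (Prod.ext (h' _ (List.get_mem _ _) _ (List.get_mem _ _) e) e)

variable {k : ℕ} {x : Fin n → Str k} {y : Fin m → Str k}

theorem nodup_matchPairs (x : Fin n → Str k) (y : Fin m → Str k) : (matchPairs x y).Nodup := by
  refine List.Nodup.filterMap (fun j j' p hp hp' => ?_) (List.nodup_finRange m)
  have key : ∀ j, p ∈ (if ∀ j' < j, y j' ≠ y j then
      ((List.finRange n).find? fun i => decide (x i = y j)).map fun i => (i, j) else none) →
      p.2 = j := by
    intro j h
    split_ifs at h with h0
    · obtain ⟨i, _, rfl⟩ := Option.map_eq_some_iff.1 h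
      rfl
    · simp at h
  rw [← key j hp, ← key j' hp']

/-- Injectivity of `y` makes the first-occurrence test succeed always, and injectivity of `x` leaves
the search a single candidate. -/
theorem mem_matchPairs (hx : Function.Injective x) (hy : Function.Injective y)
    (p : Fin n × Fin m) : p ∈ matchPairs x y ↔ x p.1 = y p.2 := by
  unfold matchPairs
  rw [List.mem_filterMap]
  constructor
  · rintro ⟨j, _, h⟩
    split_ifs at h with h0
    obtain ⟨i, hi, rfl⟩ := Option.map_eq_some_iff.1 h
    exact of_decide_eq_true (List.find?_some (p := fun i => decide (x i = y j)) hi)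
  · intro h
    refine ⟨p.2, List.mem_finRange _, ?_⟩
    rw [if_pos fun j' hj' e => hj'.ne (hy e)]
    cases hf : (List.finRange n).find? fun i => decide (x i = y p.2) with
    | none => exact absurd (decide_eq_true h) (List.find?_eq_none.1 hf p.1 (List.mem_finRange _))
    | some i =>
      have hi := of_decide_eq_true (List.find?_some (p := fun i => decide (x i = y p.2)) hf)
      rw [Option.map_some, hx (hi.trans h.symm)]

theorem matchPairs_fst_injective (hx : Function.Injective x) (hy : Function.Injective y) :
    Function.Injective fun i => ((matchPairs x y).get i).1 :=
  get_fst_injective (nodup_matchPairs x y) fun p hp q hq h => by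
    rw [mem_matchPairs hx hy] at hp hq
    exact hy (by rw [← hp, ← hq, h])

theorem matchPairs_snd_injective (hx : Function.Injective x) (hy : Function.Injective y) :
    Function.Injective fun i => ((matchPairs x y).get i).2 :=
  get_snd_injective (nodup_matchPairs x y) fun p hp q hq h => by
    rw [mem_matchPairs hx hy] at hp hq
    exact hx (by rw [hp, hq, h])

end Matching

section Join

variable {l₁ l₂ : ℕ} (D₁ : Dataset l₁) (D₂ : Dataset l₂)

/-- The pairs of positions with equal identifiers. -/
def joinPairs : List (Fin D₁.size × Fin D₂.size) :=
  ((List.finRange D₁.size) ×ˢ (List.finRange D₂.size)).filter fun p => D₁.id p.1 = D₂.id p.2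

theorem nodup_joinPairs : (joinPairs D₁ D₂).Nodup :=
  ((List.nodup_finRange _).product (List.nodup_finRange _)).filter _

theorem mem_joinPairs (p : Fin D₁.size × Fin D₂.size) :
    p ∈ joinPairs D₁ D₂ ↔ D₁.id p.1 = D₂.id p.2 := by
  rw [joinPairs, List.mem_filter, decide_eq_true_iff]
  exact ⟨fun h => h.2, fun h => ⟨List.mem_product.2 ⟨List.mem_finRange _, List.mem_finRange _⟩, h⟩⟩

theorem length_joinRows : (joinRows D₁ D₂).length = (joinPairs D₁ D₂).length := by
  simp [joinRows, joinPairs]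

theorem length_joinRows_eq_card : (joinRows D₁ D₂).length = (D₁.ids ∩ D₂.ids).card := by
  classical
  rw [length_joinRows, ← List.toFinset_card_of_nodup (nodup_joinPairs D₁ D₂)]
  refine Finset.card_bij (fun p _ => D₁.id p.1) (fun p hp => ?_) (fun p hp q hq h => ?_)
    fun z hz => ?_
  · have hp := (mem_joinPairs D₁ D₂ p).1 (List.mem_toFinset.1 hp)
    refine Finset.mem_inter.2 ⟨Finset.mem_image_of_mem _ (Finset.mem_univ _), ?_⟩
    rw [hp]
    exact Finset.mem_image_of_mem _ (Finset.mem_univ _)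
  · have hp := (mem_joinPairs D₁ D₂ p).1 (List.mem_toFinset.1 hp)
    have hq := (mem_joinPairs D₁ D₂ q).1 (List.mem_toFinset.1 hq)
    exact Prod.ext (D₁.id_injective h) (D₂.id_injective (by rw [← hp, ← hq]; exact h))
  · obtain ⟨h₁, h₂⟩ := Finset.mem_inter.1 hz
    obtain ⟨i, _, rfl⟩ := Finset.mem_image.1 h₁
    obtain ⟨j, _, h⟩ := Finset.mem_image.1 h₂
    exact ⟨(i, j), List.mem_toFinset.2 ((mem_joinPairs D₁ D₂ _).2 h.symm), rfl⟩

theorem card_ids {l : ℕ} (D : Dataset l) : D.ids.card = D.size := by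
  rw [Dataset.ids, Finset.card_image_of_injective _ D.id_injective, Finset.card_fin]

theorem length_joinRows_le₁ : (joinRows D₁ D₂).length ≤ D₁.size := by
  rw [length_joinRows_eq_card, ← card_ids D₁]
  exact Finset.card_le_card Finset.inter_subset_left

theorem length_joinRows_le₂ : (joinRows D₁ D₂).length ≤ D₂.size := by
  rw [length_joinRows_eq_card, ← card_ids D₂]
  exact Finset.card_le_card Finset.inter_subset_right

variable {D₁ D₂} {k : ℕ} {h : List Bool → Str k}

theorem id_mem_ids {l : ℕ} (D : Dataset l) (i : Fin D.size) : D.id i ∈ D.ids :=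
  Finset.mem_image_of_mem _ (Finset.mem_univ _)

theorem hash_injective₁ (hh : Set.InjOn h ↑(D₁.ids ∪ D₂.ids))
    (σ : Equiv.Perm (Fin D₁.size)) :
    Function.Injective fun i => h (D₁.id (σ i)) := fun _ _ e =>
  σ.injective (D₁.id_injective (hh (Finset.mem_union_left _ (id_mem_ids _ _))
    (Finset.mem_union_left _ (id_mem_ids _ _)) e))

theorem hash_injective₂ (hh : Set.InjOn h ↑(D₁.ids ∪ D₂.ids))
    (σ : Equiv.Perm (Fin D₂.size)) :
    Function.Injective fun i => h (D₂.id (σ i)) := fun _ _ e =>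
  σ.injective (D₂.id_injective (hh (Finset.mem_union_right _ (id_mem_ids _ _))
    (Finset.mem_union_right _ (id_mem_ids _ _)) e))

/-- Without collisions, the matching positions are those of the rows of the inner join. -/
theorem matchPairs_perm (hh : Set.InjOn h ↑(D₁.ids ∪ D₂.ids))
    (σ₁ : Equiv.Perm (Fin D₁.size)) (σ₂ : Equiv.Perm (Fin D₂.size)) :
    ((matchPairs (fun i => h (D₁.id (σ₁ i))) fun j => h (D₂.id (σ₂ j))).map fun p =>
      (D₁.attr (σ₁ p.1), D₂.attr (σ₂ p.2))).Perm (joinRows D₁ D₂) := by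
  have hm := mem_matchPairs (hash_injective₁ hh σ₁) (hash_injective₂ hh σ₂)
  have hn := nodup_matchPairs (fun i => h (D₁.id (σ₁ i))) fun j => h (D₂.id (σ₂ j))
  have : ((matchPairs (fun i => h (D₁.id (σ₁ i))) fun j => h (D₂.id (σ₂ j))).map
      (Equiv.prodCongr σ₁ σ₂)).Perm (joinPairs D₁ D₂) := by
    refine (List.perm_ext_iff_of_nodup (hn.map (Equiv.injective _)) (nodup_joinPairs _ _)).2
      fun p => ?_
    rw [mem_joinPairs, List.mem_map]
    constructor
    · rintro ⟨q, hq, rfl⟩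
      exact hh (Finset.mem_union_left _ (id_mem_ids _ _))
        (Finset.mem_union_right _ (id_mem_ids _ _)) ((hm q).1 hq)
    · intro e
      refine ⟨(σ₁.symm p.1, σ₂.symm p.2), (hm _).2 ?_, by simp⟩
      simp [e]
  have := this.map fun p => (D₁.attr p.1, D₂.attr p.2)
  rwa [List.map_map] at this

theorem card_image_inter (hh : Set.InjOn h ↑(D₁.ids ∪ D₂.ids))
    (σ₁ : Equiv.Perm (Fin D₁.size)) (σ₂ : Equiv.Perm (Fin D₂.size)) :
    (Finset.univ.image (fun i => h (D₁.id (σ₁ i))) ∩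
      Finset.univ.image fun j => h (D₂.id (σ₂ j))).card = (D₁.ids ∩ D₂.ids).card := by
  have key : ∀ {l : ℕ} (D : Dataset l) (σ : Equiv.Perm (Fin D.size)),
      Finset.univ.image (fun i => h (D.id (σ i))) = D.ids.image h := by
    intro l D σ
    rw [Dataset.ids, Finset.image_image]
    ext z
    simp only [Finset.mem_image, Finset.mem_univ, true_and, Function.comp]
    exact σ.exists_congr_left.trans (by simp)
  rw [key, key, ← Finset.image_inter_of_injOn, Finset.card_image_of_injOn]
  · exact hh.mono (Finset.coe_subset.2 (Finset.inter_subset_left.trans Finset.subset_union_left))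
  · simpa using hh

end Join

/-! ## The ideal functionality on a shuffled list of rows -/

/-- The functionality shuffles the rows, so their listing order is irrelevant, and the list produced
by the protocol can be used instead. -/
theorem idealPSA_bind {l₁ l₂ c : ℕ} {γ : Type} {D₁ : Dataset l₁} {D₂ : Dataset l₂}
    (f : Fin c → Str l₁ × Str l₂) (hf : (List.ofFn f).Perm (joinRows D₁ D₂))
    (F : Outputs l₁ l₂ → PMF γ) :
    (idealPSA D₁ D₂).bind F = (unif (Equiv.Perm (Fin c))).bind fun τ =>
      (unif (Fin c → Str l₁ × Str l₂)).bind fun s => F {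
        out₁ := List.ofFn s
        out₂ := List.ofFn fun i => ((s i).1.xor (f (τ i)).1, (s i).2.xor (f (τ i)).2)
        outS := ((D₁.ids ∩ D₂.ids).card, D₁.size, D₂.size) } := by
  have hc : c = (joinRows D₁ D₂).length := by rw [← hf.length_eq, List.length_ofFn]
  subst hc
  rw [unif_perm_bind_of_perm (f := f) (g := (joinRows D₁ D₂).get) (by rwa [List.ofFn_get])
    fun f => (unif (Fin (joinRows D₁ D₂).length → Str l₁ × Str l₂)).bind fun s => F {
        out₁ := List.ofFn s
        out₂ := List.ofFn fun i => ((s i).1.xor (f i).1, (s i).2.xor (f i).2)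
        outS := ((D₁.ids ∩ D₂.ids).card, D₁.size, D₂.size) }]
  unfold idealPSA
  rw [show ∀ (p : PMF (Equiv.Perm (Fin (joinRows D₁ D₂).length)))
    (g : _ → PMF (Outputs l₁ l₂)), (p >>= g) = p.bind g from fun _ _ => rfl, PMF.bind_bind]
  refine congrArg _ (funext fun τ => ?_)
  rw [show ∀ (p : PMF (Fin (joinRows D₁ D₂).length → Str l₁ × Str l₂))
    (g : _ → PMF (Outputs l₁ l₂)), (p >>= g) = p.bind g from fun _ _ => rfl, PMF.bind_bind]
  refine congrArg _ (funext fun s => ?_)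
  exact PMF.pure_bind _ _

/-! ## The simulator for a data owner, for a given key -/

/-- The law of the output of the simulator for a data owner, with the given key and shuffle. -/
noncomputable def partyKeyLaw (key σ : List ℕ) (la n c : ℕ) (ds : List ℕ) (kept sent : ℕ → List ℕ) :
    PMF (List ℕ) :=
  (permLaw n).bind fun ρ =>
    (seqLaw n fun i => fixedOr la (prescribed n c ρ kept i)).bind fun lab₁ =>
    (seqLaw (gateCount n + gateCount n) fun i => fixedOr la (prescribed n c ρ kept (n + i))).bind
      fun lab₂ => PMF.pure (ds ++ key ++ n :: σ ++ n :: lab₁ ++ gateCount n :: lab₂ ++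
        c :: ρ.take c ++ c :: (List.range c).flatMap sent)

theorem partyLaw_eq (κ₁ la n c : ℕ) (ds : List ℕ) (kept sent : ℕ → List ℕ) :
    partyLaw κ₁ la n c ds kept sent =
      (unif (Str κ₁)).bind fun r => (unif (Equiv.Perm (Fin n))).bind fun σ =>
        partyKeyLaw (encStr r) (permList σ) la n c ds kept sent := by
  rw [partyLaw, ← unif_str_map, PMF.bind_map]
  refine congrArg _ (funext fun r => ?_)
  rw [Function.comp, permLaw, PMF.bind_map]
  rfl

theorem flatMap_encFin {n : ℕ} (L : List (Fin n)) : L.flatMap encFin = L.map Fin.val :=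
  List.map_eq_flatMap.symm

/-- Averaging over the shares of the owner is essential: planted labels become uniform labels only
after that. The continuation `F` keeps the shares, so the joint law with the outputs is preserved.
-/
theorem partyKeyLaw_bind {γ : Type} {key ds : List ℕ} {la n c : ℕ} (hc : c ≤ n)
    (σ : Equiv.Perm (Fin n))
    (kept : (Fin c → Str la) → ℕ → List ℕ) (hk : ∀ s (k : Fin c), kept s k = encStr (s k))
    (sent : ℕ → List ℕ) (F : List ℕ → (Fin c → Str la) → PMF γ) :
    ((unif (Fin c → Str la)).bind fun s =>
      (partyKeyLaw key (permList σ) la n c ds (kept s) sent).bind fun v => F v s) =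
    (unif (Equiv.Perm (Fin n))).bind fun ρ =>
      (unif (Wires n la)).bind fun W => F (ds ++ key ++ encVec encFin σ ++ encWires W ++
        encList encFin (List.ofFn fun k => ρ (Fin.castLE hc k)) ++
        c :: (List.range c).flatMap sent) fun k => outLabels W (ρ (Fin.castLE hc k)) := by
  have e₁ : ∀ σ : Equiv.Perm (Fin n), n :: permList σ = encVec encFin σ := by
    intro σ
    rw [encVec, encList, List.length_ofFn, flatMap_encFin, List.map_ofFn]
    rfl
  have e₂ : ∀ ρ : Equiv.Perm (Fin n), c :: (permList ρ).take c =
      encList encFin (List.ofFn fun k => ρ (Fin.castLE hc k)) := by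
    intro ρ
    rw [encList, List.length_ofFn, flatMap_encFin, List.map_ofFn]
    congr 1
    refine List.ext_getElem (by simpa [permList] using hc) fun i h₁ h₂ => ?_
    simp [permList]
  simp only [partyKeyLaw, permLaw, PMF.bind_bind, PMF.bind_map, Function.comp_def, PMF.pure_bind]
  rw [PMF.bind_comm]
  refine congrArg _ (funext fun ρ => ?_)
  have := prescribed_wires_bind hc ρ kept hk fun w s => F (ds ++ key ++ n :: permList σ ++ w ++
    c :: (permList ρ).take c ++ c :: (List.range c).flatMap sent) s
  rw [← e₁, ← e₂, ← this]
  simp only [List.append_assoc, List.cons_append]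

/-- The execution of both switching networks, as seen by the sender of the first. -/
theorem switching_bind {γ : Type} {n m c l l' : ℕ} (hc : c ≤ n) {a : Fin c → Fin n}
    {b : Fin c → Fin m} (ha : Function.Injective a) (hb : Function.Injective b)
    (z : Fin c → Str l') (Ψ : Wires n l → (Fin c → Fin n) → (Fin c → Str l') → PMF γ) :
    ((unif (Wires n l)).bind fun W => (unif (Equiv.Perm (Fin n))).bind fun ρ =>
      (unif (Wires m l')).bind fun W' => (unif (Equiv.Perm (Fin m))).bind fun ρ' =>
        Ψ W (rho₂ ρ a) fun k => (z k).xor (outLabels W' (rho₂ ρ' b k))) =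
    (unif (Equiv.Perm (Fin n))).bind fun ρ => (unif (Fin c → Str l')).bind fun t =>
      (unif (Wires n l)).bind fun W => Ψ W (fun k => ρ (Fin.castLE hc k)) t := by
  have inv : Function.Involutive fun (t : Fin c → Str l') k => (z k).xor (t k) := fun t =>
    funext fun k => Str.xor_self_cancel _ _
  -- One-time pad: for each fixed `ρ'` the labels sit on distinct outgoing wires, so they are
  -- uniform and mask `z` completely.
  have h₂ : ∀ f : (Fin c → Str l') → PMF γ, ((unif (Wires m l')).bind fun W' =>
      (unif (Equiv.Perm (Fin m))).bind fun ρ' =>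
        f fun k => (z k).xor (outLabels W' (rho₂ ρ' b k))) = (unif (Fin c → Str l')).bind f := by
    intro f
    rw [PMF.bind_comm, unif_bind_equiv inv.toPerm]
    refine Eq.trans (congrArg _ (funext fun ρ' => unif_outLabels_bind (q := rho₂ ρ' b)
      (ρ'.symm.injective.comp hb) fun s => f fun k => (z k).xor (s k))) ?_
    rw [PMF.bind_const]
    rfl
  -- For fixed labels of the owner only the injection is random, and its law does not depend on `a`.
  have h₁ : ∀ W : Wires n l, ((unif (Equiv.Perm (Fin n))).bind fun ρ =>
      (unif (Fin c → Str l')).bind fun t => Ψ W (rho₂ ρ a) t) =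
      (unif (Equiv.Perm (Fin n))).bind fun ρ =>
      (unif (Fin c → Str l')).bind fun t => Ψ W (fun k => ρ (Fin.castLE hc k)) t := fun W =>
    unif_perm_symm_bind hc ha fun q => (unif (Fin c → Str l')).bind fun t => Ψ W q t
  simp only [h₂, h₁]
  rw [PMF.bind_comm]
  exact congrArg _ (funext fun ρ => PMF.bind_comm _ _ _)

section Party

variable {κ₁ κ₂ l₁ l₂ : ℕ} (D₁ : Dataset l₁) (D₂ : Dataset l₂)

/-- The switching networks of an execution with the given common positions. -/
noncomputable def executeTail {κ₂ c : ℕ} (r : Str κ₁) (σ₁ : Equiv.Perm (Fin D₁.size))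
    (σ₂ : Equiv.Perm (Fin D₂.size)) (x : Fin D₁.size → Str κ₂) (y : Fin D₂.size → Str κ₂)
    (τ : Equiv.Perm (Fin c)) (π₁ : Fin c → Fin D₁.size) (π₂ : Fin c → Fin D₂.size) :
    PMF (Execution D₁.size D₂.size κ₁ κ₂ l₁ l₂) :=
  let u : Fin D₁.size → Str l₁ := fun i => D₁.attr (σ₁ i)
  let v : Fin D₂.size → Str l₂ := fun j => D₂.attr (σ₂ j)
  (unif (Wires D₁.size l₁)).bind fun W₁ => (unif (Equiv.Perm (Fin D₁.size))).bind fun ρ₁ =>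
  (unif (Wires D₂.size l₂)).bind fun W₂ => (unif (Equiv.Perm (Fin D₂.size))).bind fun ρ₁' =>
  PMF.pure {
    key := r
    shuffle₁ := σ₁
    shuffle₂ := σ₂
    wires₁ := W₁
    wires₂ := W₂
    hash₁ := x
    hash₂ := y
    order := List.ofFn fun i => (τ i : ℕ)
    bij₁ := ρ₁
    bij₂ := ρ₁'
    masked₁ := maskedInput W₁ u
    masked₂ := maskedInput W₂ v
    ot₁ := otOutputs W₁ ρ₁
    ot₂ := otOutputs W₂ ρ₁'
    inj₁ := List.ofFn (rho₂ ρ₁ π₁)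
    inj₂ := List.ofFn (rho₂ ρ₁' π₂)
    kept₁ := List.ofFn (senderShares W₁ (rho₂ ρ₁ π₁))
    kept₂ := List.ofFn (senderShares W₂ (rho₂ ρ₁' π₂))
    sent₁ := List.ofFn
      (receiverShares ρ₁ (maskedInput W₁ u) (otOutputs W₁ ρ₁) (rho₂ ρ₁ π₁))
    sent₂ := List.ofFn
      (receiverShares ρ₁' (maskedInput W₂ v) (otOutputs W₂ ρ₁') (rho₂ ρ₁' π₂)) }

/-- One execution of the protocol with the given key and hash function. -/
noncomputable def executeWith (r : Str κ₁) (h : List Bool → Str κ₂) :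
    PMF (Execution D₁.size D₂.size κ₁ κ₂ l₁ l₂) :=
  (unif (Equiv.Perm (Fin D₁.size))).bind fun σ₁ =>
  (unif (Equiv.Perm (Fin D₂.size))).bind fun σ₂ =>
  let x : Fin D₁.size → Str κ₂ := fun i => h (D₁.id (σ₁ i))
  let y : Fin D₂.size → Str κ₂ := fun j => h (D₂.id (σ₂ j))
  (unif (Equiv.Perm (Fin (matchPairs x y).length))).bind fun τ =>
    executeTail D₁ D₂ r σ₁ σ₂ x y τ (fun i => ((matchPairs x y).get (τ i)).1)
      fun i => ((matchPairs x y).get (τ i)).2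

theorem execute_eq (H : Oracle κ₁ κ₂) : execute D₁ D₂ H =
    (unif (Str κ₁)).bind fun r => executeWith D₁ D₂ r fun x => H (r, x) := rfl

theorem zip_ofFn {α β : Type} {n : ℕ} (f : Fin n → α) (g : Fin n → β) :
    (List.ofFn f).zip (List.ofFn g) = List.ofFn fun i => (f i, g i) :=
  List.ext_getElem (by simp) fun i h₁ h₂ => by simp

theorem flatMap_range_getD {α : Type} {c : ℕ} (s : Fin c → α) (g : α → List ℕ) :
    ((List.range c).flatMap fun k => ((List.ofFn s).map g).getD k []) = (List.ofFn s).flatMap g := by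
  rw [List.flatMap_def, List.flatMap_def]
  congr 1
  refine List.ext_getElem (by simp) fun i h₁ h₂ => ?_
  have : i < c := by simpa using h₁
  simp [this]

theorem bind_comm_pairs {α β α' β' γ : Type} (p : PMF α) (q : PMF β) (p' : PMF α') (q' : PMF β')
    (f : α → β → α' → β' → PMF γ) :
    (p.bind fun a => q.bind fun b => p'.bind fun a' => q'.bind fun b' => f a b a' b') =
      p'.bind fun a' => q'.bind fun b' => p.bind fun a => q.bind fun b => f a b a' b' := by
  have h : ∀ a, (q.bind fun b => p'.bind fun a' => q'.bind fun b' => f a b a' b') =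
      p'.bind fun a' => q'.bind fun b' => q.bind fun b => f a b a' b' := fun a => by
    rw [PMF.bind_comm]
    exact congrArg _ (funext fun a' => PMF.bind_comm _ _ _)
  simp only [h]
  rw [PMF.bind_comm]
  exact congrArg _ (funext fun a' => PMF.bind_comm _ _ _)

variable {D₁ D₂} {h : List Bool → Str κ₂}

/-- The view of a data owner and its shares of the rows, and the shares of the other one, for given
shuffled rows `z`. -/
noncomputable def ownerLaw {γ : Type} {l l' n c : ℕ} (hc : c ≤ n) (ds key : List ℕ)
    (σ : Equiv.Perm (Fin n)) (F : List ℕ → (Fin c → Str l) → (Fin c → Str l') → γ) : PMF γ :=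
  (unif (Equiv.Perm (Fin n))).bind fun ρ => (unif (Fin c → Str l')).bind fun t =>
    (unif (Wires n l)).bind fun W => PMF.pure (F (ds ++ key ++ encVec encFin σ ++ encWires W ++
      encList encFin (List.ofFn fun k => ρ (Fin.castLE hc k)) ++ encList encStr (List.ofFn t))
      (fun k => outLabels W (ρ (Fin.castLE hc k))) t)

/-- `ownerLaw` is the normal form in which the two worlds meet; here the simulated view is brought
into it, and `switching_ownerLaw` does the same for the real one. -/
theorem partyKeyLaw_ownerLaw {γ : Type} {l l' n c : ℕ} (hc : c ≤ n) (ds key : List ℕ)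
    (σ : Equiv.Perm (Fin n)) (F : List ℕ → (Fin c → Str l) → (Fin c → Str l') → γ) :
    ((unif (Fin c → Str l)).bind fun s => (unif (Fin c → Str l')).bind fun t =>
      (partyKeyLaw key (permList σ) l n c ds (fun k => ((List.ofFn s).map encStr).getD k [])
        fun k => ((List.ofFn t).map encStr).getD k []).bind fun v => PMF.pure (F v s t)) =
      ownerLaw hc ds key σ F := by
  unfold ownerLaw
  rw [PMF.bind_comm]
  refine Eq.trans (congrArg _ (funext fun t => ?_)) (PMF.bind_comm _ _ _)
  rw [partyKeyLaw_bind hc σ (fun s k => ((List.ofFn s).map encStr).getD k [])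
    (fun s k => by simp) _ fun v s => PMF.pure (F v s t)]
  simp only [flatMap_range_getD]
  simp only [encList, List.length_ofFn]

theorem switching_ownerLaw {γ : Type} {n m c l l' : ℕ} (hc : c ≤ n) {a : Fin c → Fin n}
    {b : Fin c → Fin m} (ha : Function.Injective a) (hb : Function.Injective b)
    (z : Fin c → Str l') (ds key : List ℕ) (σ : Equiv.Perm (Fin n))
    (F : List ℕ → (Fin c → Str l) → (Fin c → Str l') → γ) :
    ((unif (Wires n l)).bind fun W => (unif (Equiv.Perm (Fin n))).bind fun ρ =>
      (unif (Wires m l')).bind fun W' => (unif (Equiv.Perm (Fin m))).bind fun ρ' =>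
        PMF.pure (F (ds ++ key ++ encVec encFin σ ++ encWires W ++
          encList encFin (List.ofFn (rho₂ ρ a)) ++ encList encStr
            (List.ofFn fun k => (z k).xor (outLabels W' (rho₂ ρ' b k))))
          (fun k => outLabels W (rho₂ ρ a k)) fun k => (z k).xor (outLabels W' (rho₂ ρ' b k)))) =
      ownerLaw hc ds key σ F :=
  switching_bind hc ha hb z fun W q t => PMF.pure (F (ds ++ key ++ encVec encFin σ ++
    encWires W ++ encList encFin (List.ofFn q) ++ encList encStr (List.ofFn t))
    (fun k => outLabels W (q k)) t)

variable {c : ℕ} {r : Str κ₁} {σ₁ : Equiv.Perm (Fin D₁.size)} {σ₂ : Equiv.Perm (Fin D₂.size)}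
  {x : Fin D₁.size → Str κ₂} {y : Fin D₂.size → Str κ₂} {τ : Equiv.Perm (Fin c)}
  {a : Fin c → Fin D₁.size} {b : Fin c → Fin D₂.size}

/-- The parameter `s` stands for the labels kept by the owner, `t` for the shares sent by the
server. A receiver share is attribute xor label, so the label kept by the other owner is recovered
as `t` xor attribute; this turns the outputs into exclusive-or shares of the rows. -/
theorem executeTail_view₁ (hc : c ≤ D₁.size) (ha : Function.Injective a)
    (hb : Function.Injective b) :
    (executeTail D₁ D₂ r σ₁ σ₂ x y τ a b).map (fun e => (e.view₁ D₁, e.outputs)) =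
      ownerLaw hc (encDataset D₁) (encStr r) σ₁ fun v s t => (v, ({
        out₁ := List.ofFn fun i => (s i, t i)
        out₂ := List.ofFn fun i => ((s i).xor (D₁.attr (σ₁ (a i))), (t i).xor (D₂.attr (σ₂ (b i))))
        outS := ((Finset.univ.image x ∩ Finset.univ.image y).card, D₁.size, D₂.size) } :
          Outputs l₁ l₂)) := by
  rw [← switching_ownerLaw hc ha hb fun i => D₂.attr (σ₂ (b i))]
  unfold executeTail
  simp only [PMF.map_bind, PMF.pure_map]
  refine congrArg _ (funext fun W₁ => congrArg _ (funext fun ρ₁ => congrArg _ (funext fun W₂ =>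
      congrArg _ (funext fun ρ₂ => congrArg _ ?_))))
  simp only [Execution.view₁, Execution.outputs, receiverShares_eq, zip_ofFn]
  simp only [rho₂, Equiv.apply_symm_apply]
  refine congrArg _ ?_
  simp only [Outputs.mk.injEq, and_true]
  refine ⟨rfl, congrArg _ (funext fun i => Prod.ext (Str.xor_comm _ _) ?_)⟩
  simp only [Str.xor_comm (D₂.attr _), Str.xor_xor_cancel]
  rfl

theorem executeTail_view₂ (hc : c ≤ D₂.size) (ha : Function.Injective a)
    (hb : Function.Injective b) :
    (executeTail D₁ D₂ r σ₁ σ₂ x y τ a b).map (fun e => (e.view₂ D₂, e.outputs)) =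
      ownerLaw hc (encDataset D₂) (encStr r) σ₂ fun v s t => (v, ({
        out₁ := List.ofFn fun i => ((t i).xor (D₁.attr (σ₁ (a i))), (s i).xor (D₂.attr (σ₂ (b i))))
        out₂ := List.ofFn fun i => (t i, s i)
        outS := ((Finset.univ.image x ∩ Finset.univ.image y).card, D₁.size, D₂.size) } :
          Outputs l₁ l₂)) := by
  rw [← switching_ownerLaw hc hb ha fun i => D₁.attr (σ₁ (a i))]
  unfold executeTail
  simp only [PMF.map_bind, PMF.pure_map]
  rw [bind_comm_pairs]
  refine congrArg _ (funext fun W₂ => congrArg _ (funext fun ρ₂ => congrArg _ (funext fun W₁ =>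
      congrArg _ (funext fun ρ₁ => congrArg _ ?_))))
  simp only [Execution.view₂, Execution.outputs, receiverShares_eq, zip_ofFn]
  simp only [rho₂, Equiv.apply_symm_apply]
  refine congrArg _ ?_
  simp only [Outputs.mk.injEq, and_true]
  refine ⟨congrArg _ (funext fun i => Prod.ext ?_ (Str.xor_comm _ _)), rfl⟩
  simp only [Str.xor_comm (D₁.attr _), Str.xor_xor_cancel]
  rfl

theorem idealPSA_ownerLaw₁ (hc : c ≤ D₁.size) (f : Fin c → Str l₁ × Str l₂)
    (hf : (List.ofFn f).Perm (joinRows D₁ D₂)) :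
    ((idealPSA D₁ D₂).bind fun o =>
      (partyKeyLaw (encStr r) (permList σ₁) l₁ D₁.size o.out₁.length (encDataset D₁)
        (fun k => (o.out₁.map fun p => encStr p.1).getD k [])
        fun k => (o.out₁.map fun p => encStr p.2).getD k []).map (·, o)) =
      (unif (Equiv.Perm (Fin c))).bind fun τ =>
        ownerLaw hc (encDataset D₁) (encStr r) σ₁ fun v s t => (v, ({
          out₁ := List.ofFn fun i => (s i, t i)
          out₂ := List.ofFn fun i => ((s i).xor (f (τ i)).1, (t i).xor (f (τ i)).2)
          outS := ((D₁.ids ∩ D₂.ids).card, D₁.size, D₂.size) } : Outputs l₁ l₂)) := by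
  rw [idealPSA_bind f hf]
  refine congrArg _ (funext fun τ => ?_)
  rw [unif_pi_prod_bind, ← partyKeyLaw_ownerLaw]
  refine congrArg _ (funext fun s => congrArg _ (funext fun t => ?_))
  simp only [List.length_ofFn, List.map_ofFn, Function.comp_def]
  rfl

theorem idealPSA_ownerLaw₂ (hc : c ≤ D₂.size) (f : Fin c → Str l₁ × Str l₂)
    (hf : (List.ofFn f).Perm (joinRows D₁ D₂)) :
    ((idealPSA D₁ D₂).bind fun o =>
      (partyKeyLaw (encStr r) (permList σ₂) l₂ D₂.size o.out₂.length (encDataset D₂)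
        (fun k => (o.out₂.map fun p => encStr p.2).getD k [])
        fun k => (o.out₂.map fun p => encStr p.1).getD k []).map (·, o)) =
      (unif (Equiv.Perm (Fin c))).bind fun τ =>
        ownerLaw hc (encDataset D₂) (encStr r) σ₂ fun v s t => (v, ({
          out₁ := List.ofFn fun i => ((t i).xor (f (τ i)).1, (s i).xor (f (τ i)).2)
          out₂ := List.ofFn fun i => (t i, s i)
          outS := ((D₁.ids ∩ D₂.ids).card, D₁.size, D₂.size) } : Outputs l₁ l₂)) := by
  rw [idealPSA_bind f hf]
  refine congrArg _ (funext fun τ => ?_)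
  -- The functionality draws the share of the first owner. Masking with the rows is an involution,
  -- so the share of the second owner can be taken as the uniform one.
  have inv : Function.Involutive fun (s : Fin c → Str l₁ × Str l₂) i =>
      ((s i).1.xor (f (τ i)).1, (s i).2.xor (f (τ i)).2) := fun s => funext fun i =>
    Prod.ext (Str.xor_xor_cancel _ _) (Str.xor_xor_cancel _ _)
  rw [unif_bind_equiv inv.toPerm, unif_pi_prod_bind, ← partyKeyLaw_ownerLaw, PMF.bind_comm]
  refine congrArg _ (funext fun s => congrArg _ (funext fun t => ?_))
  simp only [Function.Involutive.coe_toPerm, Str.xor_xor_cancel, List.length_ofFn, List.map_ofFn,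
    Function.comp_def]
  rfl

variable (r)

/-- For a fixed key and hash function without collisions the identity is exact; the random oracle
enters only through the probability of a collision. -/
theorem executeWith_view₁ (hh : Set.InjOn h ↑(D₁.ids ∪ D₂.ids)) :
    (executeWith D₁ D₂ r h).map (fun e => (e.view₁ D₁, e.outputs)) =
      (unif (Equiv.Perm (Fin D₁.size))).bind fun σ => (idealPSA D₁ D₂).bind fun o =>
        (partyKeyLaw (encStr r) (permList σ) l₁ D₁.size o.out₁.length (encDataset D₁)
          (fun k => (o.out₁.map fun p => encStr p.1).getD k [])
          fun k => (o.out₁.map fun p => encStr p.2).getD k []).map (·, o) := by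
  unfold executeWith
  simp only [PMF.map_bind]
  refine congrArg _ (funext fun σ₁ => ?_)
  -- For each shuffle of the other owner the conditional law is the same, so that shuffle drops out.
  refine Eq.trans (congrArg _ (funext fun σ₂ => ?_)) (PMF.bind_const _ _)
  have fst := matchPairs_fst_injective (hash_injective₁ hh σ₁) (hash_injective₂ hh σ₂)
  have snd := matchPairs_snd_injective (hash_injective₁ hh σ₁) (hash_injective₂ hh σ₂)
  have perm := matchPairs_perm hh σ₁ σ₂
  rw [← List.ofFn_get (matchPairs _ _), List.map_ofFn] at perm
  have hc := Fintype.card_le_of_injective _ fst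
  rw [Fintype.card_fin, Fintype.card_fin] at hc
  rw [idealPSA_ownerLaw₁ hc _ perm]
  refine congrArg _ (funext fun τ => ?_)
  refine (executeTail_view₁ hc (fst.comp τ.injective) (snd.comp τ.injective)).trans ?_
  rw [card_image_inter hh]
  rfl

theorem executeWith_view₂ (hh : Set.InjOn h ↑(D₁.ids ∪ D₂.ids)) :
    (executeWith D₁ D₂ r h).map (fun e => (e.view₂ D₂, e.outputs)) =
      (unif (Equiv.Perm (Fin D₂.size))).bind fun σ => (idealPSA D₁ D₂).bind fun o =>
        (partyKeyLaw (encStr r) (permList σ) l₂ D₂.size o.out₂.length (encDataset D₂)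
          (fun k => (o.out₂.map fun p => encStr p.2).getD k [])
          fun k => (o.out₂.map fun p => encStr p.1).getD k []).map (·, o) := by
  unfold executeWith
  simp only [PMF.map_bind]
  rw [PMF.bind_comm]
  refine congrArg _ (funext fun σ₂ => ?_)
  refine Eq.trans (congrArg _ (funext fun σ₁ => ?_)) (PMF.bind_const _ _)
  have fst := matchPairs_fst_injective (hash_injective₁ hh σ₁) (hash_injective₂ hh σ₂)
  have snd := matchPairs_snd_injective (hash_injective₁ hh σ₁) (hash_injective₂ hh σ₂)
  have perm := matchPairs_perm hh σ₁ σ₂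
  rw [← List.ofFn_get (matchPairs _ _), List.map_ofFn] at perm
  have hc := Fintype.card_le_of_injective _ snd
  rw [Fintype.card_fin, Fintype.card_fin] at hc
  rw [idealPSA_ownerLaw₂ hc _ perm]
  refine congrArg _ (funext fun τ => ?_)
  refine (executeTail_view₂ hc (fst.comp τ.injective) (snd.comp τ.injective)).trans ?_
  rw [card_image_inter hh]
  rfl

end Party

/-! ### The bad events: a collision of hash values and a query with the secret key. -/

/-! ## The random oracle -/

open scoped ENNReal

section Oracle

variable {κ₁ κ₂ : ℕ}

instance : IsProbabilityMeasure (randomOracle κ₁ κ₂) := by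
  unfold randomOracle; infer_instance

/-- Values at finitely many distinct points are independent and uniform, so an integral over the
oracle reduces to a finite sum. -/
theorem lintegral_oracle_comp {ι : Type} [Fintype ι] [DecidableEq ι] {q : ι → Str κ₁ × List Bool}
    (hq : Function.Injective q) (f : (ι → Str κ₂) → ℝ≥0∞) :
    ∫⁻ H, f (fun i => H (q i)) ∂(randomOracle κ₁ κ₂) = ∑' z, unif (ι → Str κ₂) z * f z := by
  classical
  have hm : Measurable fun (H : Oracle κ₁ κ₂) i => H (q i) :=
    measurable_pi_lambda _ fun i => measurable_pi_apply _
  have hf : Measurable f := measurable_of_countable f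
  rw [← lintegral_map hf hm, lintegral_countable']
  refine tsum_congr fun z => ?_
  rw [mul_comm]
  congr 1
  rw [Measure.map_apply hm (measurableSet_singleton z)]
  -- The side conditions `q i = p` describe the cylinder set as a product without inverting `q`; by
  -- injectivity the factor at `q i` is `{z i}`.
  have : (fun (H : Oracle κ₁ κ₂) i => H (q i)) ⁻¹' {z} =
      Set.pi ↑(Finset.univ.image q) fun p => {a | ∀ i, q i = p → a = z i} := by
    ext H
    simp only [Set.mem_preimage, Set.mem_singleton_iff, Set.mem_pi, Finset.coe_image,
      Finset.coe_univ, Set.image_univ, Set.mem_range, Set.mem_ofPred_eq]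
    constructor
    · rintro rfl p _ i rfl
      rfl
    · exact fun h => funext fun i => h _ ⟨i, rfl⟩ i rfl
  rw [this, randomOracle, Measure.infinitePi_pi _ fun p _ => (Set.to_countable _).measurableSet,
    Finset.prod_image fun i _ j _ h => hq h]
  have e : ∀ i, {a : Str κ₂ | ∀ j, q j = q i → a = z j} = {z i} := by
    intro i
    ext a
    simp only [Set.mem_ofPred_eq, Set.mem_singleton_iff]
    exact ⟨fun h => h i rfl, fun h j hj => by rw [h, hq hj]⟩
  simp only [e, PMF.toMeasure_apply_singleton _ _ (measurableSet_singleton _),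
    PMF.uniformOfFintype_apply, Finset.prod_const, Finset.card_univ, Fintype.card_fun]
  rw [Nat.cast_pow, Nat.cast_pow, ENNReal.inv_pow, ENNReal.inv_pow, Nat.cast_pow, ENNReal.inv_pow]

/-- The two values form a uniform pair, and the diagonal contains `2 ^ κ₂` of the `(2 ^ κ₂) ^ 2`
pairs. -/
theorem measure_oracle_eq {p p' : Str κ₁ × List Bool} (h : p ≠ p') :
    randomOracle κ₁ κ₂ {H | H p = H p'} = ((2 : ℝ≥0∞) ^ κ₂)⁻¹ := by
  have hq : Function.Injective fun b : Bool => if b then p else p' := by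
    intro b b' e
    cases b <;> cases b' <;> simp_all [eq_comm]
  have hmeas : MeasurableSet {H : Oracle κ₁ κ₂ | H p = H p'} :=
    measurableSet_eq_fun (measurable_pi_apply _) (measurable_pi_apply _)
  have h1 := lintegral_oracle_comp (κ₂ := κ₂) hq fun z => if z true = z false then 1 else 0
  have e : (fun H : Oracle κ₁ κ₂ => if H p = H p' then (1 : ℝ≥0∞) else 0) =
      Set.indicator {H | H p = H p'} 1 := by
    funext H; simp [Set.indicator_apply]
  simp only [if_true, Bool.false_eq_true, if_false] at h1
  rw [e, lintegral_indicator_one hmeas] at h1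
  rw [h1]
  rw [tsum_fintype, ← (Equiv.boolArrowEquivProd (Str κ₂)).symm.sum_comp, Fintype.sum_prod_type]
  simp only [PMF.uniformOfFintype_apply, Equiv.boolArrowEquivProd, Equiv.coe_fn_symm_mk,
    mul_ite, mul_one, mul_zero, Fintype.card_fun, Fintype.card_bool, Fintype.card_fin,
    if_true, Bool.false_eq_true, if_false]
  rw [Finset.sum_congr rfl fun x _ => Finset.sum_eq_single x (fun b _ hb => if_neg hb)
    fun hx => absurd (Finset.mem_univ x) hx]
  simp only [if_true, Finset.sum_const, Finset.card_univ, Fintype.card_fun, Fintype.card_bool,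
    Fintype.card_fin, nsmul_eq_mul]
  push_cast
  rw [sq, ENNReal.mul_inv (by simp) (by simp), ← mul_assoc, ENNReal.mul_inv_cancel (by simp)
    (by simp), one_mul]

/-- A collision of hash values among the elements of a finite set is unlikely. -/
theorem measure_collision_le (r : Str κ₁) (S : Finset (List Bool)) :
    randomOracle κ₁ κ₂ {H | ¬ Set.InjOn (fun x => H (r, x)) ↑S} ≤
      (S.card : ℝ≥0∞) ^ 2 * ((2 : ℝ≥0∞) ^ κ₂)⁻¹ := by
  classical
  have hsub : {H : Oracle κ₁ κ₂ | ¬ Set.InjOn (fun x => H (r, x)) ↑S} ⊆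
      ⋃ p ∈ S.offDiag, {H | H (r, p.1) = H (r, p.2)} := by
    intro H hH
    simp only [Set.mem_ofPred_eq, Set.InjOn, not_forall] at hH
    obtain ⟨x, hx, y, hy, e, hne⟩ := hH
    exact Set.mem_biUnion (x := (x, y)) (Finset.mem_offDiag.2 ⟨hx, hy, hne⟩) e
  refine (measure_mono hsub).trans ((measure_biUnion_finset_le _ _).trans ?_)
  rw [Finset.sum_congr rfl fun p hp => measure_oracle_eq fun e =>
    (Finset.mem_offDiag.1 hp).2.2 (Prod.ext_iff.1 e).2, Finset.sum_const, nsmul_eq_mul]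
  gcongr
  rw [Finset.offDiag_card, sq]
  exact_mod_cast Nat.sub_le _ _

theorem measurableSet_collision (r : Str κ₁) (S : Finset (List Bool)) :
    MeasurableSet {H : Oracle κ₁ κ₂ | ¬ Set.InjOn (fun x => H (r, x)) ↑S} := by
  have : {H : Oracle κ₁ κ₂ | ¬ Set.InjOn (fun x => H (r, x)) ↑S} =
      (⋂ x ∈ S, ⋂ y ∈ S, {H | H (r, x) = H (r, y) → x = y})ᶜ := by
    ext H
    simp only [Set.InjOn, Set.mem_ofPred_eq, Set.mem_compl_iff, Set.mem_iInter, Finset.mem_coe]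
  rw [this]
  refine (S.measurableSet_biInter fun x _ => S.measurableSet_biInter fun y _ => ?_).compl
  by_cases hxy : x = y
  · simp [hxy]
  · simp only [hxy, imp_false]
    exact (measurableSet_eq_fun (f := fun H : Oracle κ₁ κ₂ => H (r, x)) (g := fun H => H (r, y))
      (measurable_pi_apply _) (measurable_pi_apply _)).compl

/-- Induction on the strategy: a query splits the oracles into finitely many measurable classes, one
for each answer. -/
theorem measurable_run (D : Strategy κ₁ κ₂) : Measurable fun H => D.run H true := by
  induction D with
  | ret b => exact measurable_const
  | toss k ih =>
    simp only [Strategy.run, PMF.bind_apply]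
    exact Measurable.tsum fun b => (ih b).const_mul _
  | ask q k ih =>
    have : (fun H => (Strategy.ask q k).run H true) = fun H : Oracle κ₁ κ₂ =>
        ∑ z, Set.indicator {H : Oracle κ₁ κ₂ | H q = z} (fun H => (k z).run H true) H := by
      funext H
      rw [Strategy.run, Finset.sum_eq_single (H q)]
      · simp
      · intro z _ hz
        simp [hz.symm]
      · simp
    rw [this]
    refine Finset.measurable_sum _ fun z _ => (ih z).indicator ?_
    exact measurableSet_eq_fun (measurable_pi_apply q) measurable_const

theorem measurable_bind_run {α : Type} [Countable α] {E : Oracle κ₁ κ₂ → PMF α}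
    (hE : ∀ a, Measurable fun H => E H a) (D : α → Strategy κ₁ κ₂) :
    Measurable fun H => ((E H).bind fun a => (D a).run H) true := by
  simp only [PMF.bind_apply]
  exact Measurable.tsum fun a => (hE a).mul (measurable_run (D a))

/-! ### Resampling the values of the oracle for one key -/

/-- Replace the values for the key `r`. -/
def overrideKey (r : Str κ₁) (p : Oracle κ₁ κ₂ × Oracle κ₁ κ₂) : Oracle κ₁ κ₂ := fun q =>
  if q.1 = r then p.2 q else p.1 q

theorem measurable_overrideKey (r : Str κ₁) : Measurable (overrideKey (κ₂ := κ₂) r) := by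
  refine measurable_pi_lambda _ fun q => ?_
  unfold overrideKey
  split_ifs
  · exact (measurable_pi_apply q).comp measurable_snd
  · exact (measurable_pi_apply q).comp measurable_fst

/-- The coordinates are independent, so taking those for `r` from a second copy does not change the
law; on boxes the product over coordinates splits into two factors. -/
theorem map_overrideKey (r : Str κ₁) :
    ((randomOracle κ₁ κ₂).prod (randomOracle κ₁ κ₂)).map (overrideKey r) =
      randomOracle κ₁ κ₂ := by
  classical
  refine Measure.eq_infinitePi _ fun s t ht => ?_
  rw [Measure.map_apply (measurable_overrideKey r)
    (MeasurableSet.pi s.countable_toSet fun i _ => ht i)]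
  have : overrideKey r ⁻¹' Set.pi ↑s t = Set.pi ↑(s.filter fun q => ¬ q.1 = r) t ×ˢ
      Set.pi ↑(s.filter fun q => q.1 = r) t := by
    ext p
    simp only [Set.mem_preimage, Set.mem_pi, Finset.mem_coe, Set.mem_prod, Finset.mem_filter,
      overrideKey]
    constructor
    · intro h
      refine ⟨fun i hi => ?_, fun i hi => ?_⟩
      · simpa [hi.2] using h i hi.1
      · simpa [hi.2] using h i hi.1
    · intro h i hi
      split_ifs with hr
      · exact h.2 i ⟨hi, hr⟩
      · exact h.1 i ⟨hi, hr⟩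
  rw [this, Measure.prod_prod]
  unfold randomOracle
  rw [Measure.infinitePi_pi _ fun i _ => ht i, Measure.infinitePi_pi _ fun i _ => ht i, mul_comm,
    Finset.prod_filter_mul_prod_filter_not]

theorem lintegral_overrideKey (r : Str κ₁) {f : Oracle κ₁ κ₂ → ℝ≥0∞} (hf : Measurable f) :
    ∫⁻ H, f H ∂(randomOracle κ₁ κ₂) = ∫⁻ H', ∫⁻ H, f (overrideKey r (H, H'))
      ∂(randomOracle κ₁ κ₂) ∂(randomOracle κ₁ κ₂) := by
  conv_lhs => rw [← map_overrideKey r]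
  rw [lintegral_map hf (measurable_overrideKey r)]
  exact lintegral_prod_symm _ (hf.comp (measurable_overrideKey r)).aemeasurable

/-! ### Guessing the key -/

/-- Report whether the strategy makes a query with the key `r`. -/
def Strategy.hits (r : Str κ₁) : Strategy κ₁ κ₂ → Strategy κ₁ κ₂
  | .ret _ => .ret false
  | .toss k => .toss fun b => (k b).hits r
  | .ask q k => if q.1 = r then .ret true else .ask q fun a => (k a).hits r

/-- Each query names one key, so a run with at most `n` queries hits at most `n` keys. For a uniform
key independent of the strategy this bounds the guessing probability by `n / 2 ^ κ₁`. -/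
theorem sum_hits_le (H : Oracle κ₁ κ₂) (D : Strategy κ₁ κ₂) :
    ∀ {n : ℕ}, D.QueriesAtMost n → ∑ r, (D.hits r).run H true ≤ n := by
  induction D with
  | ret b => intro n _; simp [Strategy.hits, Strategy.run]
  | toss k ih =>
    intro n hn
    simp only [Strategy.hits, Strategy.run, PMF.bind_apply, tsum_fintype]
    rw [Finset.sum_comm]
    simp only [← Finset.mul_sum]
    calc ∑ b, unif Bool b * ∑ r, ((k b).hits r).run H true
        ≤ ∑ b, unif Bool b * n := by
          gcongr with b
          exact ih b (hn b)
      _ = n := by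
          rw [← Finset.sum_mul, ← tsum_fintype (L := .unconditional _), PMF.tsum_coe, one_mul]
  | ask q k ih =>
    intro n hn
    cases n with
    | zero => exact absurd hn (by simp [Strategy.QueriesAtMost])
    | succ n =>
      calc ∑ r, ((Strategy.ask q k).hits r).run H true
          ≤ ∑ r, ((if q.1 = r then 1 else 0) + ((k (H q)).hits r).run H true) := by
            gcongr with r
            rw [Strategy.hits]
            split_ifs
            · simp [Strategy.run]
            · simp [Strategy.run]
        _ = 1 + ∑ r, ((k (H q)).hits r).run H true := by
            rw [Finset.sum_add_distrib]; simp
        _ ≤ ((n + 1 : ℕ) : ℝ≥0∞) := by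
            rw [Nat.cast_add, Nat.cast_one, add_comm]
            gcongr
            exact ih _ (hn _)

/-- Identical until bad: both runs agree up to the first query with key `r`, and at such a query
`hits` accepts. -/
theorem run_le_run_add_hits {r : Str κ₁} {H H' : Oracle κ₁ κ₂}
    (h : ∀ q, q.1 ≠ r → H q = H' q) (D : Strategy κ₁ κ₂) :
    D.run H true ≤ D.run H' true + (D.hits r).run H true ∧
      D.run H' true ≤ D.run H true + (D.hits r).run H true := by
  induction D with
  | ret b => simp [Strategy.run]
  | toss k ih =>
    simp only [Strategy.hits, Strategy.run, PMF.bind_apply, tsum_fintype]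
    rw [← Finset.sum_add_distrib, ← Finset.sum_add_distrib]
    simp only [← mul_add]
    exact ⟨by gcongr with b; exact (ih b).1, by gcongr with b; exact (ih b).2⟩
  | ask q k ih =>
    rw [Strategy.hits]
    split_ifs with hq
    · simp only [Strategy.run, PMF.pure_apply, if_true]
      exact ⟨(PMF.coe_le_one _ _).trans le_add_self, (PMF.coe_le_one _ _).trans le_add_self⟩
    · simp only [Strategy.run, ← h q hq]
      exact ih _

end Oracle

/-! ## Advantages -/

section Advantage

variable {κ₁ κ₂ : ℕ} {α β : Type}

theorem acceptProb_sub_le {E E' : Oracle κ₁ κ₂ → PMF α} {D : α → Strategy κ₁ κ₂} {δ : ℝ≥0∞}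
    (hδ : δ ≠ ⊤)
    (h₁ : ∫⁻ H, ((E H).bind fun a => (D a).run H) true ∂(randomOracle κ₁ κ₂) ≤
      ∫⁻ H, ((E' H).bind fun a => (D a).run H) true ∂(randomOracle κ₁ κ₂) + δ)
    (h₂ : ∫⁻ H, ((E' H).bind fun a => (D a).run H) true ∂(randomOracle κ₁ κ₂) ≤
      ∫⁻ H, ((E H).bind fun a => (D a).run H) true ∂(randomOracle κ₁ κ₂) + δ) :
    |acceptProb E D - acceptProb E' D| ≤ δ.toReal := by
  have fin : ∀ F : Oracle κ₁ κ₂ → PMF Bool, ∫⁻ H, F H true ∂(randomOracle κ₁ κ₂) ≠ ⊤ := by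
    intro F
    refine ne_top_of_le_ne_top ENNReal.one_ne_top ?_
    calc ∫⁻ H, F H true ∂(randomOracle κ₁ κ₂) ≤ ∫⁻ _, 1 ∂(randomOracle κ₁ κ₂) :=
          lintegral_mono fun H => PMF.coe_le_one _ _
      _ = 1 := by simp
  unfold acceptProb
  rw [abs_sub_le_iff]
  constructor
  · rw [sub_le_iff_le_add', ← ENNReal.toReal_add (fin _) hδ]
    exact ENNReal.toReal_mono (ENNReal.add_ne_top.2 ⟨fin _, hδ⟩) h₁
  · rw [sub_le_iff_le_add', ← ENNReal.toReal_add (fin _) hδ]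
    exact ENNReal.toReal_mono (ENNReal.add_ne_top.2 ⟨fin _, hδ⟩) h₂

/-- Outside the bad event the summands agree, and on it a probability is at most 1. -/
theorem bind_apply_le (p : PMF α) {F G : α → PMF β} {bad : Set α} (h : ∀ a ∉ bad, F a = G a)
    (b : β) : (p.bind F) b ≤ (p.bind G) b + ∑' a, p a * bad.indicator 1 a := by
  rw [PMF.bind_apply, PMF.bind_apply, ← ENNReal.tsum_add]
  refine ENNReal.tsum_le_tsum fun a => ?_
  rw [← mul_add]
  gcongr
  by_cases ha : a ∈ bad
  · rw [Set.indicator_of_mem ha]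
    exact (PMF.coe_le_one _ _).trans le_add_self
  · rw [h a ha]
    exact le_self_add

/-- The bound for the collision probability. -/
noncomputable def collisionBound (κ₂ N : ℕ) : ℝ≥0∞ := (N : ℝ≥0∞) ^ 2 * ((2 : ℝ≥0∞) ^ κ₂)⁻¹

theorem collisionBound_ne_top (κ₂ N : ℕ) : collisionBound κ₂ N ≠ ⊤ := by
  unfold collisionBound
  exact ENNReal.mul_ne_top (by simp) (by simp)

theorem lintegral_collision_le (S : Finset (List Bool)) :
    ∫⁻ H, ∑' r, unif (Str κ₁) r * Set.indicator
      {r | ¬ Set.InjOn (fun x => H (r, x)) ↑S} 1 r ∂(randomOracle κ₁ κ₂) ≤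
        collisionBound κ₂ S.card := by
  have e : ∀ (r : Str κ₁), (fun H : Oracle κ₁ κ₂ => Set.indicator
      {r | ¬ Set.InjOn (fun x => H (r, x)) ↑S} (1 : Str κ₁ → ℝ≥0∞) r) =
      Set.indicator {H | ¬ Set.InjOn (fun x => H (r, x)) ↑S} 1 := by
    intro r
    funext H
    simp [Set.indicator_apply]
  have hm : ∀ (r : Str κ₁), Measurable (fun H : Oracle κ₁ κ₂ => Set.indicator
      {r | ¬ Set.InjOn (fun x => H (r, x)) ↑S} (1 : Str κ₁ → ℝ≥0∞) r) := fun r => by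
    rw [e]
    exact measurable_one.indicator (measurableSet_collision r S)
  rw [lintegral_tsum fun r => ((hm r).const_mul _).aemeasurable]
  calc ∑' r, ∫⁻ H, unif (Str κ₁) r * Set.indicator
        {r | ¬ Set.InjOn (fun x => H (r, x)) ↑S} 1 r ∂(randomOracle κ₁ κ₂)
      ≤ ∑' r, unif (Str κ₁) r * collisionBound κ₂ S.card := by
        refine ENNReal.tsum_le_tsum fun r => ?_
        rw [lintegral_const_mul _ (hm r), e, lintegral_indicator_one (measurableSet_collision r S)]
        gcongr
        exact measure_collision_le r S
    _ = collisionBound κ₂ S.card := by rw [ENNReal.tsum_mul_right, PMF.tsum_coe, one_mul]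

theorem measurable_collision (S : Finset (List Bool)) :
    Measurable fun H : Oracle κ₁ κ₂ => ∑' r, unif (Str κ₁) r * Set.indicator
      {r | ¬ Set.InjOn (fun x => H (r, x)) ↑S} 1 r := by
  refine Measurable.tsum fun r => Measurable.const_mul ?_ _
  have : (fun H : Oracle κ₁ κ₂ => Set.indicator
      {r | ¬ Set.InjOn (fun x => H (r, x)) ↑S} (1 : Str κ₁ → ℝ≥0∞) r) =
      Set.indicator {H | ¬ Set.InjOn (fun x => H (r, x)) ↑S} 1 := by
    funext H
    simp [Set.indicator_apply]
  rw [this]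
  exact measurable_one.indicator (measurableSet_collision r S)

/-- Experiments that agree unless hash values collide. -/
theorem indist_of_collision {q : ℕ} (S : Finset (List Bool)) {E E' : Oracle κ₁ κ₂ → PMF α}
    (F F' : Oracle κ₁ κ₂ → Str κ₁ → PMF α) (hE : ∀ H, E H = (unif (Str κ₁)).bind (F H))
    (hE' : ∀ H, E' H = (unif (Str κ₁)).bind (F' H))
    (h : ∀ H r, Set.InjOn (fun x => H (r, x)) ↑S → F H r = F' H r) :
    Indist q (collisionBound κ₂ S.card).toReal E E' := by
  intro D _
  have key : ∀ (F F' : Oracle κ₁ κ₂ → Str κ₁ → PMF α),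
      (∀ H r, Set.InjOn (fun x => H (r, x)) ↑S → F H r = F' H r) →
      ∫⁻ H, (((unif (Str κ₁)).bind (F H)).bind fun a => (D a).run H) true ∂(randomOracle κ₁ κ₂) ≤
      ∫⁻ H, (((unif (Str κ₁)).bind (F' H)).bind fun a => (D a).run H) true
        ∂(randomOracle κ₁ κ₂) + collisionBound κ₂ S.card := by
    intro F F' h
    refine le_trans ?_ (add_le_add_right (lintegral_collision_le (κ₁ := κ₁) S) _)
    rw [← lintegral_add_right _ (measurable_collision S)]
    refine lintegral_mono fun H => ?_
    rw [PMF.bind_bind, PMF.bind_bind]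
    refine bind_apply_le _ (fun r hr => ?_) _
    rw [h H r (not_not.1 hr)]
  refine acceptProb_sub_le (collisionBound_ne_top _ _) ?_ ?_
  · simp only [hE, hE']
    exact key F F' h
  · simp only [hE, hE']
    exact key F' F fun H r hr => (h H r hr).symm

end Advantage

/-! ## The data owners -/

section Owners

variable {κ κ₁ κ₂ l₁ l₂ : ℕ} {D₁ : Dataset l₁} {D₂ : Dataset l₂}

theorem mem_support_idealPSA {o : Outputs l₁ l₂} (h : o ∈ (idealPSA D₁ D₂).support) :
    o.out₁.length = (joinRows D₁ D₂).length ∧ o.out₂.length = (joinRows D₁ D₂).length ∧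
      o.outS = ((D₁.ids ∩ D₂.ids).card, D₁.size, D₂.size) := by
  have e := idealPSA_bind (D₁ := D₁) (D₂ := D₂) (joinRows D₁ D₂).get (by rw [List.ofFn_get])
    PMF.pure
  rw [PMF.bind_pure] at e
  rw [e, PMF.mem_support_bind_iff] at h
  obtain ⟨τ, _, h⟩ := h
  rw [PMF.mem_support_bind_iff] at h
  obtain ⟨s, _, h⟩ := h
  rw [PMF.mem_support_pure_iff] at h
  subst h
  simp

/-- The view contains the key, so nothing is hidden by the oracle: collisions are the only
discrepancy, and the number of queries `q` plays no role in the bound. -/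
theorem indist_owner₁ (q : ℕ) : Indist q (collisionBound κ₂ (D₁.ids ∪ D₂.ids).card).toReal
    (real₁ κ₁ κ₂ D₁ D₂) (ideal₁ κ κ₁ κ₂ D₁ D₂ (partyCmd false).toPPT) := by
  refine indist_of_collision (D₁.ids ∪ D₂.ids)
    (fun H r => (executeWith D₁ D₂ r fun x => H (r, x)).map fun e => (e.view₁ D₁, e.outputs)) _
    (fun H => by rw [real₁, execute_eq, PMF.map_bind]) (fun H => ?_)
    fun H r hr => executeWith_view₁ r hr
  rw [ideal₁]
  refine Eq.trans (bind_congr_support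
    (g := fun o => (unif (Str κ₁)).bind fun r => (unif (Equiv.Perm (Fin D₁.size))).bind fun σ =>
      (partyKeyLaw (encStr r) (permList σ) l₁ D₁.size o.out₁.length (encDataset D₁)
        (fun k => (o.out₁.map fun p => encStr p.1).getD k [])
        fun k => (o.out₁.map fun p => encStr p.2).getD k []).map (·, o)) fun o ho => ?_) ?_
  · rw [party₁_output κ κ₁ κ₂ D₁ o.out₁
      ((mem_support_idealPSA ho).1.trans_le (length_joinRows_le₁ D₁ D₂)), partyLaw_eq]
    simp only [PMF.map_bind]
  · rw [PMF.bind_comm]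
    exact congrArg _ (funext fun r => PMF.bind_comm _ _ _)

theorem indist_owner₂ (q : ℕ) : Indist q (collisionBound κ₂ (D₁.ids ∪ D₂.ids).card).toReal
    (real₂ κ₁ κ₂ D₁ D₂) (ideal₂ κ κ₁ κ₂ D₁ D₂ (partyCmd true).toPPT) := by
  refine indist_of_collision (D₁.ids ∪ D₂.ids)
    (fun H r => (executeWith D₁ D₂ r fun x => H (r, x)).map fun e => (e.view₂ D₂, e.outputs)) _
    (fun H => by rw [real₂, execute_eq, PMF.map_bind]) (fun H => ?_)
    fun H r hr => executeWith_view₂ r hr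
  rw [ideal₂]
  refine Eq.trans (bind_congr_support
    (g := fun o => (unif (Str κ₁)).bind fun r => (unif (Equiv.Perm (Fin D₂.size))).bind fun σ =>
      (partyKeyLaw (encStr r) (permList σ) l₂ D₂.size o.out₂.length (encDataset D₂)
        (fun k => (o.out₂.map fun p => encStr p.2).getD k [])
        fun k => (o.out₂.map fun p => encStr p.1).getD k []).map (·, o)) fun o ho => ?_) ?_
  · rw [party₂_output κ κ₁ κ₂ D₂ o.out₂
      ((mem_support_idealPSA ho).2.1.trans_le (length_joinRows_le₂ D₁ D₂)), partyLaw_eq]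
    simp only [PMF.map_bind]
  · rw [PMF.bind_comm]
    exact congrArg _ (funext fun r => PMF.bind_comm _ _ _)

end Owners

/-! ### Indistinguishability for the server, and the final bound. -/

/-! ## The view of the server -/

section Lists

theorem encVec_encStr {n l : ℕ} (x : Fin n → Str l) :
    encVec encStr x = n :: (List.ofFn fun i => encStr (x i)).flatten := by
  rw [encVec, encList, List.length_ofFn, List.flatMap_def, List.map_ofFn]
  rfl

theorem encVec_encFin_perm {n : ℕ} (σ : Equiv.Perm (Fin n)) :
    encVec encFin σ = n :: permList σ := by
  rw [encVec, encList, List.length_ofFn, flatMap_encFin, List.map_ofFn]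
  rfl

theorem encList_permList {n : ℕ} (σ : Equiv.Perm (Fin n)) :
    encList (fun i => [i]) (List.ofFn fun i => (σ i : ℕ)) = n :: permList σ := by
  rw [encList, List.length_ofFn, ← List.map_eq_flatMap, List.map_id']
  rfl

theorem getD_flatten {k : ℕ} : ∀ L : List (List ℕ), (∀ a ∈ L, a.length = k) → ∀ i < L.length,
    ∀ t < k, L.flatten.getD (i * k + t) 0 = (L.getD i []).getD t 0
  | [], _, i, hi, _, _ => absurd hi (Nat.not_lt_zero i)
  | a :: L, h, 0, _, t, ht => by
    have ha := h a List.mem_cons_self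
    rw [List.flatten_cons, zero_mul, zero_add, List.getD_append _ _ _ _ (by omega)]
    rfl
  | a :: L, h, i + 1, hi, t, ht => by
    have ha := h a List.mem_cons_self
    rw [List.flatten_cons, List.getD_append_right _ _ _ _ (by rw [ha, add_mul]; omega), ha,
      show (i + 1) * k + t - k = i * k + t by rw [add_mul, one_mul]; omega,
      getD_flatten L (fun b hb => h b (List.mem_cons_of_mem _ hb)) i (by simpa using hi) t ht]
    rfl

theorem chunk_flatten {n k : ℕ} (x : Fin n → Str k) (i : Fin n) :
    chunk k (List.ofFn fun i => encStr (x i)).flatten i = encStr (x i) := by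
  unfold chunk
  refine List.ext_getElem (by simp) fun t h₁ h₂ => ?_
  have ht : t < k := by simpa using h₁
  rw [List.getElem_map, List.getElem_range, getD_flatten _ (fun a ha => ?_) _ (by simp) _ ht]
  · have e : (List.ofFn fun i => encStr (x i)).getD i [] = encStr (x i) := by
      rw [List.getD_eq_getElem _ _ (by simp)]
      simp
    rw [e, List.getD_eq_getElem _ _ h₂]
  · obtain ⟨j, rfl⟩ := List.mem_ofFn.1 ha
    simp

end Lists

theorem seqLaw_bitsLaw (n l : ℕ) : (seqLaw n fun _ => bitsLaw l) =
    (unif (Fin n → Str l)).map fun x => (List.ofFn fun i => encStr (x i)).flatten := by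
  rw [unif_pi_flatten n fun _ s => encStr s, unif_str_map]

/-- The messages received in a switching network are uniform. -/
theorem switchingLaw_eq {N l : ℕ} (u : Fin N → Str l) :
    ((unif (Wires N l)).bind fun W => (unif (Equiv.Perm (Fin N))).map fun ρ : Equiv.Perm (Fin N) =>
      encVec encFin ρ ++ encVec encStr (maskedInput W u) ++ encVec encPair (otOutputs W ρ)) =
      switchingLaw N l := by
  unfold switchingLaw
  simp only [map_eq_bind]
  rw [PMF.bind_comm, permLaw, PMF.bind_map]
  refine congrArg _ (funext fun ρ => ?_)
  -- Change of variables from wire labels to messages, for fixed `ρ`: the messages are then encoded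
  -- exactly like uniform wire labels.
  have h := congrArg (fun p => PMF.bind p fun W : Wires N l => PMF.pure (encVec encFin ρ ++ encWires W))
    (unif_map_of_bijective (messages_bijective u ρ))
  rw [PMF.bind_map] at h
  have h₁ : ((unif (Wires N l)).bind fun W => PMF.pure (encVec encFin ρ ++
      encVec encStr (maskedInput W u) ++ encVec encPair (otOutputs W ρ))) =
      (unif (Wires N l)).bind fun W : Wires N l => PMF.pure (encVec encFin ρ ++ encWires W) := by
    rw [← h]
    simp only [Function.comp_def, encWires, List.append_assoc]
  rw [h₁, unif_wires_bind, unif_pi_append_bind]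
  simp only [encWires_labelsOf_append, encVec_encFin_perm, seqLaw_bitsLaw, PMF.bind_map,
    Function.comp_def]
  simp only [List.append_assoc, List.cons_append]

/-- The last part of the view of the server, after the hash vectors. -/
noncomputable def serverTail (l₁ l₂ c c' n m : ℕ) (a b : List ℕ) :
    PMF (List ℕ × (ℕ × ℕ × ℕ)) :=
  (permLaw c).bind fun τ => (switchingLaw n l₁).bind fun o₁ => (switchingLaw m l₂).map fun o₂ =>
    (n :: a ++ m :: b ++ c :: τ ++ o₁ ++ o₂, (c', n, m))

section Server

variable {κ₁ κ₂ l₁ l₂ : ℕ} (D₁ : Dataset l₁) (D₂ : Dataset l₂)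

/-- The view of the server when the hash function is `h`. -/
noncomputable def serverView (h : List Bool → Str κ₂) : PMF (List ℕ × (ℕ × ℕ × ℕ)) :=
  (unif (Equiv.Perm (Fin D₁.size))).bind fun σ₁ => (unif (Equiv.Perm (Fin D₂.size))).bind fun σ₂ =>
    serverTail l₁ l₂ (matchPairs (fun i => h (D₁.id (σ₁ i))) fun j => h (D₂.id (σ₂ j))).length
      (Finset.univ.image (fun i => h (D₁.id (σ₁ i))) ∩
        Finset.univ.image fun j => h (D₂.id (σ₂ j))).card D₁.size D₂.size
      (List.ofFn fun i => encStr (h (D₁.id (σ₁ i)))).flatten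
      (List.ofFn fun j => encStr (h (D₂.id (σ₂ j)))).flatten

variable {D₁ D₂}

theorem executeTail_viewS {c : ℕ} {r : Str κ₁} {σ₁ : Equiv.Perm (Fin D₁.size)}
    {σ₂ : Equiv.Perm (Fin D₂.size)} {x : Fin D₁.size → Str κ₂} {y : Fin D₂.size → Str κ₂}
    {τ : Equiv.Perm (Fin c)} {a : Fin c → Fin D₁.size} {b : Fin c → Fin D₂.size} :
    (executeTail D₁ D₂ r σ₁ σ₂ x y τ a b).map (fun e => (e.viewS, e.outputs.outS)) =
      (switchingLaw D₁.size l₁).bind fun o₁ => (switchingLaw D₂.size l₂).map fun o₂ =>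
        (encVec encStr x ++ encVec encStr y ++ c :: permList τ ++ o₁ ++ o₂,
          ((Finset.univ.image x ∩ Finset.univ.image y).card, D₁.size, D₂.size)) := by
  rw [← switchingLaw_eq fun i => D₁.attr (σ₁ i), ← switchingLaw_eq fun j => D₂.attr (σ₂ j)]
  unfold executeTail
  simp only [map_eq_bind, PMF.bind_bind, PMF.pure_bind]
  refine congrArg _ (funext fun W₁ => congrArg _ (funext fun ρ₁ => congrArg _ (funext fun W₂ =>
      congrArg _ (funext fun ρ₂ => congrArg _ ?_))))
  simp only [Execution.viewS, Execution.outputs, encList_permList, List.append_assoc]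

/-- Collisions need not be excluded here: received messages are uniform for any programming of the
network, and the key matters only through `h`. -/
theorem executeWith_viewS (r : Str κ₁) (h : List Bool → Str κ₂) :
    (executeWith D₁ D₂ r h).map (fun e => (e.viewS, e.outputs.outS)) = serverView D₁ D₂ h := by
  unfold executeWith serverView serverTail
  simp only [PMF.map_bind, executeTail_viewS, permLaw, PMF.bind_map, Function.comp_def,
    encVec_encStr]

/-- Only finitely many hash values enter, which allows resampling them as an element of a finite
type. -/
theorem serverView_congr {h h' : List Bool → Str κ₂} (e : ∀ x ∈ D₁.ids ∪ D₂.ids, h x = h' x) :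
    serverView D₁ D₂ h = serverView D₁ D₂ h' := by
  have e₁ : ∀ i, h (D₁.id i) = h' (D₁.id i) := fun i =>
    e _ (Finset.mem_union_left _ (id_mem_ids _ _))
  have e₂ : ∀ i, h (D₂.id i) = h' (D₂.id i) := fun i =>
    e _ (Finset.mem_union_right _ (id_mem_ids _ _))
  unfold serverView
  simp only [e₁, e₂]

end Server

/-! ### The law of the hash vectors -/

theorem unif_comp_injective_bind {ι κ A γ : Type} [Fintype ι] [DecidableEq ι] [Fintype κ]
    [DecidableEq κ] [Fintype A] [Nonempty A] {q : κ → ι} (hq : Function.Injective q)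
    (f : (κ → A) → PMF γ) :
    ((unif (ι → A)).bind fun y => f fun k => y (q k)) = (unif (κ → A)).bind f := by
  have h := unif_bind_extend (A := A) hq fun _ s => f s
  simp only [PMF.bind_const] at h
  exact h.symm

theorem unif_sum_bind {ι κ A γ : Type} [Fintype ι] [DecidableEq ι] [Fintype κ] [DecidableEq κ]
    [Fintype A] [Nonempty A] (f : (ι → A) → (κ → A) → PMF γ) :
    ((unif (ι ⊕ κ → A)).bind fun y => f (fun i => y (.inl i)) fun k => y (.inr k)) =
      (unif (ι → A)).bind fun x => (unif (κ → A)).bind fun y => f x y := by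
  rw [unif_bind_equiv (Equiv.sumArrowEquivProdArrow ι κ A).symm, unif_prod_bind]
  rfl

theorem unif_comp_equiv_bind {ι A γ : Type} [Fintype ι] [DecidableEq ι] [Fintype A] [Nonempty A]
    (e : Equiv.Perm ι) (f : (ι → A) → PMF γ) :
    ((unif (ι → A)).bind fun x => f fun i => x (e i)) = (unif (ι → A)).bind f :=
  unif_comp_injective_bind e.injective f

/-- For uniform values at the elements of `S`, the vectors of values at the shuffled identifiers:
one is uniform, and the other one has common values at random positions. -/
theorem shuffled_values_bind {A γ : Type} [Fintype A] [Nonempty A] {l₁ l₂ : ℕ} {D₁ : Dataset l₁}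
    {D₂ : Dataset l₂} {S : Finset (List Bool)} (h₁ : ∀ i, D₁.id i ∈ S) (h₂ : ∀ j, D₂.id j ∈ S)
    (hc : (joinPairs D₁ D₂).length ≤ D₁.size) (T : (Fin D₁.size → A) → (Fin D₂.size → A) → PMF γ) :
    ((unif (S → A)).bind fun z => (unif (Equiv.Perm (Fin D₁.size))).bind fun σ₁ =>
      (unif (Equiv.Perm (Fin D₂.size))).bind fun σ₂ =>
        T (fun i => z ⟨_, h₁ (σ₁ i)⟩) fun j => z ⟨_, h₂ (σ₂ j)⟩) =
    (unif (Equiv.Perm (Fin D₁.size))).bind fun σ₁ =>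
      (unif (Equiv.Perm (Fin D₂.size))).bind fun σ₂ => (unif (Fin D₁.size → A)).bind fun x =>
        (unif (Fin D₂.size → A)).bind fun w => T x fun j =>
          if h : (σ₂ j : ℕ) < (joinPairs D₁ D₂).length then x (σ₁ (Fin.castLE hc ⟨σ₂ j, h⟩))
          else w j := by
  have mem := mem_joinPairs D₁ D₂
  have i₁ := get_fst_injective (nodup_joinPairs D₁ D₂) fun p hp q hq e =>
    D₂.id_injective (by rw [← (mem p).1 hp, ← (mem q).1 hq, e])
  have i₂ := get_snd_injective (nodup_joinPairs D₁ D₂) fun p hp q hq e =>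
    D₁.id_injective (by rw [(mem p).1 hp, (mem q).1 hq, e])
  have sub : ∀ i j, D₁.id i = D₂.id j → ∃ k, (joinPairs D₁ D₂).get k = (i, j) := fun i j e =>
    List.mem_iff_get.1 ((mem (i, j)).2 e)
  have hget : ∀ k, D₁.id ((joinPairs D₁ D₂).get k).1 = D₂.id ((joinPairs D₁ D₂).get k).2 :=
    fun k => (mem _).1 (List.get_mem _ _)
  generalize joinPairs D₁ D₂ = L at *
  have hc₂ : L.length ≤ D₂.size := by
    have := Fintype.card_le_of_injective _ i₂
    simpa using this
  -- The permutations `e₁` and `e₂` arrange the positions so that the matched pairs come at the same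
  -- indices `k < L.length` on both sides.
  obtain ⟨e₁, he₁⟩ := Equiv.Perm.exists_extending_pair (Fin.castLE hc) _
    (Fin.castLE_injective hc) i₁
  obtain ⟨e₂, he₂⟩ := Equiv.Perm.exists_extending_pair (Fin.castLE hc₂) _
    (Fin.castLE_injective hc₂) i₂
  -- The substitutions are `σ₁ = e₁ * s⁻¹` and, below, `σ₂ = e₂ * t`; the inverse makes `s` name the
  -- position of a partner instead of the identifier at a position.
  rw [PMF.bind_comm, unif_bind_equiv ((Equiv.inv (Equiv.Perm (Fin D₁.size))).trans
    (Equiv.mulLeft e₁))]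
  refine congrArg _ (funext fun s => ?_)
  rw [PMF.bind_comm, unif_bind_equiv (Equiv.mulLeft e₂)]
  refine congrArg _ (funext fun t => ?_)
  simp only [Equiv.trans_apply, Equiv.inv_apply, Equiv.coe_mulLeft, Equiv.Perm.mul_apply]
  -- All identifiers of the first dataset and the unmatched ones of the second are distinct, so
  -- their values are independent and uniform; matched values of the second are copies.
  set q : Fin D₁.size ⊕ {k : Fin D₂.size // L.length ≤ k} → S :=
    Sum.elim (fun i => ⟨_, h₁ (e₁ i)⟩) fun k => ⟨_, h₂ (e₂ k)⟩ with hq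
  have hne : ∀ i (k : {k : Fin D₂.size // L.length ≤ k}), D₁.id (e₁ i) ≠ D₂.id (e₂ k) := by
    intro i k e
    obtain ⟨k', hk'⟩ := sub _ _ e
    have := he₂ k'
    rw [hk'] at this
    have := e₂.injective this
    have h := k.2
    rw [← this] at h
    exact absurd k'.2 (not_lt.2 h)
  have q_inj : Function.Injective q := by
    rintro (i | k) (i' | k') e
    · exact congrArg _ (e₁.injective (D₁.id_injective (congrArg Subtype.val e)))
    · exact absurd (congrArg Subtype.val e) (hne _ _)
    · exact absurd (congrArg Subtype.val e).symm (hne _ _)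
    · exact congrArg _ (Subtype.ext (e₂.injective (D₂.id_injective (congrArg Subtype.val e))))
  set G : (Fin D₁.size ⊕ {k : Fin D₂.size // L.length ≤ k} → A) → PMF γ := fun v =>
    T (fun i => v (.inl (s⁻¹ i))) fun j => if h : (t j : ℕ) < L.length then
      v (.inl (Fin.castLE hc ⟨t j, h⟩)) else v (.inr ⟨t j, not_lt.1 h⟩) with hG
  have left : ∀ z : S → A, T (fun i => z ⟨_, h₁ (e₁ (s⁻¹ i))⟩) (fun j => z ⟨_, h₂ (e₂ (t j))⟩) =
      G fun k => z (q k) := by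
    intro z
    simp only [hG, hq, Sum.elim_inl, Sum.elim_inr]
    refine congrArg _ (funext fun j => ?_)
    split_ifs with h
    · congr 1
      refine Subtype.ext ?_
      have := hget ⟨t j, h⟩
      rw [← he₁, ← he₂] at this
      exact this.symm
    · rfl
  refine Eq.trans (congrArg _ (funext left)) ((unif_comp_injective_bind q_inj G).trans ?_)
  -- Dummy values at the matched indices are added, so that the second family is indexed by all of
  -- `Fin D₂.size`, as in the simulator; they are never read.
  have emb : Function.Injective (Sum.map id Subtype.val :
      Fin D₁.size ⊕ {k : Fin D₂.size // L.length ≤ k} → Fin D₁.size ⊕ Fin D₂.size) :=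
    Function.Injective.sumMap Function.injective_id Subtype.val_injective
  rw [← unif_comp_injective_bind emb G]
  simp only [hG, Sum.map_inl, Sum.map_inr, id]
  rw [unif_sum_bind fun x w => T (fun i => x (s⁻¹ i)) fun j =>
    if h : (t j : ℕ) < L.length then x (Fin.castLE hc ⟨t j, h⟩) else w (t j)]
  rw [← unif_comp_equiv_bind s⁻¹ fun x => (unif (Fin D₂.size → A)).bind fun w => T x fun j =>
          if h : (t j : ℕ) < L.length then x (s (Fin.castLE hc ⟨t j, h⟩)) else w j]
  refine congrArg _ (funext fun x => ?_)
  rw [← unif_comp_equiv_bind t fun w => T (fun i => x (s⁻¹ i)) fun j =>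
          if h : (t j : ℕ) < L.length then x (s⁻¹ (s (Fin.castLE hc ⟨t j, h⟩))) else w j]
  simp only [Equiv.Perm.inv_def, Equiv.symm_apply_apply]

/-- The law of the hash vectors, and of the rest, in the simulation for the server. -/
theorem serverLaw_map (κ₂ l₁ l₂ n m : ℕ) {c : ℕ} (hc : c ≤ n) :
    (serverLaw κ₂ l₁ l₂ c n m).map (·, (c, n, m)) =
      (unif (Equiv.Perm (Fin n))).bind fun σ₁ => (unif (Equiv.Perm (Fin m))).bind fun σ₂ =>
      (unif (Fin n → Str κ₂)).bind fun x => (unif (Fin m → Str κ₂)).bind fun w =>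
        serverTail l₁ l₂ c c n m (List.ofFn fun i => encStr (x i)).flatten
          (List.ofFn fun j => encStr (if h : (σ₂ j : ℕ) < c then x (σ₁ (Fin.castLE hc ⟨σ₂ j, h⟩))
            else w j)).flatten := by
  unfold serverLaw
  simp only [permLaw, PMF.map_bind, PMF.bind_map, Function.comp_def]
  refine congrArg _ (funext fun σ₁ => congrArg _ (funext fun σ₂ => ?_))
  rw [seqLaw_bitsLaw, PMF.bind_map]
  refine congrArg _ (funext fun x => ?_)
  set F : ℕ → Str κ₂ → List ℕ := fun j w => if hj : j < m then
    encStr (if h : (σ₂ ⟨j, hj⟩ : ℕ) < c then x (σ₁ (Fin.castLE hc ⟨σ₂ ⟨j, hj⟩, h⟩)) else w)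
    else [] with hF
  have e : (seqLaw m fun j => fixedOr κ₂ (if (permList σ₂).getD j 0 < c then
      some (chunk κ₂ (List.ofFn fun i => encStr (x i)).flatten
        ((permList σ₁).getD ((permList σ₂).getD j 0) 0)) else none)) =
      seqLaw m fun j => (unif (Str κ₂)).map (F j) := by
    refine seqLaw_congr fun j hj => ?_
    rw [permList_getD σ₂ hj]
    simp only [hF, dif_pos hj]
    split_ifs with h
    · have e' : ((permList σ₁).getD (σ₂ ⟨j, hj⟩ : ℕ) 0) = σ₁ (Fin.castLE hc ⟨σ₂ ⟨j, hj⟩, h⟩) :=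
        permList_getD σ₁ (by omega)
      rw [e', chunk_flatten]
      exact (PMF.map_const _ _).symm
    · exact (unif_str_map κ₂).symm
  simp only [Function.comp_def]
  rw [e, ← unif_pi_flatten, PMF.bind_map]
  refine congrArg _ (funext fun w => ?_)
  simp only [hF, Fin.is_lt, dif_pos, Fin.eta, serverTail, permLaw, PMF.bind_map, Function.comp_def,
    PMF.map_comp]

/-! ## A fresh key hides the hash values -/

section FreshKey

variable {κ₁ κ₂ : ℕ} {α : Type} [Countable α] {S : Finset (List Bool)}

theorem measurable_values (r : Str κ₁) {β : Type} [MeasurableSpace β] (f : (S → Str κ₂) → β) :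
    Measurable fun H : Oracle κ₁ κ₂ => f fun x => H (r, x) :=
  (measurable_of_countable f).comp (measurable_pi_lambda _ fun _ => measurable_pi_apply _)

theorem lintegral_values (r : Str κ₁) (f : (S → Str κ₂) → ℝ≥0∞) :
    ∫⁻ H, f (fun x => H (r, x)) ∂(randomOracle κ₁ κ₂) = ∑' z, unif (S → Str κ₂) z * f z :=
  lintegral_oracle_comp (q := fun x : S => (r, (x : List Bool)))
    (fun _ _ e => Subtype.ext (Prod.ext_iff.1 e).2) f

theorem lintegral_unif_bind {ι β : Type} [Fintype ι] [Nonempty ι] {F : ι → Oracle κ₁ κ₂ → PMF β}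
    {b : β} (hF : ∀ i, Measurable fun H => F i H b) :
    ∫⁻ H, ((unif ι).bind fun i => F i H) b ∂(randomOracle κ₁ κ₂) =
      ∑' i, unif ι i * ∫⁻ H, F i H b ∂(randomOracle κ₁ κ₂) := by
  simp only [PMF.bind_apply]
  rw [lintegral_tsum fun i => ((hF i).const_mul _).aemeasurable]
  exact tsum_congr fun i => lintegral_const_mul _ (hF i)

variable (V : (S → Str κ₂) → PMF α) (D : α → Strategy κ₁ κ₂)

/-- The values for key `r` are taken from an independent oracle `H'`. The sample then depends on
`H'` alone, and replacing the combined oracle by `H` is noticed by the distinguisher only if it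
queries with key `r`. -/
theorem resample_le (r : Str κ₁) :
    (∫⁻ H, ((V fun x => H (r, x)).bind fun a => (D a).run H) true ∂(randomOracle κ₁ κ₂) ≤
      ∑' z, unif (S → Str κ₂) z * ∫⁻ H, ((V z).bind fun a => (D a).run H) true
        ∂(randomOracle κ₁ κ₂) +
      ∑' z, unif (S → Str κ₂) z * ∫⁻ H, ((V z).bind fun a => ((D a).hits r).run H) true
        ∂(randomOracle κ₁ κ₂)) ∧
    (∑' z, unif (S → Str κ₂) z * ∫⁻ H, ((V z).bind fun a => (D a).run H) true
        ∂(randomOracle κ₁ κ₂) ≤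
      ∫⁻ H, ((V fun x => H (r, x)).bind fun a => (D a).run H) true ∂(randomOracle κ₁ κ₂) +
      ∑' z, unif (S → Str κ₂) z * ∫⁻ H, ((V z).bind fun a => ((D a).hits r).run H) true
        ∂(randomOracle κ₁ κ₂)) := by
  have const : ∀ z (D : α → Strategy κ₁ κ₂),
      Measurable fun H => ((V z).bind fun a => (D a).run H) true := fun z D =>
    measurable_bind_run (E := fun _ => V z) (fun _ => measurable_const) D
  have meas : Measurable fun H : Oracle κ₁ κ₂ =>
      ((V fun x => H (r, x)).bind fun a => (D a).run H) true :=
    measurable_bind_run (fun a => measurable_values r fun z => V z a) D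
  have ov : ∀ H H' : Oracle κ₁ κ₂, (fun x : S => overrideKey r (H, H') (r, x)) =
      fun x : S => H' (r, x) := fun H H' => funext fun x => if_pos rfl
  have agree : ∀ (H H' : Oracle κ₁ κ₂) q, q.1 ≠ r → H q = overrideKey r (H, H') q :=
    fun H H' q hq => (if_neg hq).symm
  have rest : Measurable fun H' : Oracle κ₁ κ₂ => ∫⁻ H, ((V fun x => H' (r, x)).bind fun a =>
      ((D a).hits r).run H) true ∂(randomOracle κ₁ κ₂) :=
    measurable_values r fun z => ∫⁻ H, ((V z).bind fun a => ((D a).hits r).run H) true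
      ∂(randomOracle κ₁ κ₂)
  rw [lintegral_overrideKey r meas]
  simp only [ov]
  rw [← lintegral_values r fun z => ∫⁻ H, ((V z).bind fun a => (D a).run H) true
    ∂(randomOracle κ₁ κ₂), ← lintegral_values r fun z =>
    ∫⁻ H, ((V z).bind fun a => ((D a).hits r).run H) true ∂(randomOracle κ₁ κ₂),
    ← lintegral_add_right _ rest, ← lintegral_add_right _ rest]
  constructor
  · refine lintegral_mono fun H' => ?_
    rw [← lintegral_add_left (const _ _)]
    refine lintegral_mono fun H => ?_
    simp only [PMF.bind_apply]
    rw [← ENNReal.tsum_add]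
    refine ENNReal.tsum_le_tsum fun a => ?_
    rw [← mul_add]
    gcongr
    exact (run_le_run_add_hits (agree H H') (D a)).2
  · refine lintegral_mono fun H' => ?_
    rw [← lintegral_add_right _ (const _ _)]
    refine lintegral_mono fun H => ?_
    simp only [PMF.bind_apply]
    rw [← ENNReal.tsum_add]
    refine ENNReal.tsum_le_tsum fun a => ?_
    rw [← mul_add]
    gcongr
    exact (run_le_run_add_hits (agree H H') (D a)).1

/-- In the resampled experiment neither sample nor oracle depends on the key, so summing over keys
first reduces the bound to `sum_hits_le`. -/
theorem hits_le {q : ℕ} (hD : ∀ a, (D a).QueriesAtMost q) :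
    ∑' r, unif (Str κ₁) r * ∑' z, unif (S → Str κ₂) z *
      ∫⁻ H, ((V z).bind fun a => ((D a).hits r).run H) true ∂(randomOracle κ₁ κ₂) ≤
        q * ((2 : ℝ≥0∞) ^ κ₁)⁻¹ := by
  have const : ∀ z (D : α → Strategy κ₁ κ₂),
      Measurable fun H => ((V z).bind fun a => (D a).run H) true := fun z D =>
    measurable_bind_run (E := fun _ => V z) (fun _ => measurable_const) D
  have hu : ∀ r, unif (Str κ₁) r = ((2 : ℝ≥0∞) ^ κ₁)⁻¹ := by
    intro r
    simp
  simp only [hu]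
  rw [ENNReal.tsum_mul_left, mul_comm, ENNReal.tsum_comm]
  gcongr
  simp only [ENNReal.tsum_mul_left]
  calc _ ≤ ∑' z, unif (S → Str κ₂) z * (q : ℝ≥0∞) := by
        refine ENNReal.tsum_le_tsum fun z => ?_
        gcongr
        rw [← lintegral_tsum fun r => (const z fun a => (D a).hits r).aemeasurable]
        calc _ ≤ ∫⁻ _, (q : ℝ≥0∞) ∂(randomOracle κ₁ κ₂) := by
              refine lintegral_mono fun H => ?_
              simp only [PMF.bind_apply]
              rw [ENNReal.tsum_comm]
              simp only [ENNReal.tsum_mul_left]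
              calc _ ≤ ∑' a, V z a * (q : ℝ≥0∞) := by
                    refine ENNReal.tsum_le_tsum fun a => ?_
                    gcongr
                    rw [tsum_fintype]
                    exact sum_hits_le H (D a) (hD a)
                _ = q := by rw [ENNReal.tsum_mul_right, PMF.tsum_coe, one_mul]
          _ = q := by simp
    _ = q := by rw [ENNReal.tsum_mul_right, PMF.tsum_coe, one_mul]

/-- The hash values for a uniform key may be replaced by independent ones. -/
theorem fresh_key_le {q : ℕ} (hD : ∀ a, (D a).QueriesAtMost q) :
    (∫⁻ H, (((unif (Str κ₁)).bind fun r => V fun x => H (r, x)).bind fun a => (D a).run H) true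
        ∂(randomOracle κ₁ κ₂) ≤
      ∫⁻ H, (((unif (S → Str κ₂)).bind V).bind fun a => (D a).run H) true ∂(randomOracle κ₁ κ₂) +
        q * ((2 : ℝ≥0∞) ^ κ₁)⁻¹) ∧
    (∫⁻ H, (((unif (S → Str κ₂)).bind V).bind fun a => (D a).run H) true ∂(randomOracle κ₁ κ₂) ≤
      ∫⁻ H, (((unif (Str κ₁)).bind fun r => V fun x => H (r, x)).bind fun a => (D a).run H) true
        ∂(randomOracle κ₁ κ₂) + q * ((2 : ℝ≥0∞) ^ κ₁)⁻¹) := by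
  simp only [PMF.bind_bind]
  rw [lintegral_unif_bind fun r => measurable_bind_run (fun a => measurable_values r fun z => V z a) D,
    lintegral_unif_bind fun z => measurable_bind_run (E := fun _ => V z)
      (fun _ => measurable_const) D]
  set M := ∑' z, unif (S → Str κ₂) z * ∫⁻ H, ((V z).bind fun a => (D a).run H) true
        ∂(randomOracle κ₁ κ₂) with hM
  -- `M` does not involve the key; writing it as an average over keys allows a comparison key by
  -- key.
  have hM' : M = ∑' r, unif (Str κ₁) r * M := by
    rw [ENNReal.tsum_mul_right, PMF.tsum_coe, one_mul]
  constructor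
  · refine le_trans ?_ (add_le_add_right (hits_le V D hD) _)
    conv_rhs => rw [hM']
    rw [← ENNReal.tsum_add]
    refine ENNReal.tsum_le_tsum fun r => ?_
    rw [← mul_add]
    gcongr
    exact (resample_le V D r).1
  · refine le_trans ?_ (add_le_add_right (hits_le V D hD) _)
    conv_lhs => rw [hM']
    rw [← ENNReal.tsum_add]
    refine ENNReal.tsum_le_tsum fun r => ?_
    rw [← mul_add]
    gcongr
    exact (resample_le V D r).2

end FreshKey

/-! ## The server -/

section Server

variable {κ κ₁ κ₂ l₁ l₂ : ℕ} {D₁ : Dataset l₁} {D₂ : Dataset l₂}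

/-- A hash function with the given values on a finite set. -/
def extendHash {κ₂ : ℕ} (S : Finset (List Bool)) (z : S → Str κ₂) (x : List Bool) : Str κ₂ :=
  if hx : x ∈ S then z ⟨x, hx⟩ else fun _ => false

theorem extendHash_restrict (S : Finset (List Bool)) (h : List Bool → Str κ₂) :
    ∀ x ∈ S, h x = extendHash S (fun x => h x) x := fun x hx => by
  rw [extendHash, dif_pos hx]

theorem serverView_of_injOn {h : List Bool → Str κ₂} (hh : Set.InjOn h ↑(D₁.ids ∪ D₂.ids)) :
    serverView D₁ D₂ h = (unif (Equiv.Perm (Fin D₁.size))).bind fun σ₁ =>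
      (unif (Equiv.Perm (Fin D₂.size))).bind fun σ₂ =>
        serverTail l₁ l₂ (D₁.ids ∩ D₂.ids).card (D₁.ids ∩ D₂.ids).card D₁.size D₂.size
          (List.ofFn fun i => encStr (h (D₁.id (σ₁ i)))).flatten
          (List.ofFn fun j => encStr (h (D₂.id (σ₂ j)))).flatten := by
  unfold serverView
  refine congrArg _ (funext fun σ₁ => congrArg _ (funext fun σ₂ => ?_))
  have := (matchPairs_perm hh σ₁ σ₂).length_eq
  rw [List.length_map, length_joinRows_eq_card] at this
  rw [this, card_image_inter hh]

/-- The simulated view is the view for independent uniform hash values in which both counts are set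
to `|X ∩ Y|`. It therefore agrees with `serverView` unless these values collide. -/
theorem idealS_eq (H : Oracle κ₁ κ₂) : idealS κ κ₁ κ₂ D₁ D₂ serverCmd.toPPT H =
    (unif (↥(D₁.ids ∪ D₂.ids) → Str κ₂)).bind fun z =>
      (unif (Equiv.Perm (Fin D₁.size))).bind fun σ₁ =>
      (unif (Equiv.Perm (Fin D₂.size))).bind fun σ₂ =>
        serverTail l₁ l₂ (D₁.ids ∩ D₂.ids).card (D₁.ids ∩ D₂.ids).card D₁.size D₂.size
          (List.ofFn fun i => encStr (extendHash _ z (D₁.id (σ₁ i)))).flatten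
          (List.ofFn fun j => encStr (extendHash _ z (D₂.id (σ₂ j)))).flatten := by
  have hl := length_joinRows D₁ D₂
  have hcard := length_joinRows_eq_card D₁ D₂
  have hc : (joinPairs D₁ D₂).length ≤ D₁.size := hl ▸ length_joinRows_le₁ D₁ D₂
  rw [← hcard, hl]
  have m₁ : ∀ i, D₁.id i ∈ D₁.ids ∪ D₂.ids := fun i => Finset.mem_union_left _ (id_mem_ids _ _)
  have m₂ : ∀ j, D₂.id j ∈ D₁.ids ∪ D₂.ids := fun j => Finset.mem_union_right _ (id_mem_ids _ _)
  simp only [extendHash, m₁, m₂, dif_pos]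
  rw [shuffled_values_bind m₁ m₂ hc fun x y => serverTail l₁ l₂ (joinPairs D₁ D₂).length
    (joinPairs D₁ D₂).length D₁.size D₂.size (List.ofFn fun i => encStr (x i)).flatten
          (List.ofFn fun j => encStr (y j)).flatten, ← serverLaw_map κ₂ l₁ l₂ D₁.size D₂.size hc]
  unfold idealS
  refine Eq.trans (bind_congr_support fun o ho => ?_) (PMF.bind_const (idealPSA D₁ D₂) _)
  rw [(mem_support_idealPSA ho).2.2, ← hcard, hl, serverCmd_output hc]

theorem realS_eq (H : Oracle κ₁ κ₂) : realS κ₁ κ₂ D₁ D₂ H = (unif (Str κ₁)).bind fun r =>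
    serverView D₁ D₂ (extendHash (D₁.ids ∪ D₂.ids) fun x => H (r, x)) := by
  rw [realS, execute_eq, PMF.map_bind]
  refine congrArg _ (funext fun r => ?_)
  rw [executeWith_viewS]
  exact serverView_congr (extendHash_restrict _ fun x => H (r, x))

/-- Independent values have the law of the oracle at any fixed key, so the collision bound carries
over; keys of length 0 are the simplest choice. -/
theorem unif_collision_le (S : Finset (List Bool)) :
    ∑' z, unif (S → Str κ₂) z * Set.indicator {z | ¬ Set.InjOn (extendHash S z) ↑S} 1 z ≤
      collisionBound κ₂ S.card := by
  rw [← lintegral_values (κ₁ := 0) (fun _ => false) fun z : S → Str κ₂ =>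
    Set.indicator {z | ¬ Set.InjOn (extendHash S z) ↑S} 1 z]
  refine le_trans (le_of_eq ?_) (measure_collision_le (κ₁ := 0) (fun _ => false) S)
  rw [← lintegral_indicator_one (measurableSet_collision _ S)]
  refine lintegral_congr fun H => ?_
  have : Set.InjOn (extendHash S fun x : S => H (fun _ => false, x)) ↑S ↔
      Set.InjOn (fun x => H (fun _ => false, x)) ↑S :=
    Set.EqOn.injOn_iff fun x hx =>
      (extendHash_restrict S (fun x => H (fun _ => false, x)) x hx).symm
  simp only [Set.indicator_apply, Set.mem_ofPred_eq, this, Pi.one_apply]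

/-- A hybrid argument through independent hash values: replacing the values for the secret key costs
`q / 2 ^ κ₁`, and ignoring collisions costs the collision bound. -/
theorem indist_server (q : ℕ) :
    Indist q (collisionBound κ₂ (D₁.ids ∪ D₂.ids).card + q * ((2 : ℝ≥0∞) ^ κ₁)⁻¹).toReal
      (realS κ₁ κ₂ D₁ D₂) (idealS κ κ₁ κ₂ D₁ D₂ serverCmd.toPPT) := by
  intro D hD
  have fresh := fresh_key_le (S := D₁.ids ∪ D₂.ids)
    (fun z => serverView D₁ D₂ (extendHash (D₁.ids ∪ D₂.ids) z)) D hD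
  have good := fun (z : ↥(D₁.ids ∪ D₂.ids) → Str κ₂)
    (hz : z ∉ {z | ¬ Set.InjOn (extendHash (D₁.ids ∪ D₂.ids) z) ↑(D₁.ids ∪ D₂.ids)}) =>
      serverView_of_injOn (D₁ := D₁) (D₂ := D₂) (not_not.1 hz)
  have coll := unif_collision_le (κ₂ := κ₂) (D₁.ids ∪ D₂.ids)
  have lift : ∀ {F G : (↥(D₁.ids ∪ D₂.ids) → Str κ₂) → PMF (List ℕ × (ℕ × ℕ × ℕ))},
      (∀ z ∉ {z | ¬ Set.InjOn (extendHash (D₁.ids ∪ D₂.ids) z) ↑(D₁.ids ∪ D₂.ids)}, F z = G z) →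
      ∫⁻ H, (((unif _).bind F).bind fun a => (D a).run H) true ∂(randomOracle κ₁ κ₂) ≤
      ∫⁻ H, (((unif _).bind G).bind fun a => (D a).run H) true ∂(randomOracle κ₁ κ₂) +
        collisionBound κ₂ (D₁.ids ∪ D₂.ids).card := by
    intro F G h
    calc _ ≤ ∫⁻ H, ((((unif _).bind G).bind fun a => (D a).run H) true +
            collisionBound κ₂ (D₁.ids ∪ D₂.ids).card) ∂(randomOracle κ₁ κ₂) := by
          refine lintegral_mono fun H => ?_
          rw [PMF.bind_bind, PMF.bind_bind]
          refine (bind_apply_le _ (fun z hz => ?_) _).trans (add_le_add_right coll _)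
          rw [h z hz]
      _ = _ := by rw [lintegral_add_right _ measurable_const]; simp
  refine acceptProb_sub_le (ENNReal.add_ne_top.2 ⟨collisionBound_ne_top _ _,
    ENNReal.mul_ne_top (by simp) (by simp)⟩) ?_ ?_
  · simp only [realS_eq, idealS_eq]
    refine fresh.1.trans ?_
    rw [← add_assoc]
    gcongr
    exact lift good
  · simp only [realS_eq, idealS_eq]
    refine (lift fun z hz => (good z hz).symm).trans ?_
    rw [add_comm (collisionBound _ _), ← add_assoc]
    gcongr
    exact fresh.2

end Server

/-- The bound for the advantage. -/
noncomputable def advantageBound (κ₁ κ₂ N q : ℕ) : ℝ :=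
  (N : ℝ) ^ 2 * ((2 : ℝ) ^ κ₂)⁻¹ + q * ((2 : ℝ) ^ κ₁)⁻¹

theorem negligible_advantageBound {κ₁ κ₂ : ℕ → ℕ} (h₁ : Negligible fun κ => ((2 : ℝ) ^ κ₁ κ)⁻¹)
    (h₂ : Negligible fun κ => ((2 : ℝ) ^ κ₂ κ)⁻¹) (P : Polynomial ℕ) :
    Negligible fun κ => advantageBound (κ₁ κ) (κ₂ κ) (P.eval κ) (P.eval κ) := by
  have e : ∀ κ : ℕ, ((P.eval κ : ℕ) : ℝ) = (P.map (Nat.castRingHom ℝ)).eval (κ : ℝ) := fun κ => by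
    rw [Polynomial.eval_natCast_map]; rfl
  have a₂ := Asymptotics.SuperpolynomialDecay.polynomial_mul h₂ ((P.map (Nat.castRingHom ℝ)) ^ 2)
  have a₁ := Asymptotics.SuperpolynomialDecay.polynomial_mul h₁ (P.map (Nat.castRingHom ℝ))
  refine (a₂.add a₁).congr fun κ => ?_
  simp only [advantageBound, e, Pi.add_apply, Polynomial.eval_pow]

theorem collisionBound_toReal_le {κ₁ κ₂ l₁ l₂ N q : ℕ} {D₁ : Dataset l₁} {D₂ : Dataset l₂}
    (h : D₁.size + D₂.size ≤ N) :
    (collisionBound κ₂ (D₁.ids ∪ D₂.ids).card + q * ((2 : ℝ≥0∞) ^ κ₁)⁻¹).toReal ≤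
      advantageBound κ₁ κ₂ N q := by
  have hN : (D₁.ids ∪ D₂.ids).card ≤ N := by
    refine (Finset.card_union_le _ _).trans ?_
    rwa [card_ids, card_ids]
  rw [ENNReal.toReal_add (collisionBound_ne_top _ _) (ENNReal.mul_ne_top (by simp) (by simp))]
  simp only [collisionBound, advantageBound, ENNReal.toReal_mul, ENNReal.toReal_pow,
    ENNReal.toReal_natCast, ENNReal.toReal_inv, ENNReal.toReal_ofNat]
  gcongr

theorem Indist.mono {κ₁ κ₂ q : ℕ} {α : Type} {ε ε' : ℝ} {E E' : Oracle κ₁ κ₂ → PMF α}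
    (h : Indist q ε E E') (hε : ε ≤ ε') : Indist q ε' E E' :=
  fun D hD => (h D hD).trans hε

end PSA

theorem theorem3 (κ₁ κ₂ : ℕ → ℕ)
    (hκ₁ : PSA.Negligible fun κ => ((2 : ℝ) ^ κ₁ κ)⁻¹)
    (hκ₂ : PSA.Negligible fun κ => ((2 : ℝ) ^ κ₂ κ)⁻¹) :
    ∃ S₁ S₂ S : PSA.PPT, ∀ P : Polynomial ℕ, ∃ ε : ℕ → ℝ, PSA.Negligible ε ∧
      ∀ (κ l₁ l₂ : ℕ) (D₁ : PSA.Dataset l₁) (D₂ : PSA.Dataset l₂),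
        D₁.size + D₂.size ≤ P.eval κ →
        PSA.Indist (P.eval κ) (ε κ)
          (PSA.real₁ (κ₁ κ) (κ₂ κ) D₁ D₂) (PSA.ideal₁ κ (κ₁ κ) (κ₂ κ) D₁ D₂ S₁) ∧
        PSA.Indist (P.eval κ) (ε κ)
          (PSA.real₂ (κ₁ κ) (κ₂ κ) D₁ D₂) (PSA.ideal₂ κ (κ₁ κ) (κ₂ κ) D₁ D₂ S₂) ∧
        PSA.Indist (P.eval κ) (ε κ)
          (PSA.realS (κ₁ κ) (κ₂ κ) D₁ D₂) (PSA.idealS κ (κ₁ κ) (κ₂ κ) D₁ D₂ S) := by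
  refine ⟨(PSA.partyCmd false).toPPT, (PSA.partyCmd true).toPPT, PSA.serverCmd.toPPT, fun P =>
    ⟨_, PSA.negligible_advantageBound hκ₁ hκ₂ P, fun κ l₁ l₂ D₁ D₂ h => ?_⟩⟩
  have bound := PSA.collisionBound_toReal_le (κ₁ := κ₁ κ) (κ₂ := κ₂ κ) (q := P.eval κ) h
  -- The bound for a data owner is that for the server without the query term, so one negligible
  -- function serves all three claims.
  have owner : (PSA.collisionBound (κ₂ κ) (D₁.ids ∪ D₂.ids).card).toReal ≤
      PSA.advantageBound (κ₁ κ) (κ₂ κ) (P.eval κ) (P.eval κ) :=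
    (ENNReal.toReal_mono (ENNReal.add_ne_top.2 ⟨PSA.collisionBound_ne_top _ _,
      ENNReal.mul_ne_top (by simp) (by simp)⟩) le_self_add).trans bound
  exact ⟨(PSA.indist_owner₁ _).mono owner, (PSA.indist_owner₂ _).mono owner,
    (PSA.indist_server _).mono bound⟩
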